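/- **Setting.** Let $\mathcal M$ be a von Neumann algebra with a normal semifinite faithful trace $\tau$, and write $|x|^2=x^*x$. $L_p(\mathcal M)$ is the completion of $\{x\in\mathcal M:\tau(|x|^p)<\infty\}$ for the norm $\tau(|x|^p)^{1/p}$. Let $\mathcal S=(S_t)_{t\ge 0}$ be a bounded semigroup on $\mathcal M$: $S_0=I$, $S_{s+t}=S_sS_t$, $\sup_t\|S_t\|<\infty$, every $S_t$ is weak-$*$ continuous and completely positive, $\tau(S_t(f)g)=\tau(fS_t(g))$ for $f,g\in\mathcal M\cap L_1(\mathcal M)$, and $t\mapsto S_t f$ is weak-$*$ continuous for every $f$. Write $S_t=e^{-tL}$ on $L_2(\mathcal M)$ with $L\ge 0$ self-adjoint, and $F(L)=\int_0^\infty F\,dE_L$. Let $C_b^\infty$ be the set of bounded functions $F:[0,\infty)\to\mathbb C$ with bounded derivatives of all orders. Let $\mathcal A_{\mathcal M}\subset\mathcal M$ be a weak-$*$ dense subalgebra that is contained and dense in $L_p(\mathcal M)$ for $1<p<\infty$, and with $F(L)\mathcal A_{\mathcal M}\subset\mathcal A_{\mathcal M}$ for all $F\in C_b^\infty$. *P-metric.*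 Let $m\ge 2$ be real and $\mathcal Q=\{(R_{j,t},\sigma_{j,t}):j\in\mathbb N,\,t>0\}$, where $R_{j,t}:\mathcal M\to\mathcal M$ are normal completely positive unital maps that fix every $f$ with $S_sf=f$ for all $s$, and $\sigma_{j,t}\in\mathcal M$, such that with a constant $C$ independent of $j,t,\xi$ $$S_t(|\xi|^2)\le\sum_{j\ge0}\sigma_{j,t}^*R_{j,t^{1/m}}(|\xi|^2)\sigma_{j,t},\qquad \|R_{j,t}(|\xi|^2)\|\le C\|R_{0,t}(|\xi|^2)\|,\qquad \sup_{t>0}\Big\|\sum_{j\ge 0}|\sigma_{j,t}|^2\Big\|<\infty$$ for all $j\in\mathbb N$, $t>0$, $\xi\in\mathcal M$ (series in the weak-$*$ topology). Put $R_t=R_{0,t}$. *Form of $R_r$.* Let $\rho_1,\rho_2:\mathcal M\to\mathcal N$ be unital injective $*$-homomorphisms into a von Neumann algebra $\mathcal N$, let $E$ be a normal operator-valued weight from $\mathcal N_+$ to the extended positive part of $\rho_1(\mathcal M)\simeq\mathcal M$, and let $(q_r)_{r>0}$ be increasing projections in $\mathcal N$ such that $E(q_r)\in\mathcal M$ is invertible.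 Assume $$R_rf=E(q_r)^{-1/2}E(q_r\rho_2(f)q_r)E(q_r)^{-1/2}\qquad(r>0,\ f\in\mathcal M).$$ Elements of $\mathcal M$ act on $\mathcal N$ through $\rho_1$. Let $L_\infty^c=\{f\in\mathcal N:\|f\|_c:=\|E(|f|^2)\|^{1/2}<\infty\}$ and $V=L_\infty^c+\rho_2(\mathcal A_{\mathcal M})$. We say $f_i\to f$ strongly if $\tau(b^*E(|f_i-f|^2)b)\to0$ for all $b\in L_2(\mathcal M)$. Let $\pi$ be an algebra homomorphism from $\{F(L):F\in C_b^\infty\}$ to the linear operators on $V$ with $\pi(F(L))\circ\rho_2=\rho_2\circ F(L)$ on $\mathcal A_{\mathcal M}$. Put $b_{1,r}=q_{2r}$ and $b_{k,r}=q_{2^kr}-q_{2^{k-1}r}$ for $k\ge2$; $E_1(x)=1$ and $E_k(x)=\exp(2^{mk/(m-1)}x)$ for $k\ge2$. *Conditions.* 1. (ALi) $E(b_{k,r}|\xi|^2b_{k,r})\le E(|\xi|^2)$ for $k\ge1$, $r>0$, $\xi\in\mathcal N$. 2. (ALii) $\pi(F(L))(\eta E(q_r)^{-1/2})=\pi(F(L))(\eta)E(q_r)^{-1/2}$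 for $\eta\in L_\infty^c$, $F\in C_b^\infty$, $r>0$. 3. (Ti) $\pi(F(L))(fq_s)q_rE(q_r)^{-1/2}\to\pi(F(L))(f)q_rE(q_r)^{-1/2}$ strongly as $s\to\infty$, for $r>0$, $F\in\mathcal S(\mathbb R)$, $f\in V$. 4. (Tii) If $F_k\to F$ pointwise, $F_k,F\in\mathcal S(\mathbb R)$ and $\sup_k\|F_k\|_\infty<\infty$, then $\pi(F_k(L))(f)q_rE(q_r)^{-1/2}\to\pi(F(L))(f)q_rE(q_r)^{-1/2}$ strongly for $r>0$, $f\in V$. 5. (Oi) $\|\pi(F(L))\eta\|_c\le\sup_{[0,\infty)}|F|\,\|\eta\|_c$ for $F\in C_b^\infty$, $\eta\in L_\infty^c$. 6. (Oii) There are $C,c>0$ such that for all $t>0$, $k\ge1$, $0<r_1\le r_2$, $f\in\mathcal N$, $$\big\|\pi(e^{-tL})(fb_{k,r_2})q_{r_1}E(q_{r_1})^{-1/2}\big\|_c\le C\,E_k\Big(-c\big(r_2t^{-1/m}\big)^{\frac m{m-1}}\Big)\big\|fb_{k,r_2}E(q_{\max\{r_1,t^{1/m}\}})^{-1/2}\big\|_c.$$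 7. (ANi) There are $C,n>0$ and $D\ge0$ such that for all $r_1\ge r_2\ge r_3>0$ and all $f\in\mathcal A_{\mathcal M}\cup\{1\}$, $$\Big\|E\big(|\rho_2(f)q_{r_1}E(q_{r_3})^{-1/2}|^2\big)\Big\|\le C\Big(\frac{r_1}{r_2}\Big)^D\Big(\frac{r_1}{r_3}\Big)^n\Big\|E\big(|\rho_2(f)q_{r_2}E(q_{r_2})^{-1/2}|^2\big)\Big\|.$$ **Proposition.** For an integer $M\ge1$ let $$\|f\|_{BMO^c_{\mathcal Q,M}}=\sup_{t>0}\big\|R_{t^{1/m}}|(I-S_t)^Mf|^2\big\|^{1/2}.$$ Under the assumptions above, for every integer $M\ge1$ there is a constant $C>0$, independent of $f$, such that for all $f\in\mathcal A_{\mathcal M}$ $$C^{-1}\|f\|_{BMO^c_{\mathcal Q,M}}\le\|f\|_{BMO^c_{\mathcal Q,1}}\le C\,\|f\|_{BMO^c_{\mathcal Q,M}}.$$ -/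

import Mathlib

open Filter Topology
open scoped ENNReal NNReal ComplexOrder ContDiff SchwartzMap CStarAlgebra InnerProductSpace
  ComplexStarModule

noncomputable section

/-! ### Suprema of directed sets -/

/-- Suprema of increasing directed families are additive. -/
theorem isLUB_add_of_directed {ι G : Type*} [Preorder ι] [AddCommGroup G] [PartialOrder G]
    [IsOrderedAddMonoid G] {D : Set ι} (hD : DirectedOn (· ≤ ·) D) {f g : ι → G}
    (hf : MonotoneOn f D) (hg : MonotoneOn g D) {a b : G} (ha : IsLUB (f '' D) a)
    (hb : IsLUB (g '' D) b) : IsLUB ((fun i => f i + g i) '' D) (a + b) := by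
  constructor
  · rintro _ ⟨i, hi, rfl⟩
    exact add_le_add (ha.1 ⟨i, hi, rfl⟩) (hb.1 ⟨i, hi, rfl⟩)
  · intro u hu
    have key : ∀ i ∈ D, ∀ j ∈ D, f i + g j ≤ u := by
      intro i hi j hj
      obtain ⟨k, hk, hik, hjk⟩ := hD i hi j hj
      exact (add_le_add (hf hi hk hik) (hg hj hk hjk)).trans (hu ⟨k, hk, rfl⟩)
    have h1 : ∀ i ∈ D, b ≤ u - f i := by
      intro i hi
      refine hb.2 ?_
      rintro _ ⟨j, hj, rfl⟩
      exact le_sub_iff_add_le'.2 (key i hi j hj)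
    have h2 : a ≤ u - b := by
      refine ha.2 ?_
      rintro _ ⟨i, hi, rfl⟩
      exact le_sub_comm.1 (h1 i hi)
    exact le_sub_iff_add_le.1 h2

/-- `|x|^2 = x* x`. -/
def absSq {N : Type*} [Mul N] [Star N] (x : N) : N := star x * x

section Conj

/-- Averaging identity for compressions. -/
theorem conj_average {M : Type*} [CStarAlgebra M] (a x : M) (c : ℝ) :
    ((star (a + (c : ℂ) • 1) * x * (a + (c : ℂ) • 1)
      + star (a + (-c : ℂ) • 1) * x * (a + (-c : ℂ) • 1))
      + (star (a + (c * Complex.I : ℂ) • 1) * x * (a + (c * Complex.I : ℂ) • 1)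
      + star (a + (-(c * Complex.I) : ℂ) • 1) * x * (a + (-(c * Complex.I) : ℂ) • 1)))
      = (4 : ℝ) • (star a * x * a) + (4 * c ^ 2 : ℝ) • x := by
  have h : ∀ z : ℂ, star (a + z • (1 : M)) * x * (a + z • 1)
      = star a * x * a + z • (star a * x) + star z • (x * a) + (star z * z) • x := by
    intro z
    simp only [star_add, star_smul, star_one, add_mul, mul_add, smul_mul_assoc, mul_smul_comm,
      one_mul, mul_one, smul_add, smul_smul]
    abel_nf
    simp [mul_comm]
  simp only [h]
  have e1 : star (c : ℂ) = c := by simp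
  have e2 : star (-c : ℂ) = -c := by simp
  have e3 : star (c * Complex.I : ℂ) = -(c * Complex.I) := by simp
  have e4 : star (-(c * Complex.I) : ℂ) = c * Complex.I := by simp
  rw [e1, e2, e3, e4]
  have e5 : -((c : ℂ) * Complex.I) * (c * Complex.I) = (c : ℂ) * c := by
    linear_combination (-(c:ℂ) * c) * Complex.I_mul_I
  have e6 : ((c : ℂ) * Complex.I) * -(c * Complex.I) = (c : ℂ) * c := by
    linear_combination (-(c:ℂ) * c) * Complex.I_mul_I
  rw [e5, e6, neg_mul_neg]
  have e7 : (4 * c ^ 2 : ℝ) • x = (4 * (c * c) : ℂ) • x := by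
    rw [← Complex.coe_smul]; congr 1; push_cast; ring
  have e8 : (4 : ℝ) • (star a * x * a) = (4 : ℂ) • (star a * x * a) := by
    rw [← Complex.coe_smul]; congr 1
  rw [e7, e8]
  module

variable {M : Type*} [CStarAlgebra M] [PartialOrder M] [StarOrderedRing M]

/-- Conjugation by an arbitrary element preserves suprema of directed sets. -/
theorem isLUB_conj (a : M) {D : Set M} {s : M}
    (hD : DirectedOn (· ≤ ·) D) (hs : IsLUB D s) :
    IsLUB ((fun x => star a * x * a) '' D) (star a * s * a) := by
  have mono : ∀ b : M, Monotone (fun x => star b * x * b) := fun b x y h =>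
    star_left_conjugate_le_conjugate h b
  have hunit : ∀ b : M, IsUnit b →
      IsLUB ((fun x => star b * x * b) '' D) (star b * s * b) := by
    intro b hb
    obtain ⟨u, rfl⟩ := hb
    refine ⟨?_, ?_⟩
    · rintro _ ⟨x, hx, rfl⟩
      exact mono _ (hs.1 hx)
    · intro v hv
      have : s ≤ star (↑u⁻¹ : M) * v * (↑u⁻¹ : M) := by
        refine hs.2 fun x hx => ?_
        have h1 := mono (↑u⁻¹ : M) (hv ⟨x, hx, rfl⟩)
        have h2 : star (↑u⁻¹ : M) * (star (u : M) * x * u) * (↑u⁻¹ : M) = x := by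
          have : star (↑u⁻¹ : M) * star (u : M) = 1 := by rw [← star_mul]; simp
          calc _ = (star (↑u⁻¹ : M) * star (u : M)) * x * ((u : M) * (↑u⁻¹ : M)) := by
                simp only [mul_assoc]
            _ = x := by rw [this]; simp
        simpa only [h2] using h1
      have h3 := mono (u : M) this
      have h4 : star (u : M) * (star (↑u⁻¹ : M) * v * (↑u⁻¹ : M)) * u = v := by
        have : star (u : M) * star (↑u⁻¹ : M) = 1 := by rw [← star_mul]; simp
        calc _ = (star (u : M) * star (↑u⁻¹ : M)) * v * ((↑u⁻¹ : M) * (u : M)) := by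
              simp only [mul_assoc]
          _ = v := by rw [this]; simp
      simpa only [h4] using h3
  refine ⟨?_, ?_⟩
  · rintro _ ⟨x, hx, rfl⟩
    exact mono a (hs.1 hx)
  intro v hv
  set c : ℝ := ‖a‖ + 1 with hc
  have hu : ∀ z : ℂ, ‖z‖ = c → IsUnit (a + z • (1 : M)) := by
    intro z hz
    by_cases hM : Nontrivial M
    · have : -z ∉ spectrum ℂ a := by
        intro hmem
        have := spectrum.norm_le_norm_of_mem hmem
        rw [norm_neg, hz] at this
        linarith
      rw [spectrum.notMem_iff] at this
      have h5 := this.neg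
      convert h5 using 1
      rw [Algebra.algebraMap_eq_smul_one]
      module
    · rw [not_nontrivial_iff_subsingleton] at hM
      exact isUnit_of_subsingleton _
  have hc0 : 0 ≤ c := by positivity
  have n1 : ‖(c : ℂ)‖ = c := by simp [abs_of_nonneg hc0]
  have n2 : ‖(-c : ℂ)‖ = c := by simp [abs_of_nonneg hc0]
  have n3 : ‖(c * Complex.I : ℂ)‖ = c := by simp [abs_of_nonneg hc0]
  have n4 : ‖(-(c * Complex.I) : ℂ)‖ = c := by simp [abs_of_nonneg hc0]
  have mo : ∀ b : M, MonotoneOn (fun x => star b * x * b) D := fun b => (mono b).monotoneOn _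
  have L := isLUB_add_of_directed hD ((mo _).add (mo _)) ((mo _).add (mo _))
    (isLUB_add_of_directed hD (mo _) (mo _) (hunit _ (hu _ n1)) (hunit _ (hu _ n2)))
    (isLUB_add_of_directed hD (mo _) (mo _) (hunit _ (hu _ n3)) (hunit _ (hu _ n4)))
  rw [conj_average a s c] at L
  have h6 : (4 : ℝ) • (star a * s * a) + (4 * c ^ 2 : ℝ) • s
      ≤ (4 : ℝ) • v + (4 * c ^ 2 : ℝ) • s := by
    refine L.2 ?_
    rintro _ ⟨x, hx, rfl⟩
    have := conj_average a x c
    simp only at this ⊢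
    rw [this]
    exact add_le_add (smul_le_smul_of_nonneg_left (hv ⟨x, hx, rfl⟩) (by norm_num))
      (smul_le_smul_of_nonneg_left (hs.1 hx) (by positivity))
  have h7 := le_of_add_le_add_right h6
  have h8 := smul_le_smul_of_nonneg_left h7 (by norm_num : (0:ℝ) ≤ 1 / 4)
  simpa [smul_smul] using h8

end Conj

/-! ### Normal functionals, the weak-star topology, the extended positive part -/

section Normal

variable (M : Type*) [CStarAlgebra M] [PartialOrder M] [StarOrderedRing M]

/-- A functional is normal if it preserves suprema of bounded increasing nets of positive
elements. -/
def IsNormalFunctional {M : Type*} [CStarAlgebra M] [PartialOrder M] (φ : StrongDual ℂ M) : Prop :=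
  ∀ (D : Set M) (s : M), D.Nonempty → DirectedOn (· ≤ ·) D → (∀ a ∈ D, 0 ≤ a) → IsLUB D s →
    IsLUB ((fun a => (φ a).re) '' D) (φ s).re

/-- The positive part `M_{*,+}` of the predual: the positive normal functionals. -/
@[ext] structure NormalPos where
  /-- the underlying bounded functional -/
  toDual : StrongDual ℂ M
  nonneg : ∀ a : M, 0 ≤ a → 0 ≤ toDual a
  normal : IsNormalFunctional toDual

namespace NormalPos

/-- The topology of the dual norm. -/
instance : TopologicalSpace (NormalPos M) := TopologicalSpace.induced toDual inferInstance

variable {M}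

theorem continuous_toDual : Continuous (toDual : NormalPos M → StrongDual ℂ M) :=
  continuous_induced_dom

theorem re_mono (φ : NormalPos M) : Monotone fun a => (φ.toDual a).re := by
  intro a b h
  have := φ.nonneg (b - a) (sub_nonneg.2 h)
  rw [map_sub] at this
  have := (Complex.le_def.1 this).1
  simpa using this

instance : Add (NormalPos M) where
  add φ ψ :=
    { toDual := φ.toDual + ψ.toDual
      nonneg := fun a ha => add_nonneg (φ.nonneg a ha) (ψ.nonneg a ha)
      normal := fun D s hne hD h0 hs => by
        have := isLUB_add_of_directed hD (φ.re_mono.monotoneOn D) (ψ.re_mono.monotoneOn D)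
          (φ.normal D s hne hD h0 hs) (ψ.normal D s hne hD h0 hs)
        exact this }

theorem toDual_add (φ ψ : NormalPos M) : (φ + ψ).toDual = φ.toDual + ψ.toDual := rfl

instance : SMul ℝ≥0 (NormalPos M) where
  smul c φ :=
    { toDual := ((c : ℝ) : ℂ) • φ.toDual
      nonneg := fun a ha => by
        have h := φ.nonneg a ha
        have hc : (0 : ℂ) ≤ ((c : ℝ) : ℂ) := by exact_mod_cast c.2
        exact mul_nonneg hc h
      normal := fun D s hne hD h0 hs => by
        have h := φ.normal D s hne hD h0 hs
        have e : ∀ x : M, ((((c : ℝ) : ℂ) • φ.toDual) x).re = (c : ℝ) * (φ.toDual x).re := by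
          intro x; simp
        simp only [e]
        refine ⟨?_, fun u hu => ?_⟩
        · rintro _ ⟨x, hx, rfl⟩
          exact mul_le_mul_of_nonneg_left (h.1 ⟨x, hx, rfl⟩) c.2
        · rcases eq_or_lt_of_le (NNReal.coe_nonneg c) with h0c | h0c
          · obtain ⟨x, hx⟩ := hne
            have := hu ⟨x, hx, rfl⟩
            simpa only [← h0c, zero_mul] using this
          · have : (φ.toDual s).re ≤ u / c := by
              refine h.2 ?_
              rintro _ ⟨x, hx, rfl⟩
              exact (le_div_iff₀' h0c).2 (hu ⟨x, hx, rfl⟩)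
            exact (le_div_iff₀' h0c).1 this }

theorem toDual_smul (c : ℝ≥0) (φ : NormalPos M) : (c • φ).toDual = ((c : ℝ) : ℂ) • φ.toDual := rfl

/-- The functional `a φ a* : x ↦ φ (a* x a)`. -/
def conj (a : M) (φ : NormalPos M) : NormalPos M where
  toDual := φ.toDual.comp ((ContinuousLinearMap.mul ℂ M (star a)).comp
      ((ContinuousLinearMap.mul ℂ M).flip a))
  nonneg x hx := φ.nonneg _ (by simpa [mul_assoc] using star_left_conjugate_nonneg hx a)
  normal D s hne hD h0 hs := by
    have h := φ.normal ((fun x => star a * x * a) '' D) (star a * s * a) (hne.image _)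
      (by
        rintro _ ⟨x, hx, rfl⟩ _ ⟨y, hy, rfl⟩
        obtain ⟨z, hz, hxz, hyz⟩ := hD x hx y hy
        exact ⟨_, ⟨z, hz, rfl⟩, star_left_conjugate_le_conjugate hxz a,
          star_left_conjugate_le_conjugate hyz a⟩)
      (by
        rintro _ ⟨x, hx, rfl⟩
        exact star_left_conjugate_nonneg (h0 x hx) a)
      (isLUB_conj a hD hs)
    rw [Set.image_image] at h
    simpa [mul_assoc] using h

theorem conj_apply (a : M) (φ : NormalPos M) (x : M) :
    (φ.conj a).toDual x = φ.toDual (star a * x * a) := by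
  simp [conj, mul_assoc]

theorem continuous_conj (a : M) : Continuous (conj a) := by
  refine continuous_induced_rng.2 ?_
  exact ((ContinuousLinearMap.compL ℂ M M ℂ).flip _).continuous.comp continuous_toDual

end NormalPos

/-- The weak-star topology `σ(M, M_*)`: the coarsest topology for which all normal positive
functionals (which span the predual) are continuous. -/
@[reducible] def weakStar : TopologicalSpace M :=
  ⨅ φ : NormalPos M, TopologicalSpace.induced (fun a => φ.toDual a) inferInstance

variable {M}

/-- The series `∑ x_j` converges to `s` in the weak-star topology. -/
def WeakStarSum (x : ℕ → M) (s : M) : Prop :=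
  ∀ φ : NormalPos M, HasSum (fun j => φ.toDual (x j)) (φ.toDual s)

variable (M)

/-- The extended positive part of `M`: lower semicontinuous, additive and positively homogeneous
maps `M_{*,+} → [0, ∞]`. -/
structure ExtPos where
  /-- the underlying map -/
  toFun : NormalPos M → ℝ≥0∞
  lsc : LowerSemicontinuous toFun
  map_add : ∀ φ ψ, toFun (φ + ψ) = toFun φ + toFun ψ
  map_smul : ∀ (c : ℝ≥0) φ, toFun (c • φ) = c * toFun φ

namespace ExtPos

variable {M}

/-- A positive element `a` of `M`, seen as the element `φ ↦ φ a` of the extended positive part. -/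
def ofPos (a : M) (ha : 0 ≤ a) : ExtPos M where
  toFun φ := ENNReal.ofReal (φ.toDual a).re
  lsc := by
    refine Continuous.lowerSemicontinuous (ENNReal.continuous_ofReal.comp
      (Complex.continuous_re.comp ?_))
    exact (ContinuousLinearMap.apply ℂ ℂ a).continuous.comp NormalPos.continuous_toDual
  map_add φ ψ := by
    have h1 := (Complex.le_def.1 (φ.nonneg a ha)).1
    have h2 := (Complex.le_def.1 (ψ.nonneg a ha)).1
    exact ENNReal.ofReal_add h1 h2
  map_smul c φ := by
    have : ((c • φ).toDual a).re = c * (φ.toDual a).re := by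
      simp [NormalPos.toDual_smul]
    rw [this, ENNReal.ofReal_mul (NNReal.coe_nonneg c)]
    simp

/-- The element `a* m a` of the extended positive part: `φ ↦ m (a φ a*)`. -/
def conj (a : M) (m : ExtPos M) : ExtPos M where
  toFun φ := m.toFun (φ.conj a)
  lsc := m.lsc.comp (NormalPos.continuous_conj a)
  map_add φ ψ := by
    have : (φ + ψ).conj a = φ.conj a + ψ.conj a := NormalPos.ext rfl
    rw [this, m.map_add]
  map_smul c φ := by
    have : (c • φ).conj a = c • φ.conj a := NormalPos.ext rfl
    rw [this, m.map_smul]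

end ExtPos

end Normal

/-! ### Traces and noncommutative `L_p` spaces -/

/-- A normal semifinite faithful trace on `M_+`. Only the values at positive elements matter. -/
structure SemifiniteTrace (M : Type*) [CStarAlgebra M] [PartialOrder M] [StarOrderedRing M] where
  /-- the trace of a positive element -/
  toFun : M → ℝ≥0∞
  map_add : ∀ x y, 0 ≤ x → 0 ≤ y → toFun (x + y) = toFun x + toFun y
  map_smul : ∀ (c : ℝ≥0) x, 0 ≤ x → toFun (c • x) = c * toFun x
  tracial : ∀ x, toFun (star x * x) = toFun (x * star x)
  faithful : ∀ x, 0 ≤ x → toFun x = 0 → x = 0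
  normal : ∀ (D : Set M) (s : M), D.Nonempty → DirectedOn (· ≤ ·) D → (∀ a ∈ D, 0 ≤ a) →
    IsLUB D s → IsLUB (toFun '' D) (toFun s)
  semifinite : ∀ x, 0 ≤ x →
    IsLUB {r | ∃ y, 0 ≤ y ∧ y ≤ x ∧ toFun y < ⊤ ∧ r = toFun y} (toFun x)

namespace SemifiniteTrace

theorem sq_smul {M : Type*} [CStarAlgebra M] (c : ℂ) (x : M) : star (c • x) * (c • x) = (‖c‖ ^ 2 : ℝ) • (star x * x) := by
  rw [star_smul, smul_mul_smul_comm]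
  have : star c * c = ((‖c‖ ^ 2 : ℝ) : ℂ) := by
    rw [Complex.star_def, Complex.conj_mul']; push_cast; rfl
  rw [this, Complex.coe_smul]

theorem parallelogram {M : Type*} [CStarAlgebra M] (x y : M) {c : ℝ} (hc : 0 < c) :
    star (x + y) * (x + y) + star (c • x - c⁻¹ • y) * (c • x - c⁻¹ • y)
      = (1 + c ^ 2) • (star x * x) + (1 + (c⁻¹) ^ 2) • (star y * y) := by
  simp only [star_add, star_sub, star_smul, star_trivial, add_mul, mul_add, sub_mul, mul_sub,
    smul_mul_smul_comm, mul_inv_cancel₀ hc.ne', inv_mul_cancel₀ hc.ne']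
  module

variable {M : Type*} [CStarAlgebra M] [PartialOrder M] [StarOrderedRing M]
  (τ : SemifiniteTrace M)

theorem mono {x y : M} (hx : 0 ≤ x) (h : x ≤ y) : τ.toFun x ≤ τ.toFun y := by
  have := τ.map_add x (y - x) hx (sub_nonneg.2 h)
  rw [add_sub_cancel] at this
  rw [this]
  exact le_self_add

theorem map_real_smul {c : ℝ} (hc : 0 ≤ c) {x : M} (hx : 0 ≤ x) :
    τ.toFun (c • x) = ENNReal.ofReal c * τ.toFun x := by
  have := τ.map_smul c.toNNReal x hx
  rwa [NNReal.smul_def, Real.coe_toNNReal c hc] at this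

theorem trace_parallelogram (x y : M) {c : ℝ} (hc : 0 < c) :
    τ.toFun (star (x + y) * (x + y)) + τ.toFun (star (c • x - c⁻¹ • y) * (c • x - c⁻¹ • y))
      = ENNReal.ofReal (1 + c ^ 2) * τ.toFun (star x * x)
        + ENNReal.ofReal (1 + (c⁻¹) ^ 2) * τ.toFun (star y * y) := by
  rw [← τ.map_add _ _ (star_mul_self_nonneg _) (star_mul_self_nonneg _), parallelogram x y hc,
    τ.map_add _ _ (smul_nonneg (by positivity) (star_mul_self_nonneg _))
      (smul_nonneg (by positivity) (star_mul_self_nonneg _)),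
    τ.map_real_smul (by positivity) (star_mul_self_nonneg _),
    τ.map_real_smul (by positivity) (star_mul_self_nonneg _)]

theorem trace_sq_smul (c : ℂ) (x : M) :
    τ.toFun (star (c • x) * (c • x)) = ENNReal.ofReal (‖c‖ ^ 2) * τ.toFun (star x * x) := by
  rw [sq_smul, τ.map_real_smul (by positivity) (star_mul_self_nonneg _)]

theorem trace_zero : τ.toFun 0 = 0 := by
  simpa using τ.map_smul 0 0 le_rfl

/-- The space `M ∩ L_2(M) = {x : τ(|x|^2) < ⊤}`. -/
def sqInt : Submodule ℂ M where
  carrier := {x | τ.toFun (star x * x) < ⊤}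
  zero_mem' := by simp [trace_zero]
  add_mem' {x y} hx hy := by
    have h := τ.trace_parallelogram x y one_pos
    refine lt_of_le_of_lt (le_self_add.trans h.le) ?_
    exact ENNReal.add_lt_top.2 ⟨ENNReal.mul_lt_top ENNReal.ofReal_lt_top hx,
      ENNReal.mul_lt_top ENNReal.ofReal_lt_top hy⟩
  smul_mem' c x hx := by
    change τ.toFun _ < ⊤
    rw [trace_sq_smul]
    exact ENNReal.mul_lt_top ENNReal.ofReal_lt_top hx

/-- The space `M ∩ L_2(M)` with the norm `‖x‖ = τ(|x|^2)^{1/2}`. -/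
def PreL2 : Type _ := τ.sqInt

namespace PreL2

variable {τ}

instance : AddCommGroup τ.PreL2 := inferInstanceAs (AddCommGroup τ.sqInt)
instance : Module ℂ τ.PreL2 := inferInstanceAs (Module ℂ τ.sqInt)

/-- The underlying element of `M`. -/
def val : τ.PreL2 →ₗ[ℂ] M := τ.sqInt.subtype

/-- The element of `L_2` given by a square integrable element of `M`. -/
def mk (x : M) (hx : τ.toFun (star x * x) < ⊤) : τ.PreL2 := ⟨x, hx⟩

theorem val_mk (x : M) (hx : τ.toFun (star x * x) < ⊤) : val (mk x hx) = x := rfl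

theorem lt_top (x : τ.PreL2) : τ.toFun (star (val x) * val x) < ⊤ := x.2

theorem val_injective : Function.Injective (val (τ := τ)) := Subtype.val_injective

instance : Norm τ.PreL2 := ⟨fun x => √(τ.toFun (star (val x) * val x)).toReal⟩

theorem norm_def (x : τ.PreL2) : ‖x‖ = √(τ.toFun (star (val x) * val x)).toReal := rfl

theorem norm_sq (x : τ.PreL2) : ‖x‖ ^ 2 = (τ.toFun (star (val x) * val x)).toReal := by
  rw [norm_def, Real.sq_sqrt ENNReal.toReal_nonneg]

theorem smul_norm (c : ℂ) (x : τ.PreL2) : ‖c • x‖ = ‖c‖ * ‖x‖ := by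
  rw [norm_def, norm_def, _root_.map_smul, trace_sq_smul, ENNReal.toReal_mul,
    ENNReal.toReal_ofReal (by positivity), Real.sqrt_mul (by positivity),
    Real.sqrt_sq (norm_nonneg _)]

theorem parallelogram_sq (x y : τ.PreL2) {c : ℝ} (hc : 0 < c) :
    ‖x + y‖ ^ 2 + ‖(c : ℂ) • x - ((c⁻¹ : ℝ) : ℂ) • y‖ ^ 2
      = (1 + c ^ 2) * ‖x‖ ^ 2 + (1 + (c⁻¹) ^ 2) * ‖y‖ ^ 2 := by
  simp only [norm_sq, _root_.map_add, _root_.map_sub, _root_.map_smul]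
  simp only [Complex.coe_smul]
  have h := τ.trace_parallelogram (val x) (val y) hc
  have hz : τ.toFun (star (c • val x - c⁻¹ • val y) * (c • val x - c⁻¹ • val y)) < ⊤ := by
    have := lt_top ((c : ℂ) • x - ((c⁻¹ : ℝ) : ℂ) • y)
    rw [_root_.map_sub, _root_.map_smul, _root_.map_smul] at this
    simpa only [Complex.coe_smul] using this
  have hs : τ.toFun (star (val x + val y) * (val x + val y)) < ⊤ := by
    have := lt_top (x + y)
    simpa only [_root_.map_add] using this
  have h' := congrArg ENNReal.toReal h
  rw [ENNReal.toReal_add hs.ne hz.ne, ENNReal.toReal_add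
    (ENNReal.mul_lt_top ENNReal.ofReal_lt_top (lt_top x)).ne
    (ENNReal.mul_lt_top ENNReal.ofReal_lt_top (lt_top y)).ne, ENNReal.toReal_mul,
    ENNReal.toReal_mul, ENNReal.toReal_ofReal (by positivity),
    ENNReal.toReal_ofReal (by positivity)] at h'
  exact h'

theorem norm_nonneg' (x : τ.PreL2) : 0 ≤ ‖x‖ := Real.sqrt_nonneg _

theorem eq_zero_of_norm {x : τ.PreL2} (h : ‖x‖ = 0) : x = 0 := by
  have h2 := norm_sq x
  rw [h, zero_pow two_ne_zero, eq_comm, ENNReal.toReal_eq_zero_iff] at h2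
  have h3 := h2.resolve_right (lt_top x).ne
  have h4 := τ.faithful _ (star_mul_self_nonneg _) h3
  exact val_injective (by rw [CStarRing.star_mul_self_eq_zero_iff] at h4; rw [h4, map_zero])

theorem core : NormedSpace.Core ℂ τ.PreL2 where
  norm_nonneg := norm_nonneg'
  norm_smul := smul_norm
  norm_triangle x y := by
    by_cases hx : ‖x‖ = 0
    · rw [hx, eq_zero_of_norm hx, zero_add, zero_add]
    by_cases hy : ‖y‖ = 0
    · rw [hy, eq_zero_of_norm hy, add_zero, add_zero]
    have px : 0 < ‖x‖ := lt_of_le_of_ne (norm_nonneg' x) (Ne.symm hx)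
    have py : 0 < ‖y‖ := lt_of_le_of_ne (norm_nonneg' y) (Ne.symm hy)
    have h := parallelogram_sq x y (c := √(‖y‖ / ‖x‖)) (by positivity)
    rw [inv_pow, Real.sq_sqrt (by positivity)] at h
    have h2 : (1 + ‖y‖ / ‖x‖) * ‖x‖ ^ 2 + (1 + (‖y‖ / ‖x‖)⁻¹) * ‖y‖ ^ 2 = (‖x‖ + ‖y‖) ^ 2 := by
      field_simp
      ring
    rw [h2] at h
    refine le_of_sq_le_sq ?_ (by positivity)
    rw [← h]
    exact le_add_of_nonneg_right (sq_nonneg _)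
  norm_eq_zero_iff x := by
    refine ⟨eq_zero_of_norm, ?_⟩
    rintro rfl
    simp [norm_def, trace_zero]

instance : NormedAddCommGroup τ.PreL2 := NormedAddCommGroup.ofCore core
instance : NormedSpace ℂ τ.PreL2 := NormedSpace.ofCore core

/-- The inner product `⟪x, y⟫ = τ(x* y)`, the one that polarizes `‖x‖² = τ(|x|^2)`. -/
instance : InnerProductSpace ℂ τ.PreL2 := InnerProductSpace.ofNorm ℂ fun x y => by
  have h := parallelogram_sq x y one_pos
  simp only [inv_one, Complex.ofReal_one, one_smul] at h
  linarith


theorem trace_mul_lt_top (a : M) (x : τ.PreL2) : τ.toFun (star (a * val x) * (a * val x)) ≤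
    ENNReal.ofReal (‖a‖ ^ 2) * τ.toFun (star (val x) * val x) := by
  rw [← τ.map_real_smul (by positivity) (star_mul_self_nonneg _)]
  refine τ.mono (star_mul_self_nonneg _) ?_
  have h := CStarAlgebra.star_left_conjugate_le_norm_smul (a := val x) (b := star a * a)
    (IsSelfAdjoint.star_mul_self a)
  rw [CStarRing.norm_star_mul_self, ← sq] at h
  simpa only [star_mul, mul_assoc] using h

/-- Left multiplication by `a ∈ M` on `M ∩ L_2(M)`. -/
def lmul (a : M) : τ.PreL2 →L[ℂ] τ.PreL2 :=
  LinearMap.mkContinuous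
    { toFun := fun x => mk (a * val x)
        (lt_of_le_of_lt (trace_mul_lt_top a x) (ENNReal.mul_lt_top ENNReal.ofReal_lt_top (lt_top x)))
      map_add' := fun x y => val_injective (by simp [val_mk, mul_add])
      map_smul' := fun c x => val_injective (by simp [val_mk]) } ‖a‖ fun x => by
    refine le_of_sq_le_sq ?_ (by positivity)
    rw [mul_pow, norm_sq, norm_sq]
    have h := ENNReal.toReal_mono
      (ENNReal.mul_lt_top ENNReal.ofReal_lt_top (lt_top x)).ne (trace_mul_lt_top a x)
    rw [ENNReal.toReal_mul, ENNReal.toReal_ofReal (by positivity)] at h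
    exact h

theorem val_lmul (a : M) (x : τ.PreL2) : val (lmul a x) = a * val x := rfl

theorem norm_lmul_le (a : M) : ‖(lmul a : τ.PreL2 →L[ℂ] τ.PreL2)‖ ≤ ‖a‖ :=
  LinearMap.mkContinuous_norm_le _ (norm_nonneg _) _

theorem lmul_add (a b : M) : (lmul (a + b) : τ.PreL2 →L[ℂ] τ.PreL2) = lmul a + lmul b := by
  ext x
  exact val_injective (by simp [val_lmul, add_mul])

theorem lmul_smul (c : ℂ) (a : M) : (lmul (c • a) : τ.PreL2 →L[ℂ] τ.PreL2) = c • lmul a := by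
  ext x
  exact val_injective (by simp [val_lmul])

theorem re_inner_eq (x y : τ.PreL2) : 4 * (⟪x, y⟫_ℂ).re = ‖x + y‖ ^ 2 - ‖x - y‖ ^ 2 := by
  have h1 := norm_add_sq (𝕜 := ℂ) x y
  have h2 := norm_sub_sq (𝕜 := ℂ) x y
  simp only [RCLike.re_to_complex] at h1 h2
  linarith

theorem re_inner_lmul (a : M) (x y : τ.PreL2) :
    (⟪lmul a x, y⟫_ℂ).re = (⟪x, lmul (star a) y⟫_ℂ).re := by
  have key : ‖lmul a x + y‖ ^ 2 + ‖x - lmul (star a) y‖ ^ 2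
      + (‖x‖ ^ 2 + ‖lmul (star a) y‖ ^ 2)
      = ‖lmul a x - y‖ ^ 2 + ‖x + lmul (star a) y‖ ^ 2
      + (‖x‖ ^ 2 + ‖lmul (star a) y‖ ^ 2) := by
    have e : star (val (lmul a x + y)) * val (lmul a x + y)
        + star (val (x - lmul (star a) y)) * val (x - lmul (star a) y)
        = star (val (lmul a x - y)) * val (lmul a x - y)
        + star (val (x + lmul (star a) y)) * val (x + lmul (star a) y) := by
      simp only [_root_.map_add, _root_.map_sub, val_lmul, star_add, star_sub, star_mul, star_star]
      noncomm_ring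
    have e2 := congrArg τ.toFun e
    rw [τ.map_add _ _ (star_mul_self_nonneg _) (star_mul_self_nonneg _),
      τ.map_add _ _ (star_mul_self_nonneg _) (star_mul_self_nonneg _)] at e2
    have e3 := congrArg ENNReal.toReal e2
    rw [ENNReal.toReal_add (lt_top _).ne (lt_top _).ne,
      ENNReal.toReal_add (lt_top _).ne (lt_top _).ne] at e3
    simp only [norm_sq]
    linarith
  have h1 := re_inner_eq (lmul a x) y
  have h2 := re_inner_eq x (lmul (star a) y)
  linarith

theorem inner_lmul (a : M) (x y : τ.PreL2) : ⟪lmul a x, y⟫_ℂ = ⟪x, lmul (star a) y⟫_ℂ := by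
  apply Complex.ext
  · exact re_inner_lmul a x y
  · have h := re_inner_lmul a x (Complex.I • y)
    rw [_root_.map_smul, inner_smul_right, inner_smul_right] at h
    simpa using h

end PreL2

/-- The Hilbert space `L_2(M)`: the completion of `{x ∈ M : τ(|x|^2) < ∞}` for the norm
`τ(|x|^2)^{1/2}`. -/
abbrev L2 : Type _ := UniformSpace.Completion τ.PreL2

/-- An element `x` of `M` represents the vector `v` of `L_2(M)`. -/
def Represents (x : M) (v : τ.L2) : Prop :=
  ∃ h : τ.toFun (star x * x) < ⊤, v = (PreL2.mk x h : τ.PreL2)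

theorem completion_add (S T : τ.PreL2 →L[ℂ] τ.PreL2) :
    (S + T).completion = S.completion + T.completion := by
  ext v
  induction v using UniformSpace.Completion.induction_on with
  | hp => exact isClosed_eq (by fun_prop) (by fun_prop)
  | ih x => simp [UniformSpace.Completion.coe_add]

theorem completion_smul (c : ℂ) (S : τ.PreL2 →L[ℂ] τ.PreL2) :
    (c • S).completion = c • S.completion := by
  ext v
  induction v using UniformSpace.Completion.induction_on with
  | hp =>
    exact isClosed_eq (ContinuousLinearMap.continuous _)
      ((ContinuousLinearMap.continuous _).const_smul c)
  | ih x =>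
    rw [smul_apply, ContinuousLinearMap.completion_apply_coe,
      ContinuousLinearMap.completion_apply_coe, smul_apply,
      UniformSpace.Completion.coe_smul]

theorem norm_completion_le (S : τ.PreL2 →L[ℂ] τ.PreL2) : ‖S.completion‖ ≤ ‖S‖ := by
  refine ContinuousLinearMap.opNorm_le_bound _ (norm_nonneg _) fun v => ?_
  induction v using UniformSpace.Completion.induction_on with
  | hp => exact isClosed_le (by fun_prop) (by fun_prop)
  | ih x =>
    rw [ContinuousLinearMap.completion_apply_coe, UniformSpace.Completion.norm_coe,
      UniformSpace.Completion.norm_coe]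
    exact S.le_opNorm x

/-- The action of `M` on `L_2(M)` by left multiplication. -/
def lmul : M →L[ℂ] τ.L2 →L[ℂ] τ.L2 :=
  LinearMap.mkContinuous
    { toFun := fun a => (PreL2.lmul a : τ.PreL2 →L[ℂ] τ.PreL2).completion
      map_add' := fun a b => by rw [PreL2.lmul_add, completion_add]
      map_smul' := fun c a => by rw [PreL2.lmul_smul, completion_smul, RingHom.id_apply] } 1
    fun a => by
      rw [one_mul]
      exact (τ.norm_completion_le _).trans (PreL2.norm_lmul_le a)

theorem lmul_coe (a : M) (x : τ.PreL2) : τ.lmul a x = (PreL2.lmul a x : τ.PreL2) := by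
  simp [lmul]

/-- The functional `a ↦ τ(b* a b) = ⟪b, a b⟫` on `M`, for `b ∈ L_2(M)`. -/
def vecDual (b : τ.L2) : StrongDual ℂ M := (innerSL ℂ b).comp (τ.lmul.flip b)

theorem vecDual_apply (b : τ.L2) (a : M) : τ.vecDual b a = ⟪b, τ.lmul a b⟫_ℂ := rfl

theorem continuous_vecDual : Continuous τ.vecDual := by
  unfold vecDual
  fun_prop

theorem vecDual_coe (x : τ.PreL2) {a : M} (ha : 0 ≤ a) :
    τ.vecDual x a = ((τ.toFun (star (PreL2.val x) * a * PreL2.val x)).toReal : ℂ) := by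
  obtain ⟨c, rfl⟩ := CStarAlgebra.nonneg_iff_eq_star_mul_self.1 ha
  have e : (PreL2.lmul (star c * c) x : τ.PreL2) = PreL2.lmul (star c) (PreL2.lmul c x) :=
    PreL2.val_injective (by simp [PreL2.val_lmul, mul_assoc])
  rw [vecDual_apply, lmul_coe, UniformSpace.Completion.inner_coe, e, ← PreL2.inner_lmul,
    inner_self_eq_norm_sq_to_K]
  have h := PreL2.norm_sq (PreL2.lmul c x)
  rw [PreL2.val_lmul, star_mul] at h
  rw [← RCLike.ofReal_pow, h]
  simp [mul_assoc]

theorem vecDual_nonneg (b : τ.L2) {a : M} (ha : 0 ≤ a) : 0 ≤ τ.vecDual b a := by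
  induction b using UniformSpace.Completion.induction_on with
  | hp =>
    refine isClosed_le continuous_const ?_
    exact (ContinuousLinearMap.apply ℂ ℂ a).continuous.comp τ.continuous_vecDual
  | ih x =>
    rw [τ.vecDual_coe x ha]
    exact_mod_cast ENNReal.toReal_nonneg

theorem trace_conj_lt_top (x : τ.PreL2) {a : M} (ha : 0 ≤ a) :
    τ.toFun (star (PreL2.val x) * a * PreL2.val x) < ⊤ := by
  obtain ⟨c, rfl⟩ := CStarAlgebra.nonneg_iff_eq_star_mul_self.1 ha
  have h := PreL2.lt_top (PreL2.lmul c x)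
  rw [PreL2.val_lmul, star_mul] at h
  simpa only [mul_assoc] using h

theorem isNormal_vecDual_coe (x : τ.PreL2) : IsNormalFunctional (τ.vecDual x) := by
  intro D s hne hD h0 hs
  have hs0 : 0 ≤ s := by
    obtain ⟨d, hd⟩ := hne
    exact (h0 d hd).trans (hs.1 hd)
  have h := τ.normal ((fun d => star (PreL2.val x) * d * PreL2.val x) '' D)
    (star (PreL2.val x) * s * PreL2.val x) (hne.image _)
    (by
      rintro _ ⟨a, ha, rfl⟩ _ ⟨b, hb, rfl⟩
      obtain ⟨z, hz, haz, hbz⟩ := hD a ha b hb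
      exact ⟨_, ⟨z, hz, rfl⟩, star_left_conjugate_le_conjugate haz _,
        star_left_conjugate_le_conjugate hbz _⟩)
    (by
      rintro _ ⟨a, ha, rfl⟩
      exact star_left_conjugate_nonneg (h0 a ha) _)
    (isLUB_conj _ hD hs)
  constructor
  · rintro _ ⟨d, hd, rfl⟩
    simp only
    rw [τ.vecDual_coe x (h0 d hd), τ.vecDual_coe x hs0, Complex.ofReal_re, Complex.ofReal_re]
    exact ENNReal.toReal_mono (τ.trace_conj_lt_top x hs0).ne (h.1 ⟨_, ⟨d, hd, rfl⟩, rfl⟩)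
  · intro u hu
    rw [τ.vecDual_coe x hs0, Complex.ofReal_re]
    have hu0 : 0 ≤ u := by
      obtain ⟨d, hd⟩ := hne
      have h1 := hu ⟨d, hd, rfl⟩
      simp only at h1
      rw [τ.vecDual_coe x (h0 d hd), Complex.ofReal_re] at h1
      exact ENNReal.toReal_nonneg.trans h1
    refine ENNReal.toReal_le_of_le_ofReal hu0 (h.2 ?_)
    rintro _ ⟨_, ⟨d, hd, rfl⟩, rfl⟩
    have h1 := hu ⟨d, hd, rfl⟩
    simp only at h1
    rw [τ.vecDual_coe x (h0 d hd), Complex.ofReal_re] at h1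
    exact (ENNReal.le_ofReal_iff_toReal_le (τ.trace_conj_lt_top x (h0 d hd)).ne hu0).2 h1

theorem isNormal_vecDual (b : τ.L2) : IsNormalFunctional (τ.vecDual b) := by
  intro D s hne hD h0 hs
  have hs0 : 0 ≤ s := by
    obtain ⟨d, hd⟩ := hne
    exact (h0 d hd).trans (hs.1 hd)
  constructor
  · rintro _ ⟨d, hd, rfl⟩
    have h1 := τ.vecDual_nonneg b (sub_nonneg.2 (hs.1 hd))
    rw [_root_.map_sub] at h1
    simpa using (Complex.le_def.1 h1).1
  · intro u hu
    refine le_of_forall_pos_le_add fun ε hε => ?_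
    set δ : ℝ := ε / (2 * (‖s‖ + 1)) with hδ
    have hδ0 : 0 < δ := by positivity
    obtain ⟨x, hx⟩ : ∃ x : τ.PreL2, ‖τ.vecDual x - τ.vecDual b‖ < δ := by
      have h1 := Metric.continuous_iff.1 τ.continuous_vecDual b δ hδ0
      obtain ⟨r, hr, h2⟩ := h1
      obtain ⟨x, hx⟩ := (UniformSpace.Completion.denseRange_coe (α := τ.PreL2)).exists_dist_lt b hr
      refine ⟨x, ?_⟩
      rw [← dist_eq_norm]
      exact h2 _ (by rwa [dist_comm])
    have bound : ∀ a : M, 0 ≤ a → a ≤ s →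
        |(τ.vecDual x a).re - (τ.vecDual b a).re| ≤ ε / 2 := by
      intro a ha has
      have h1 : ‖a‖ ≤ ‖s‖ := CStarAlgebra.norm_le_norm_of_nonneg_of_le ha has
      have h2 := (τ.vecDual x - τ.vecDual b).le_opNorm a
      have h3 := Complex.abs_re_le_norm ((τ.vecDual x - τ.vecDual b) a)
      rw [sub_apply, Complex.sub_re] at h3
      refine h3.trans (h2.trans ?_)
      calc _ ≤ δ * (‖s‖ + 1) := by
            apply mul_le_mul hx.le (by linarith) (norm_nonneg _) hδ0.le
        _ = ε / 2 := by rw [hδ]; field_simp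
    have h4 : (τ.vecDual x s).re ≤ u + ε / 2 := by
      refine (τ.isNormal_vecDual_coe x D s hne hD h0 hs).2 ?_
      rintro _ ⟨d, hd, rfl⟩
      have h5 := (abs_le.1 (bound d (h0 d hd) (hs.1 hd))).2
      have h6 := hu ⟨d, hd, rfl⟩
      simp only at h6 ⊢
      linarith
    have h7 := (abs_le.1 (bound s hs0 le_rfl)).1
    linarith

/-- The normal positive functional `a ↦ τ(b* a b)`, for `b ∈ L_2(M)`. -/
def vec (b : τ.L2) : NormalPos M where
  toDual := τ.vecDual b
  nonneg _ ha := τ.vecDual_nonneg b ha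
  normal := τ.isNormal_vecDual b

/-- The norm on the extended positive part: `sup {m(τ(b* · b)) : ‖b‖_2 ≤ 1} ∈ [0, ∞]`. Here
`b ↦ τ(b* · b)` maps `L_2(M)` onto `M_{*,+}`, and `τ(b* · b)` has norm `‖b‖_2^2`. So this is the
norm of `M` on `M_+`, and it is infinite outside of `M_+`. -/
def _root_.ExtPos.nrm (m : ExtPos M) : ℝ≥0∞ := ⨆ b : τ.L2, ⨆ _ : ‖b‖ ≤ 1, m.toFun (τ.vec b)

/-- The linear extension of the trace to `M ∩ L_1(M)`, by means of the decomposition of an element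
into the positive and negative parts of its real and imaginary parts. -/
def ext (x : M) : ℂ :=
  (((τ.toFun ((ℜ x : M)⁺)).toReal - (τ.toFun ((ℜ x : M)⁻)).toReal : ℝ) : ℂ)
    + (((τ.toFun ((ℑ x : M)⁺)).toReal - (τ.toFun ((ℑ x : M)⁻)).toReal : ℝ) : ℂ) * Complex.I

/-- `τ(|x|^p)`, the `p`-th power of the norm of `x` in `L_p(M)`. -/
def powInt (p : ℝ) (x : M) : ℝ≥0∞ := τ.toFun (CFC.abs x ^ p)

/-- `A ⊆ M` is a dense subset of `L_p(M)`, the completion of `{x ∈ M : τ(|x|^p) < ∞}` for the norm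
`τ(|x|^p)^{1/p}`. -/
def DenseInLp (p : ℝ) (A : Set M) : Prop :=
  (∀ f ∈ A, τ.powInt p f < ⊤) ∧
    ∀ x, τ.powInt p x < ⊤ → ∀ ε : ℝ≥0∞, 0 < ε → ∃ a ∈ A, τ.powInt p (x - a) < ε

end SemifiniteTrace

/-! ### Bounded semigroups and spectral multipliers -/

/-- A bounded semigroup `(S_t)_{t ≥ 0}` on `(M, τ)`. Only the values at `t ≥ 0` matter. -/
structure BoundedSemigroup {M : Type*} [CStarAlgebra M] [PartialOrder M] [StarOrderedRing M]
    (τ : SemifiniteTrace M) where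
  /-- the operators `S_t`, completely positive maps -/
  S : ℝ → (M →CP M)
  zero : ∀ f, S 0 f = f
  add : ∀ s t, 0 ≤ s → 0 ≤ t → ∀ f, S (s + t) f = S s (S t f)
  bounded : ∃ K : ℝ, ∀ t, 0 ≤ t → ∀ f, ‖S t f‖ ≤ K * ‖f‖
  normal : ∀ t, 0 ≤ t → @Continuous M M (weakStar M) (weakStar M) (S t)
  symmetric : ∀ t, 0 ≤ t → ∀ f g, τ.powInt 1 f < ⊤ → τ.powInt 1 g < ⊤ →
    τ.ext (S t f * g) = τ.ext (f * S t g)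
  continuous : ∀ f, @ContinuousOn ℝ M _ (weakStar M) (fun t => S t f) (Set.Ici 0)

/-- `F` is bounded and smooth on `[0, ∞)` with bounded derivatives of all orders. -/
def IsCbInfty (F : ℝ → ℂ) : Prop :=
  ContDiffOn ℝ ((⊤ : ℕ∞) : WithTop ℕ∞) F (Set.Ici 0) ∧
    ∀ k : ℕ, ∃ C : ℝ, ∀ x, 0 ≤ x → ‖iteratedDerivWithin k F (Set.Ici 0) x‖ ≤ C

namespace BoundedSemigroup

variable {M : Type*} [CStarAlgebra M] [PartialOrder M] [StarOrderedRing M]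
  {τ : SemifiniteTrace M} (𝒮 : BoundedSemigroup τ)

/-- `T` is the bounded operator on `L_2(M)` that extends `S_t`. -/
def IsL2Extension (t : ℝ) (T : τ.L2 →L[ℂ] τ.L2) : Prop :=
  ∀ (f : M) (v : τ.L2), τ.Represents f v → τ.Represents (𝒮.S t f) (T v)

open Classical in
/-- The operator `e^{-tL}` on `L_2(M)`, that is, the (unique) bounded extension of `S_t`;
`-L` is the generator of this semigroup of positive self-adjoint contractions. -/
def l2 (t : ℝ) : τ.L2 →L[ℂ] τ.L2 :=
  if h : ∃ T, 𝒮.IsL2Extension t T then h.choose else 0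

/-- `μ` is the spectral measure `B ↦ ⟪x, E_L(B) x⟫` of the non-negative self-adjoint operator `L`
at the vector `x`. It is the only finite measure on `[0, ∞)` such that
`⟪x, e^{-tL} x⟫ = ∫ e^{-tλ} dμ(λ)` for all `t ≥ 0`. -/
def IsSpectralMeasureAt (x : τ.L2) (μ : MeasureTheory.Measure ℝ) : Prop :=
  MeasureTheory.IsFiniteMeasure μ ∧ μ (Set.Iio 0) = 0 ∧
    ∀ t : ℝ, 0 ≤ t → ⟪x, 𝒮.l2 t x⟫_ℂ = ∫ l, Complex.exp (-(t * l : ℂ)) ∂μ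

/-- `B = ∫ F dE_L`, in the weak sense `⟪x, B x⟫ = ∫ F(λ) d⟪x, E_L(λ) x⟫` for all `x`. -/
def IsMultiplier (F : ℝ → ℂ) (B : τ.L2 →L[ℂ] τ.L2) : Prop :=
  ∀ x : τ.L2, ∃ μ, 𝒮.IsSpectralMeasureAt x μ ∧ ⟪x, B x⟫_ℂ = ∫ l, F l ∂μ

open Classical in
/-- The spectral multiplier `F(L)` on `L_2(M)`, for `F` bounded and continuous on `[0, ∞)`. -/
def mult (F : ℝ → ℂ) : τ.L2 →L[ℂ] τ.L2 :=
  if h : ∃ B, 𝒮.IsMultiplier F B then h.choose else 0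

/-- The standing a priori assumption on the subalgebra `A` of `M`: it is weak-star dense in `M`,
contained and dense in `L_p(M)` for `1 < p < ∞`, and invariant under all `F(L)`. -/
structure IsTestAlgebra (A : NonUnitalSubalgebra ℂ M) : Prop where
  weakStar_dense : @Dense M (weakStar M) (A : Set M)
  lp_dense : ∀ p : ℝ, 1 < p → τ.DenseInLp p (A : Set M)
  mult_mem : ∀ F, IsCbInfty F → ∀ f ∈ A, ∀ v, τ.Represents f v →
    ∃ g ∈ A, τ.Represents g (𝒮.mult F v)

end BoundedSemigroup

/-! ### P-metrics and metric type BMO -/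

/-- A P-metric `{(R_{j,t}, σ_{j,t}) : j ∈ ℕ, t > 0}` of order `m` for the semigroup `𝒮`. -/
structure PMetric {M : Type*} [CStarAlgebra M] [PartialOrder M] [StarOrderedRing M]
    {τ : SemifiniteTrace M} (𝒮 : BoundedSemigroup τ) (m : ℝ) where
  /-- the completely positive maps -/
  R : ℕ → ℝ → (M →CP M)
  /-- the coefficients -/
  σ : ℕ → ℝ → M
  R_one : ∀ j t, 0 < t → R j t 1 = 1
  R_normal : ∀ j t, 0 < t → @Continuous M M (weakStar M) (weakStar M) (R j t)
  R_fixed : ∀ j t, 0 < t → ∀ f, (∀ s, 0 ≤ s → 𝒮.S s f = f) → R j t f = f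
  majorization : ∀ t, 0 < t → ∀ ξ : M, ∃ u : M,
    WeakStarSum (fun j => star (σ j t) * R j (t ^ (1 / m)) (absSq ξ) * σ j t) u ∧
      𝒮.S t (absSq ξ) ≤ u
  average : ∃ C : ℝ, ∀ j t, 0 < t → ∀ ξ : M, ‖R j t (absSq ξ)‖ ≤ C * ‖R 0 t (absSq ξ)‖
  integrability : ∃ K : ℝ, ∀ t, 0 < t → ∃ w : M,
    WeakStarSum (fun j => absSq (σ j t)) w ∧ ‖w‖ ≤ K

/-- The column seminorm `sup_{t > 0} ‖R_{t^{1/m}} |(I - S_t)^k f|^2‖^{1/2}` of order `k`. -/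
def PMetric.bmo {M : Type*} [CStarAlgebra M] [PartialOrder M] [StarOrderedRing M]
    {τ : SemifiniteTrace M} {𝒮 : BoundedSemigroup τ} {m : ℝ} (𝒬 : PMetric 𝒮 m) (k : ℕ) (f : M) :
    ℝ≥0∞ :=
  ⨆ t : ℝ, ⨆ _ : 0 < t,
    ‖𝒬.R 0 (t ^ (1 / m)) (absSq (((1 - (𝒮.S t).toLinearMap : Module.End ℂ M) ^ k) f))‖ₑ ^ (1 / 2 : ℝ)

/-! ### Operator-valued weights and amplifications -/

/-- A normal operator-valued weight from `N_+` to the extended positive part of `ρ(M) ≃ M`. Only the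
values at positive elements of `N` matter. -/
structure OperatorValuedWeight {M N : Type*} [CStarAlgebra M] [PartialOrder M] [StarOrderedRing M]
    [CStarAlgebra N] [PartialOrder N] [StarOrderedRing N] (ρ : M →⋆ₐ[ℂ] N) where
  /-- the weight of a positive element -/
  w : N → ExtPos M
  map_add : ∀ x y, 0 ≤ x → 0 ≤ y → ∀ φ, (w (x + y)).toFun φ = (w x).toFun φ + (w y).toFun φ
  map_smul : ∀ (c : ℝ≥0) x, 0 ≤ x → ∀ φ, (w (c • x)).toFun φ = c * (w x).toFun φ
  conj : ∀ (a : M) x, 0 ≤ x → w (star (ρ a) * x * ρ a) = (w x).conj a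
  normal : ∀ (D : Set N) (s : N), D.Nonempty → DirectedOn (· ≤ ·) D → (∀ a ∈ D, 0 ≤ a) →
    IsLUB D s → ∀ φ, IsLUB ((fun d => (w d).toFun φ) '' D) ((w s).toFun φ)

namespace OperatorValuedWeight

variable {M N : Type*} [CStarAlgebra M] [PartialOrder M] [StarOrderedRing M]
  [CStarAlgebra N] [PartialOrder N] [StarOrderedRing N] {ρ : M →⋆ₐ[ℂ] N}
  (E : OperatorValuedWeight ρ)

/-- The norm `‖f‖ = ‖E(|f|^2)‖^{1/2} ∈ [0, ∞]` of `L_∞^c(N; E)`. -/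
def cnorm (τ : SemifiniteTrace M) (f : N) : ℝ≥0∞ := (E.w (absSq f)).nrm τ ^ (1 / 2 : ℝ)

theorem add_sq_le (f g : N) (φ : NormalPos M) :
    (E.w (absSq (f + g))).toFun φ
      ≤ 2 * (E.w (absSq f)).toFun φ + 2 * (E.w (absSq g)).toFun φ := by
  have h := SemifiniteTrace.parallelogram f g one_pos
  have h1 : absSq (f + g) + absSq (f - g) = (2 : ℝ≥0) • absSq f + (2 : ℝ≥0) • absSq g := by
    simp only [absSq, NNReal.smul_def]
    norm_num at h
    simpa using h
  have p : ∀ x : N, 0 ≤ absSq x := fun x => star_mul_self_nonneg x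
  have p2 : ∀ x : N, 0 ≤ (2 : ℝ≥0) • absSq x := fun x => by
    rw [NNReal.smul_def]
    exact smul_nonneg (by positivity) (p x)
  have h2 := E.map_add _ _ (p (f + g)) (p (f - g)) φ
  rw [h1, E.map_add _ _ (p2 f) (p2 g), E.map_smul _ _ (p f), E.map_smul _ _ (p g)] at h2
  calc _ ≤ _ := le_self_add
    _ = _ := h2.symm
    _ = _ := by simp

/-- The space `L_∞^c(N; E) = {f ∈ N : ‖E(|f|^2)‖ < ∞}`. -/
def colSpace (τ : SemifiniteTrace M) : Submodule ℂ N where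
  carrier := {f | E.cnorm τ f < ⊤}
  zero_mem' := by
    have h := fun φ => E.map_smul 0 0 le_rfl φ
    simp only [smul_zero, ENNReal.coe_zero, zero_mul] at h
    simp [cnorm, ExtPos.nrm, absSq, h]
  add_mem' {f g} hf hg := by
    change E.cnorm τ f < ⊤ at hf
    change E.cnorm τ g < ⊤ at hg
    change E.cnorm τ (f + g) < ⊤
    rw [cnorm] at hf hg ⊢
    rw [ENNReal.rpow_lt_top_iff_of_pos (by norm_num)] at hf hg ⊢
    refine lt_of_le_of_lt (b := 2 * (E.w (absSq f)).nrm τ + 2 * (E.w (absSq g)).nrm τ) ?_ ?_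
    · refine iSup₂_le fun b hb => (E.add_sq_le f g (τ.vec b)).trans ?_
      have l : ∀ n : ExtPos M, n.toFun (τ.vec b) ≤ n.nrm τ := fun n =>
        le_iSup₂ (f := fun (b : τ.L2) (_ : ‖b‖ ≤ 1) => n.toFun (τ.vec b)) b hb
      gcongr <;> exact l _
    · exact ENNReal.add_lt_top.2 ⟨ENNReal.mul_lt_top (by simp) hf, ENNReal.mul_lt_top (by simp) hg⟩
  smul_mem' c f hf := by
    change E.cnorm τ f < ⊤ at hf
    change E.cnorm τ (c • f) < ⊤
    rw [cnorm] at hf ⊢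
    rw [ENNReal.rpow_lt_top_iff_of_pos (by norm_num)] at hf ⊢
    refine lt_of_le_of_lt (b := (‖c‖₊ ^ 2 : ℝ≥0) * (E.w (absSq f)).nrm τ) ?_
      (ENNReal.mul_lt_top (by simp) hf)
    refine iSup₂_le fun b hb => ?_
    have h : absSq (c • f) = (‖c‖₊ ^ 2 : ℝ≥0) • absSq f := by
      rw [absSq, SemifiniteTrace.sq_smul, NNReal.smul_def]
      simp [absSq]
    rw [h, E.map_smul _ _ (show 0 ≤ absSq f from star_mul_self_nonneg f)]
    gcongr
    exact le_iSup₂ (f := fun (b : τ.L2) (_ : ‖b‖ ≤ 1) => (E.w (absSq f)).toFun (τ.vec b)) b hb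

/-- `f_i → g` in the strong operator topology: `τ(b* E(|f_i - g|^2) b) → 0` for all
`b ∈ L_2(M)`. -/
def SOTTendsto (τ : SemifiniteTrace M) {ι : Type*} (l : Filter ι) (f : ι → N) (g : N) : Prop :=
  ∀ b : τ.L2, Tendsto (fun i => (E.w (absSq (f i - g))).toFun (τ.vec b)) l (𝓝 0)

end OperatorValuedWeight

/-- The data that produce the maps `R_r`: injective unital `*`-homomorphisms `ρ₁, ρ₂ : M → N`, a
normal operator-valued weight `E : N → ρ₁(M) ≃ M`, and increasing projections `q_r`, `r > 0`, in the
domain of `E` whose weights `E(q_r) ∈ M` are invertible. -/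
structure MetricModel (M N : Type*) [CStarAlgebra M] [PartialOrder M] [StarOrderedRing M]
    [CStarAlgebra N] [PartialOrder N] [StarOrderedRing N] where
  /-- first embedding -/
  ρ₁ : M →⋆ₐ[ℂ] N
  /-- second embedding -/
  ρ₂ : M →⋆ₐ[ℂ] N
  inj₁ : Function.Injective ρ₁
  inj₂ : Function.Injective ρ₂
  /-- the operator-valued weight -/
  E : OperatorValuedWeight ρ₁
  /-- the projections `q_r` -/
  q : ℝ → N
  q_proj : ∀ r, 0 < r → IsStarProjection (q r)
  q_mono : ∀ r s, 0 < r → r ≤ s → q r ≤ q s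
  /-- the elements `E(q_r)` of `M` -/
  e : ℝ → M
  e_nonneg : ∀ r, 0 ≤ e r
  e_unit : ∀ r, 0 < r → IsUnit (e r)
  E_q : ∀ r, 0 < r → E.w (q r) = ExtPos.ofPos (e r) (e_nonneg r)

namespace MetricModel

variable {M N : Type*} [CStarAlgebra M] [PartialOrder M] [StarOrderedRing M]
  [CStarAlgebra N] [PartialOrder N] [StarOrderedRing N] {τ : SemifiniteTrace M}
  (P : MetricModel M N)

/-- The element `E(q_r)^{-1/2}` of `M`. -/
def d (r : ℝ) : M := P.e r ^ (-(1 / 2) : ℝ)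

/-- The element `E(q_r)^{-1/2}` of `ρ₁(M) ⊆ N`. -/
def dN (r : ℝ) : N := P.ρ₁ (P.d r)

/-- The annuli `b_{1,r} = q_{2r}` and `b_{k,r} = q_{2^k r} - q_{2^{k-1} r}` for `k ≥ 2`. -/
def b (k : ℕ) (r : ℝ) : N :=
  if k = 1 then P.q (2 * r) else P.q (2 ^ k * r) - P.q (2 ^ (k - 1) * r)

/-- The map `R` on `M` is `f ↦ E(q_r)^{-1/2} E(q_r ρ₂(f) q_r) E(q_r)^{-1/2}`. By linearity, this is
stated for positive `f`. -/
def Produces (r : ℝ) (R : M →CP M) : Prop :=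
  ∀ (f : M) (_ : 0 ≤ f) (hR : 0 ≤ R f),
    ExtPos.ofPos (R f) hR = (P.E.w (P.q r * P.ρ₂ f * P.q r)).conj (P.d r)

/-- The space `V = L_∞^c(N; E) + ρ₂(A)`. -/
def V (τ : SemifiniteTrace M) (A : NonUnitalSubalgebra ℂ M) : Submodule ℂ N :=
  P.E.colSpace τ ⊔ A.toSubmodule.map (P.ρ₂ : M →ₗ[ℂ] N)

/-- `π` is a homomorphism from the algebra `{F(L) : F ∈ C_b^∞} ⊆ B(L_2(M))` to the linear operators
on `V`, which intertwines: `π(F(L)) ∘ ρ₂ = ρ₂ ∘ F(L)` on `A`. -/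
structure IsAmplification (𝒮 : BoundedSemigroup τ) (A : NonUnitalSubalgebra ℂ M)
    (π : (τ.L2 →L[ℂ] τ.L2) → Module.End ℂ (P.V τ A)) : Prop where
  map_add : ∀ F G, IsCbInfty F → IsCbInfty G →
    π (𝒮.mult F + 𝒮.mult G) = π (𝒮.mult F) + π (𝒮.mult G)
  map_smul : ∀ (c : ℂ) F, IsCbInfty F → π (c • 𝒮.mult F) = c • π (𝒮.mult F)
  map_mul : ∀ F G, IsCbInfty F → IsCbInfty G →
    π (𝒮.mult F * 𝒮.mult G) = π (𝒮.mult F) * π (𝒮.mult G)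
  intertwine : ∀ F, IsCbInfty F → ∀ f ∈ A, ∀ g ∈ A,
    (∃ v, τ.Represents f v ∧ τ.Represents g (𝒮.mult F v)) →
    ∀ v : P.V τ A, (v : N) = P.ρ₂ f → (π (𝒮.mult F) v : N) = P.ρ₂ g

/-- `E(b_{k,r} |ξ|^2 b_{k,r}) ≤ E(|ξ|^2)` for `k ≥ 1`, `r > 0` and `ξ ∈ N`. -/
def Monotonicity : Prop :=
  ∀ k r, 1 ≤ k → 0 < r → ∀ (ξ : N) (φ : NormalPos M),
    (P.E.w (P.b k r * absSq ξ * P.b k r)).toFun φ ≤ (P.E.w (absSq ξ)).toFun φ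

section Conditions

variable (𝒮 : BoundedSemigroup τ) {A : NonUnitalSubalgebra ℂ M}
  (π : (τ.L2 →L[ℂ] τ.L2) → Module.End ℂ (P.V τ A))

/-- Right modularity: `π(F(L))(η E(q_r)^{-1/2}) = π(F(L))(η) E(q_r)^{-1/2}` for
`η ∈ L_∞^c(N; E)`. -/
def RightModularity : Prop :=
  ∀ F, IsCbInfty F → ∀ r, 0 < r → ∀ η ζ : P.V τ A, (η : N) ∈ P.E.colSpace τ →
    (ζ : N) = η * P.dN r → (π (𝒮.mult F) ζ : N) = π (𝒮.mult F) η * P.dN r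

/-- Continuity of the projections: for `f ∈ V`, `F ∈ 𝓢(ℝ)` and `r > 0`,
`π(F(L))(f q_s) q_r E(q_r)^{-1/2} → π(F(L))(f) q_r E(q_r)^{-1/2}` as `s → ∞`. -/
def ProjectionContinuity : Prop :=
  ∀ r, 0 < r → ∀ (F : 𝓢(ℝ, ℂ)) (f : P.V τ A) (g : ℝ → P.V τ A),
    (∀ s, 0 < s → (g s : N) = f * P.q s) →
    P.E.SOTTendsto τ atTop (fun s => (π (𝒮.mult F) (g s) : N) * P.q r * P.dN r)
      (π (𝒮.mult F) f * P.q r * P.dN r)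

/-- Continuity of `π`: if `F_k → F` pointwise in `𝓢(ℝ)` with `sup_k ‖F_k‖_∞ < ∞`, then
`π(F_k(L))(f) q_r E(q_r)^{-1/2} → π(F(L))(f) q_r E(q_r)^{-1/2}` for `f ∈ V` and `r > 0`. -/
def AmplificationContinuity : Prop :=
  ∀ (F : ℕ → 𝓢(ℝ, ℂ)) (G : 𝓢(ℝ, ℂ)), (∀ l, Tendsto (fun k => F k l) atTop (𝓝 (G l))) →
    (∃ C : ℝ, ∀ k l, ‖F k l‖ ≤ C) → ∀ r, 0 < r → ∀ f : P.V τ A,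
    P.E.SOTTendsto τ atTop (fun k => (π (𝒮.mult (F k)) f : N) * P.q r * P.dN r)
      (π (𝒮.mult G) f * P.q r * P.dN r)

/-- Boundedness: `‖π(F(L))‖ ≤ ‖F‖_∞` on `L_∞^c(N; E)`. -/
def Boundedness : Prop :=
  ∀ F, IsCbInfty F → ∀ η : P.V τ A, (η : N) ∈ P.E.colSpace τ →
    P.E.cnorm τ (π (𝒮.mult F) η) ≤ (⨆ l : ℝ, ⨆ _ : 0 ≤ l, ‖F l‖ₑ) * P.E.cnorm τ η

/-- `E_1(x) = 1` and `E_k(x) = exp(2^{mk/(m-1)} x)` for `k ≥ 2`. -/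
def expWeight (m : ℝ) (k : ℕ) (x : ℝ) : ℝ :=
  if k = 1 then 1 else Real.exp ((2 : ℝ) ^ (m * k / (m - 1)) * x)

/-- The `L_2`-Gaussian estimate. -/
def GaussianEstimate (m : ℝ) : Prop :=
  ∃ C c : ℝ, 0 < C ∧ 0 < c ∧ ∀ (t : ℝ) (k : ℕ) (r₁ r₂ : ℝ), 0 < t → 1 ≤ k → 0 < r₁ → r₁ ≤ r₂ →
    ∀ (f : N) (v : P.V τ A), (v : N) = f * P.b k r₂ →
      P.E.cnorm τ ((π (𝒮.mult fun l => Complex.exp (-(t * l : ℂ))) v : N) * P.q r₁ * P.dN r₁)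
        ≤ ENNReal.ofReal (C * expWeight m k (-c * (r₂ / t ^ (1 / m)) ^ (m / (m - 1))))
          * P.E.cnorm τ (f * P.b k r₂ * P.dN (max r₁ (t ^ (1 / m))))

end Conditions

/-- The strong doubling condition, for `f ∈ A` and for `f = 1`. -/
def StrongDoubling (τ : SemifiniteTrace M) (A : NonUnitalSubalgebra ℂ M) : Prop :=
  ∃ C n D : ℝ, 0 < C ∧ 0 < n ∧ 0 ≤ D ∧ ∀ r₁ r₂ r₃ : ℝ, 0 < r₃ → r₃ ≤ r₂ → r₂ ≤ r₁ →
    ∀ f : M, (f ∈ A ∨ f = 1) →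
      (P.E.w (absSq (P.ρ₂ f * P.q r₁ * P.dN r₃))).nrm τ
        ≤ ENNReal.ofReal (C * (r₁ / r₂) ^ D * (r₁ / r₃) ^ n)
          * (P.E.w (absSq (P.ρ₂ f * P.q r₂ * P.dN r₂))).nrm τ

end MetricModel
end

/-! Write $\|f\|_r=\|R_r|f|^2\|^{1/2}$. Everything rests on one estimate,
`exists_ballNorm_semigroup_le`: $\|S_tf\|_r\le K\|f\|_{t^{1/m}}$ for $f\in A$ and all $r\le
t^{1/m}$. In $\mathcal N$, $\|f\|_r$ is the column norm of $\rho_2(f)q_rE(q_r)^{-1/2}$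
(`ballNorm_eq`), and $\rho_2(S_tf)=\pi(e^{-tL})\rho_2(f)$. Cut $\rho_2(f)$ into the annuli of radius
$\rho=t^{1/m}$. The Gaussian estimate with $r_2=\rho$ gives the $k$-th piece the factor $E_k(-c)$,
doubling costs only a power of $2^k$, and the series converges. Continuity of the projections and
lower semicontinuity of the norm pass from finite sums of annuli to $\rho_2(f)$.

Raising the order is then immediate: apply $(1-S_t)^n$ to $(1-S_t)f$ at the fixed radius $t^{1/m}$.

Lowering the order from $n+1$ to $n$ uses the identity $2^n(1-X)^nX=(1-X^2)^nX^2+qX(1-X)^{n+1}$ at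
$X=S_t$ (`exists_polynomial_identity`). With $\beta$ the seminorm of order $n+1$, it bounds
$\|(1-S_s)^nS_sf\|_r$ by half of the same quantity at time $2s$ plus $C\beta$. The supremum $u$ over
all $s$ with $s^{1/m}\ge r$, at fixed $r$, is finite because $f$ is bounded and the semigroup is
bounded, so $u\le\frac12(u+C\beta)$ gives $u\le C\beta$. The missing part $(1-S_t)^n(f-S_tf)$ is of
order $n+1$.

Much of the file serves to identify the spectral multiplier $e^{-tL}$ with $S_t$. Boundedness on
$L_2$ comes from the Kadison-Schwarz inequality and symmetry, and spectral measures come from the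
functional calculus of $e^{-L}$ (`exists_laplace_measure`, `mult_exp`). -/

noncomputable section

/-! ### Spectral measures of a symmetric semigroup on a Hilbert space -/

section SpectralMeasure

open MeasureTheory

variable {H : Type*} [NormedAddCommGroup H] [InnerProductSpace ℂ H] [CompleteSpace H]

/-- The positive linear functional `f ↦ ⟪x, f(a) x⟫` on the continuous functions on the spectrum. -/
def cfcVectorFunctional {a : H →L[ℂ] H} (ha : IsSelfAdjoint a) (x : H) :
    CompactlySupportedContinuousMap (spectrum ℝ a) ℝ →ₚ[ℝ] ℝ :=
  PositiveLinearMap.mk₀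
    { toFun := fun f => (⟪x, cfcHom ha (f : C(spectrum ℝ a, ℝ)) x⟫_ℂ).re
      map_add' := fun f g => by
        have : ((f + g : CompactlySupportedContinuousMap (spectrum ℝ a) ℝ) :
          C(spectrum ℝ a, ℝ)) = (f : C(spectrum ℝ a, ℝ)) + (g : C(spectrum ℝ a, ℝ)) := rfl
        rw [this, map_add, add_apply, inner_add_right, Complex.add_re]
      map_smul' := fun c f => by
        have : ((c • f : CompactlySupportedContinuousMap (spectrum ℝ a) ℝ) :
          C(spectrum ℝ a, ℝ)) = c • (f : C(spectrum ℝ a, ℝ)) := rfl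
        rw [this, map_smul, smul_apply, ← Complex.coe_smul, inner_smul_right]
        simp }
    fun f hf => by
      have h1 : 0 ≤ cfcHom ha (f : C(spectrum ℝ a, ℝ)) := by
        refine cfcHom_nonneg_iff ha |>.2 ?_
        intro s
        exact hf s
      rw [ContinuousLinearMap.nonneg_iff_isPositive] at h1
      exact (Complex.le_def.1 (h1.inner_nonneg_right x)).1

/-- Riesz-Markov-Kakutani on the spectrum. Its compactness makes every continuous function compactly
supported and the measure finite. -/
theorem exists_measure_cfc {a : H →L[ℂ] H} (ha : IsSelfAdjoint a) (x : H) :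
    ∃ ν : Measure (spectrum ℝ a), IsFiniteMeasure ν ∧
      ∀ f : ℝ → ℝ, ContinuousOn f (spectrum ℝ a) →
        (⟪x, cfc f a x⟫_ℂ).re = ∫ s, f s ∂ν := by
  refine ⟨RealRMK.rieszMeasure (cfcVectorFunctional ha x), ⟨?_⟩, fun f hf => ?_⟩
  · exact IsCompact.measure_lt_top isCompact_univ
  · have h := RealRMK.integral_rieszMeasure (cfcVectorFunctional ha x)
      (CompactlySupportedContinuousMap.continuousMapEquiv ⟨_, hf.domRestrict⟩)
    rw [cfc_apply f a ha hf]
    exact h.symm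

variable {T : ℝ → H →L[ℂ] H}

theorem semigroup_inner_eq_norm_sq
    (hadd : ∀ s t, 0 ≤ s → 0 ≤ t → T (s + t) = T s * T t)
    (hsa : ∀ t, 0 ≤ t → IsSelfAdjoint (T t)) {t : ℝ} (ht : 0 ≤ t) (x : H) :
    ⟪x, T t x⟫_ℂ = ((‖T (t / 2) x‖ ^ 2 : ℝ) : ℂ) := by
  have h := hadd (t / 2) (t / 2) (by linarith) (by linarith)
  rw [add_halves] at h
  rw [h, mul_apply_eq_comp, ← ContinuousLinearMap.adjoint_inner_left,
    ContinuousLinearMap.isSelfAdjoint_iff'.1 (hsa _ (by linarith)), inner_self_eq_norm_sq_to_K]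
  simp

/-- The C*-identity gives $\|T_{2^nt}\|=\|T_t\|^{2^n}$, which would exceed the uniform bound $K$ if
$\|T_t\|>1$. -/
theorem semigroup_norm_le_one
    (hadd : ∀ s t, 0 ≤ s → 0 ≤ t → T (s + t) = T s * T t)
    (hsa : ∀ t, 0 ≤ t → IsSelfAdjoint (T t)) {K : ℝ} (hK : ∀ t, 0 ≤ t → ‖T t‖ ≤ K)
    {t : ℝ} (ht : 0 ≤ t) : ‖T t‖ ≤ 1 := by
  have hpow : ∀ n : ℕ, ‖T t‖ ^ 2 ^ n = ‖T (2 ^ n * t)‖ := by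
    intro n
    induction n with
    | zero => simp
    | succ n ih =>
      rw [pow_succ, pow_mul, ih]
      have h1 : (2 : ℝ) ^ (n + 1) * t = 2 ^ n * t + 2 ^ n * t := by ring
      have h2 : 0 ≤ (2 : ℝ) ^ n * t := by positivity
      rw [h1, hadd _ _ h2 h2]
      have h3 := CStarRing.norm_star_mul_self (x := T (2 ^ n * t))
      rw [(hsa _ h2).star_eq] at h3
      rw [h3, sq]
  by_contra! h
  have h1 := (tendsto_pow_atTop_atTop_of_one_lt h).comp
    (tendsto_pow_atTop_atTop_of_one_lt (one_lt_two (α := ℕ)))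
  obtain ⟨n, hn⟩ := (h1.eventually_gt_atTop K).exists
  simp only [Function.comp_apply, hpow] at hn
  exact absurd (hK (2 ^ n * t) (by positivity)) (not_le.2 hn)

theorem semigroup_nonneg
    (hadd : ∀ s t, 0 ≤ s → 0 ≤ t → T (s + t) = T s * T t)
    (hsa : ∀ t, 0 ≤ t → IsSelfAdjoint (T t)) {t : ℝ} (ht : 0 ≤ t) : 0 ≤ T t := by
  have h := hadd (t / 2) (t / 2) (by linarith) (by linarith)
  rw [add_halves] at h
  rw [h]
  nth_rewrite 1 [← (hsa (t / 2) (by linarith)).star_eq]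
  exact star_mul_self_nonneg _

/-- $T_{1/(n+1)}$ is positive with $(n+1)$-st power $T_1$, and nonnegative real powers of a positive
operator compose. No invertibility of $T_1$ is needed. -/
theorem semigroup_rat_eq_rpow
    (hadd : ∀ s t, 0 ≤ s → 0 ≤ t → T (s + t) = T s * T t)
    (hsa : ∀ t, 0 ≤ t → IsSelfAdjoint (T t)) (h0 : T 0 = 1) (p n : ℕ) :
    T (p / (n + 1 : ℕ)) = T 1 ^ ((p : ℝ) / (n + 1 : ℕ)) := by
  have hpow : ∀ (s : ℝ) (k : ℕ), 0 ≤ s → T (k * s) = T s ^ k := by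
    intro s k hs
    induction k with
    | zero => simp [h0]
    | succ k ih =>
      have : ((k + 1 : ℕ) : ℝ) * s = k * s + s := by push_cast; ring
      rw [this, hadd _ _ (by positivity) hs, ih, pow_succ]
  have hn : (0 : ℝ) < (n + 1 : ℕ) := by positivity
  have h1 := hpow (1 / (n + 1 : ℕ)) (n + 1) (by positivity)
  rw [mul_one_div_cancel hn.ne'] at h1
  have hpos := semigroup_nonneg hadd hsa (t := 1 / (n + 1 : ℕ)) (by positivity)
  have h2 : T 1 = T (1 / (n + 1 : ℕ)) ^ ((n + 1 : ℕ) : ℝ) := by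
    rw [CFC.rpow_natCast _ _ hpos, h1]
  rw [h2, CFC.rpow_rpow_of_exponent_nonneg _ _ _ hn.le (by positivity) hpos,
    mul_div_cancel₀ _ hn.ne', CFC.rpow_natCast _ _ hpos, ← hpow _ _ (by positivity)]
  congr 1
  ring

/-- $\|T_{t/2}x\|$ decreases because the $T_t$ are contractions. This monotonicity replaces
continuity when passing from rational to real times. -/
theorem semigroup_inner_antitone
    (hadd : ∀ s t, 0 ≤ s → 0 ≤ t → T (s + t) = T s * T t)
    (hsa : ∀ t, 0 ≤ t → IsSelfAdjoint (T t)) {K : ℝ} (hK : ∀ t, 0 ≤ t → ‖T t‖ ≤ K)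
    {s t : ℝ} (hs : 0 ≤ s) (hst : s ≤ t) (x : H) :
    (⟪x, T t x⟫_ℂ).re ≤ (⟪x, T s x⟫_ℂ).re := by
  rw [semigroup_inner_eq_norm_sq hadd hsa hs, semigroup_inner_eq_norm_sq hadd hsa (hs.trans hst),
    Complex.ofReal_re, Complex.ofReal_re]
  have h := hadd ((t - s) / 2) (s / 2) (by linarith) (by linarith)
  rw [show (t - s) / 2 + s / 2 = t / 2 by ring] at h
  rw [h, mul_apply_eq_comp]
  gcongr
  refine ((T _).le_opNorm _).trans ?_
  have := semigroup_norm_le_one hadd hsa hK (t := (t - s) / 2) (by linarith)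
  exact mul_le_of_le_one_left (norm_nonneg _) this

theorem continuousOn_laplace (μ : Measure ℝ) [IsFiniteMeasure μ] (hμ : μ (Set.Iio 0) = 0) :
    ContinuousOn (fun t : ℝ => ∫ l, Real.exp (-(t * l)) ∂μ) (Set.Ici 0) := by
  have hae : ∀ᵐ l ∂μ, 0 ≤ l := by
    rw [ae_iff]
    simpa [Set.Iio_def] using hμ
  refine continuousOn_of_dominated (bound := fun _ => 1) ?_ ?_ (integrable_const _) ?_
  · intro t _
    exact (by fun_prop : Continuous fun l : ℝ => Real.exp (-(t * l))).aestronglyMeasurable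
  · intro t ht
    filter_upwards [hae] with l hl
    rw [Real.norm_eq_abs, Real.abs_exp, Real.exp_le_one_iff]
    have := mul_nonneg (Set.mem_Ici.1 ht) hl
    linarith
  · exact Eventually.of_forall fun l => by fun_prop

/-- The spectral measures of the generator of a symmetric semigroup of operators on a Hilbert
space. -/
theorem exists_laplace_measure (h0 : T 0 = 1)
    (hadd : ∀ s t, 0 ≤ s → 0 ≤ t → T (s + t) = T s * T t)
    (hsa : ∀ t, 0 ≤ t → IsSelfAdjoint (T t)) {K : ℝ} (hK : ∀ t, 0 ≤ t → ‖T t‖ ≤ K)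
    (x : H) (hc : Tendsto (fun t => ⟪x, T t x⟫_ℂ) (𝓝[>] 0) (𝓝 ⟪x, x⟫_ℂ)) :
    ∃ μ : Measure ℝ, IsFiniteMeasure μ ∧ μ (Set.Iio 0) = 0 ∧
      ∀ t : ℝ, 0 ≤ t → ⟪x, T t x⟫_ℂ = ∫ l, Complex.exp (-(t * l : ℂ)) ∂μ := by
  obtain ⟨ν, hν, hνf⟩ := exists_measure_cfc (hsa 1 zero_le_one) x
  have hT1 := semigroup_nonneg hadd hsa zero_le_one
  have hspec0 : ∀ s ∈ spectrum ℝ (T 1), 0 ≤ s := spectrum_nonneg_of_nonneg hT1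
  have hspec1 : ∀ s ∈ spectrum ℝ (T 1), s ≤ 1 := by
    intro s hs
    have h1 : Nontrivial H := by
      by_contra hH
      rw [not_nontrivial_iff_subsingleton] at hH
      have : Subsingleton (H →L[ℂ] H) := ⟨fun a b => by ext v; exact Subsingleton.elim _ _⟩
      exact hs (isUnit_of_subsingleton _)
    have h2 := spectrum.norm_le_norm_of_mem hs
    exact (le_abs_self s).trans (h2.trans (semigroup_norm_le_one hadd hsa hK zero_le_one))
  -- The point $s=0$ stands for $\lambda=\infty$ and is discarded. As `Real.log 0 = 0`, keeping it
  -- would move its mass to $\lambda=0$.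
  set U : Set (spectrum ℝ (T 1)) := {s | (0 : ℝ) < s} with hU
  have hUm : MeasurableSet U := measurableSet_lt measurable_const measurable_subtype_coe
  set g : spectrum ℝ (T 1) → ℝ := fun s => -Real.log s with hg
  have hgm : Measurable g := (Real.measurable_log.comp measurable_subtype_coe).neg
  set μ : Measure ℝ := (ν.restrict U).map g with hμ
  have hfin : IsFiniteMeasure μ := Measure.isFiniteMeasure_map _ _
  have hneg : μ (Set.Iio 0) = 0 := by
    rw [hμ, Measure.map_apply hgm measurableSet_Iio]
    convert measure_empty
    · ext s
      simp only [Set.mem_preimage, Set.mem_Iio, Set.mem_empty_iff_false, iff_false, not_lt, hg]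
      have := Real.log_nonpos (hspec0 s s.2) (hspec1 s s.2)
      linarith
    · infer_instance
  have hcont := continuousOn_laplace μ hneg
  set G : ℝ → ℝ := fun t => ∫ l, Real.exp (-(t * l)) ∂μ with hG
  set f : ℝ → ℝ := fun t => (⟪x, T t x⟫_ℂ).re with hf
  have hrat : ∀ p n : ℕ, f ((p + 1 : ℕ) / (n + 1 : ℕ)) = G ((p + 1 : ℕ) / (n + 1 : ℕ)) := by
    intro p n
    set t : ℝ := (p + 1 : ℕ) / (n + 1 : ℕ) with ht
    have ht0 : 0 < t := by positivity
    have h1 : f t = ∫ s : spectrum ℝ (T 1), (s : ℝ) ^ t ∂ν := by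
      rw [← hνf _ (Real.continuous_rpow_const ht0.le).continuousOn, ← CFC.rpow_eq_cfc_real hT1,
        ht, ← semigroup_rat_eq_rpow hadd hsa h0]
    have h2 : G t = ∫ s in U, Real.exp (-(t * g s)) ∂ν := by
      rw [hG]
      simp only
      rw [hμ, integral_map hgm.aemeasurable]
      exact (by fun_prop : Continuous fun l : ℝ => Real.exp (-(t * l))).aestronglyMeasurable
    rw [h1, h2, ← integral_indicator hUm]
    congr 1
    ext s
    by_cases hs : s ∈ U
    · rw [Set.indicator_of_mem hs, Real.rpow_def_of_pos hs, hg]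
      congr 1
      ring
    · rw [Set.indicator_of_notMem hs]
      have : (s : ℝ) = 0 := le_antisymm (not_lt.1 hs) (hspec0 s s.2)
      rw [this, Real.zero_rpow ht0.ne']
  have hratq : ∀ q : ℚ, 0 < q → f q = G q := by
    intro q hq
    have hnum : 0 < q.num := Rat.num_pos.2 hq
    obtain ⟨p, hp⟩ : ∃ p : ℕ, q.num = (p + 1 : ℕ) :=
      ⟨q.num.toNat - 1, by omega⟩
    obtain ⟨n, hn⟩ : ∃ n : ℕ, q.den = n + 1 := ⟨q.den - 1, by have := q.den_pos; omega⟩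
    have := hrat p n
    have e : (q : ℝ) = (p + 1 : ℕ) / (n + 1 : ℕ) := by
      rw [Rat.cast_def, hp, hn]; simp
    rw [e, this]
  -- $f$ is antitone, $G$ is continuous and they agree at positive rationals, so rationals on either
  -- side of $t$ squeeze $f(t)$ to $G(t)$.
  have hpos : ∀ t : ℝ, 0 < t → f t = G t := by
    intro t ht
    have hct : ContinuousAt G t := hcont.continuousAt (Ici_mem_nhds ht)
    apply le_antisymm
    · refine le_of_forall_pos_le_add fun ε hε => ?_
      obtain ⟨δ, hδ, hd⟩ := Metric.continuousAt_iff.1 hct ε hε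
      obtain ⟨q, hq1, hq2⟩ := exists_rat_btwn (show max 0 (t - δ) < t by
        rw [max_lt_iff]; exact ⟨ht, by linarith⟩)
      rw [max_lt_iff] at hq1
      have h1 := semigroup_inner_antitone hadd hsa hK hq1.1.le hq2.le x
      have h2 := hratq q (by exact_mod_cast hq1.1)
      have h3 := hd (x := (q : ℝ)) (by rw [Real.dist_eq, abs_lt]; constructor <;> linarith)
      rw [Real.dist_eq, abs_lt] at h3
      change f t ≤ f q at h1
      linarith
    · refine le_of_forall_pos_le_add fun ε hε => ?_
      obtain ⟨δ, hδ, hd⟩ := Metric.continuousAt_iff.1 hct ε hε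
      obtain ⟨q, hq1, hq2⟩ := exists_rat_btwn (show t < t + δ by linarith)
      have h1 := semigroup_inner_antitone hadd hsa hK ht.le hq1.le x
      have h2 := hratq q (by exact_mod_cast ht.trans hq1)
      have h3 := hd (x := (q : ℝ)) (by rw [Real.dist_eq, abs_lt]; constructor <;> linarith)
      rw [Real.dist_eq, abs_lt] at h3
      change f q ≤ f t at h1
      linarith
  -- Weak continuity at $0$ is used here: it excludes mass of $\nu$ at the discarded point $s=0$.
  have hzero : f 0 = G 0 := by
    have h1 : Tendsto f (𝓝[>] 0) (𝓝 (f 0)) := by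
      have h := (Complex.continuous_re.tendsto _).comp hc
      have e : f 0 = (⟪x, x⟫_ℂ).re := by simp [hf, h0]
      rw [e]
      exact h
    have h2 : Tendsto G (𝓝[>] 0) (𝓝 (G 0)) :=
      (hcont 0 Set.self_mem_Ici).mono_left (nhdsWithin_mono _ Set.Ioi_subset_Ici_self)
    refine tendsto_nhds_unique h1 (h2.congr' ?_)
    filter_upwards [self_mem_nhdsWithin] with t ht
    exact (hpos t ht).symm
  refine ⟨μ, hfin, hneg, fun t ht => ?_⟩
  have h1 : f t = G t := by
    rcases ht.eq_or_lt with rfl | ht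
    · exact hzero
    · exact hpos t ht
  have h2 : ⟪x, T t x⟫_ℂ = ((f t : ℝ) : ℂ) := by
    rw [hf]
    simp only
    rw [semigroup_inner_eq_norm_sq hadd hsa ht, Complex.ofReal_re]
  rw [h2, h1, hG]
  simp only
  rw [← integral_complex_ofReal]
  congr 1
  ext l
  push_cast
  rfl

end SpectralMeasure

/-! ### Approximate support projections by functional calculus -/

section Approximant

variable {M : Type*} [CStarAlgebra M] [PartialOrder M] [StarOrderedRing M]

/-- The approximate support projections `n z (1 + n z)⁻¹` of a positive element `z`. -/
def approxSupport (n : ℕ) (z : M) : M := cfc (fun s : ℝ => n * s / (1 + n * s)) z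

variable {z : M} (hz : 0 ≤ z) (n : ℕ)
include hz

theorem one_add_mul_pos_of_mem_spectrum {s : ℝ} (hs : s ∈ spectrum ℝ z) : 0 < 1 + n * s := by
  have := spectrum_nonneg_of_nonneg hz hs
  positivity

theorem continuousOn_approxSupport :
    ContinuousOn (fun s : ℝ => n * s / (1 + n * s)) (spectrum ℝ z) :=
  ContinuousOn.div (by fun_prop) (by fun_prop)
    fun _ hs => (one_add_mul_pos_of_mem_spectrum hz n hs).ne'

theorem approxSupport_nonneg : 0 ≤ approxSupport n z := by
  refine cfc_nonneg fun s hs => ?_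
  have := spectrum_nonneg_of_nonneg hz hs
  positivity

theorem approxSupport_le_one : approxSupport n z ≤ 1 := by
  refine cfc_le_one _ _ fun s hs => ?_
  rw [div_le_one (one_add_mul_pos_of_mem_spectrum hz n hs)]
  linarith

theorem norm_approxSupport_le_one : ‖approxSupport n z‖ ≤ 1 :=
  (CStarAlgebra.norm_le_one_iff_of_nonneg _ (approxSupport_nonneg hz n)).2
    (approxSupport_le_one hz n)

theorem approxSupport_le_smul : approxSupport n z ≤ (n : ℝ) • z := by
  have h := continuousOn_approxSupport hz n
  have e : (n : ℝ) • z = cfc (fun s : ℝ => n * s) z := by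
    rw [cfc_const_mul_id (n : ℝ) z]
  rw [e, approxSupport]
  refine cfc_mono (fun s hs => ?_) h (by fun_prop)
  have := spectrum_nonneg_of_nonneg hz hs
  refine div_le_self (by positivity) ?_
  have : 0 ≤ n * s := by positivity
  linarith

theorem mul_approxSupport :
    z * approxSupport n z = cfc (fun s : ℝ => s * (n * s / (1 + n * s))) z := by
  have h := continuousOn_approxSupport hz n
  rw [cfc_mul (fun s : ℝ => s) _ z (by fun_prop) h, cfc_id' ℝ z]
  rfl

theorem commute_approxSupport : Commute z (approxSupport n z) := by
  have := cfc_commute_cfc (fun s : ℝ => s) (fun s : ℝ => n * s / (1 + n * s)) z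
  rwa [cfc_id' ℝ z] at this

theorem mul_approxSupport_nonneg : 0 ≤ z * approxSupport n z := by
  rw [mul_approxSupport hz n]
  refine cfc_nonneg fun s hs => ?_
  have := spectrum_nonneg_of_nonneg hz hs
  positivity

theorem monotone_mul_approxSupport : Monotone fun n => z * approxSupport n z := by
  intro k n hkn
  simp only [mul_approxSupport hz]
  refine cfc_mono (fun s hs => ?_)
    (continuousOn_id.mul (continuousOn_approxSupport hz k))
    (continuousOn_id.mul (continuousOn_approxSupport hz n))
  have h0 := spectrum_nonneg_of_nonneg hz hs
  have hk := one_add_mul_pos_of_mem_spectrum hz k hs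
  have hn := one_add_mul_pos_of_mem_spectrum hz n hs
  refine mul_le_mul_of_nonneg_left ?_ h0
  rw [div_le_div_iff₀ hk hn]
  have : (k : ℝ) * s ≤ n * s := by gcongr
  nlinarith

theorem sub_mul_approxSupport :
    z - z * approxSupport n z = cfc (fun s : ℝ => s / (1 + n * s)) z := by
  have h := continuousOn_approxSupport hz n
  have e : cfc (fun s : ℝ => s - s * (n * s / (1 + n * s))) z = z - z * approxSupport n z := by
    rw [cfc_sub (fun s : ℝ => s) (fun s : ℝ => s * (n * s / (1 + n * s))) z (by fun_prop)
      (continuousOn_id.mul h), cfc_id' ℝ z,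
      mul_approxSupport hz n]
  rw [← e]
  refine cfc_congr fun s hs => ?_
  have hn := (one_add_mul_pos_of_mem_spectrum hz n hs).ne'
  rw [eq_div_iff hn, sub_mul, ← mul_div_assoc, div_mul_cancel₀ _ hn]
  ring

theorem norm_sub_mul_approxSupport_le (n : ℕ) :
    ‖z - z * approxSupport (n + 1) z‖ ≤ 1 / (n + 1 : ℝ) := by
  rw [sub_mul_approxSupport hz]
  refine norm_cfc_le (by positivity) fun s hs => ?_
  have h0 := spectrum_nonneg_of_nonneg hz hs
  have hn := one_add_mul_pos_of_mem_spectrum hz (n + 1) hs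
  rw [Real.norm_of_nonneg (by positivity), div_le_div_iff₀ hn (by positivity)]
  push_cast
  linarith

theorem tendsto_mul_approxSupport :
    Tendsto (fun n => z * approxSupport n z) atTop (𝓝 z) := by
  rw [← tendsto_add_atTop_iff_nat 1, tendsto_iff_norm_sub_tendsto_zero]
  refine squeeze_zero (fun _ => norm_nonneg _) (fun n => ?_)
    (tendsto_one_div_add_atTop_nhds_zero_nat (𝕜 := ℝ))
  rw [norm_sub_rev]
  exact norm_sub_mul_approxSupport_le hz n

theorem star_approxSupport : star (approxSupport n z) = approxSupport n z :=
  (approxSupport_nonneg hz n).isSelfAdjoint.star_eq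

/-- In the form $g^*zg$ with $g=\sqrt h$, an upper bound for $z$ passes to $zh$, since conjugation
is monotone. -/
theorem sqrt_conj_approxSupport :
    star (CFC.sqrt (approxSupport n z)) * z * CFC.sqrt (approxSupport n z)
      = z * approxSupport n z := by
  have h1 : Commute z (CFC.sqrt (approxSupport n z)) := by
    have h0 : Commute (CFC.sqrt (approxSupport n z)) z := by
      unfold CFC.sqrt
      exact (commute_approxSupport hz n).symm.cfcₙ_nnreal _
    exact h0.symm
  rw [(CFC.sqrt_nonneg _).isSelfAdjoint.star_eq, ← h1.eq, mul_assoc,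
    CFC.sqrt_mul_sqrt_self _ (approxSupport_nonneg hz n)]

theorem antitone_sq_sub_mul_approxSupport :
    Antitone fun n => (z - z * approxSupport n z) * (z - z * approxSupport n z) := by
  have hc : ∀ n : ℕ, ContinuousOn (fun s : ℝ => s / (1 + n * s)) (spectrum ℝ z) := fun n =>
    ContinuousOn.div (by fun_prop) (by fun_prop)
      fun _ hs => (one_add_mul_pos_of_mem_spectrum hz n hs).ne'
  intro k n hkn
  simp only [sub_mul_approxSupport hz]
  rw [← cfc_mul _ _ z (hc n) (hc n), ← cfc_mul _ _ z (hc k) (hc k)]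
  refine cfc_mono (fun s hs => ?_) ((hc n).mul (hc n)) ((hc k).mul (hc k))
  have h0 := spectrum_nonneg_of_nonneg hz hs
  have hk := one_add_mul_pos_of_mem_spectrum hz k hs
  have hn := one_add_mul_pos_of_mem_spectrum hz n hs
  have : s / (1 + n * s) ≤ s / (1 + k * s) := by gcongr
  have h1 : 0 ≤ s / (1 + n * s) := by positivity
  exact mul_self_le_mul_self h1 this

end Approximant

/-! ### The linear extension of the trace and the inner product of $L_2$ -/

namespace SemifiniteTrace

variable {M : Type*} [CStarAlgebra M] [PartialOrder M] [StarOrderedRing M]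
  (τ : SemifiniteTrace M)

/-- A norm limit of an increasing sequence is its supremum, so normality applies. This lets norm
approximations play the role of spectral projections. -/
theorem tendsto_trace_of_monotone {u : ℕ → M} (hu0 : ∀ n, 0 ≤ u n) (hu : Monotone u) {z : M}
    (hz : Tendsto u atTop (𝓝 z)) :
    Tendsto (fun n => τ.toFun (u n)) atTop (𝓝 (τ.toFun z)) := by
  have h1 := isLUB_of_tendsto_atTop hu hz
  have h2 := τ.normal (Set.range u) z (Set.range_nonempty _)
    (directedOn_range.2 hu.directed_le) (by rintro _ ⟨n, rfl⟩; exact hu0 n) h1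
  rw [← Set.range_comp] at h2
  exact tendsto_atTop_isLUB (fun k n h => τ.mono (hu0 k) (hu h)) h2

theorem trace_le_of_approxSupport {z : M} (hz : 0 ≤ z) {c : ℝ≥0∞}
    (h : ∀ n, τ.toFun (z * approxSupport n z) ≤ c) : τ.toFun z ≤ c :=
  le_of_tendsto' (τ.tendsto_trace_of_monotone (mul_approxSupport_nonneg hz)
    (monotone_mul_approxSupport hz) (tendsto_mul_approxSupport hz)) h

theorem trace_approxSupport_lt_top {z : M} (hz : 0 ≤ z) (h : τ.toFun z < ⊤) (n : ℕ) :
    τ.toFun (approxSupport n z) < ⊤ := by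
  refine (τ.mono (approxSupport_nonneg hz n) (approxSupport_le_smul hz n)).trans_lt ?_
  rw [τ.map_real_smul (by positivity) hz]
  exact ENNReal.mul_lt_top ENNReal.ofReal_lt_top h

theorem trace_conj_le {a : M} (ha : 0 ≤ a) (b : M) :
    τ.toFun (star b * a * b) ≤ ENNReal.ofReal ‖a‖ * τ.toFun (star b * b) := by
  rw [← τ.map_real_smul (norm_nonneg _) (star_mul_self_nonneg _)]
  exact τ.mono (star_left_conjugate_nonneg ha b)
    (CStarAlgebra.star_left_conjugate_le_norm_smul ha.isSelfAdjoint)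

theorem star_sqrt (a : M) : star (CFC.sqrt a) = CFC.sqrt a :=
  (CFC.sqrt_nonneg _).isSelfAdjoint.star_eq

/-- `τ(√a b √a) = τ(√b a √b)`. -/
theorem trace_sqrt_conj {a b : M} (ha : 0 ≤ a) (hb : 0 ≤ b) :
    τ.toFun (star (CFC.sqrt a) * b * CFC.sqrt a) = τ.toFun (star (CFC.sqrt b) * a * CFC.sqrt b) := by
  have h := τ.tracial (CFC.sqrt b * CFC.sqrt a)
  have ea := CFC.sqrt_mul_sqrt_self a ha
  have eb := CFC.sqrt_mul_sqrt_self b hb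
  simp only [star_mul, star_sqrt] at h ⊢
  calc _ = τ.toFun (CFC.sqrt a * CFC.sqrt b * (CFC.sqrt b * CFC.sqrt a)) := by
        congr 1; nth_rewrite 1 [← eb]; simp only [mul_assoc]
    _ = _ := h
    _ = _ := by congr 1; nth_rewrite 3 [← ea]; simp only [mul_assoc]

theorem trace_conj_sqrt_le {a b : M} (ha : 0 ≤ a) (hb : 0 ≤ b) :
    τ.toFun (star (CFC.sqrt a) * b * CFC.sqrt a) ≤ ENNReal.ofReal ‖b‖ * τ.toFun a := by
  have h := τ.trace_conj_le hb (CFC.sqrt a)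
  simp only [star_sqrt] at h ⊢
  rwa [CFC.sqrt_mul_sqrt_self a ha] at h

/-- Compress $a=p-q$ by $g=\sqrt h$, where $h$ is an approximate support of $a^+$. Since $ha^-=0$,
one gets $a^+h=gag\le gpg$, and $\tau(gpg)=\tau(\sqrt p\,h\sqrt p)\le\tau(p)$ because $h\le1$. -/
theorem trace_posPart_le {p q : M} (hp : 0 ≤ p) (hq : 0 ≤ q) :
    τ.toFun ((p - q)⁺) ≤ τ.toFun p := by
  set a := p - q with ha
  have hsa : IsSelfAdjoint a := hp.isSelfAdjoint.sub hq.isSelfAdjoint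
  have hz : (0 : M) ≤ a⁺ := CFC.posPart_nonneg a
  have hw : (0 : M) ≤ a⁻ := CFC.negPart_nonneg a
  refine τ.trace_le_of_approxSupport hz fun n => ?_
  set h := approxSupport n (a⁺) with hh
  have h0 : 0 ≤ h := approxSupport_nonneg hz n
  set g := CFC.sqrt h with hg
  have hhw : h * a⁻ = 0 := by
    have e : h = cfc (fun s : ℝ => n / (1 + n * s)) (a⁺) * a⁺ := by
      nth_rewrite 2 [← cfc_id' ℝ (a⁺)]
      rw [← cfc_mul (fun s : ℝ => n / (1 + n * s)) (fun s : ℝ => s) _ (ContinuousOn.div (by fun_prop) (by fun_prop)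
        fun _ hs => (one_add_mul_pos_of_mem_spectrum hz n hs).ne')]
      refine cfc_congr fun s hs => ?_
      ring
    rw [e, mul_assoc, CFC.posPart_mul_negPart, mul_zero]
  have hgw : g * a⁻ = 0 := by
    rw [← CStarRing.star_mul_self_eq_zero_iff, star_mul, star_sqrt, mul_assoc, ← mul_assoc g,
      CFC.sqrt_mul_sqrt_self h h0, hhw, mul_zero]
  have e1 : star g * a * g = a⁺ * h := by
    rw [← sqrt_conj_approxSupport hz n, ← hh, ← hg]
    nth_rewrite 1 [← CFC.posPart_sub_negPart a hsa]
    rw [mul_sub, star_sqrt, hgw, sub_zero]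
  have hle : a⁺ * h ≤ star g * p * g := by
    rw [← e1]
    exact star_left_conjugate_le_conjugate (by rw [ha]; exact sub_le_self _ hq) g
  refine (τ.mono (mul_approxSupport_nonneg hz n) hle).trans ?_
  rw [hg, τ.trace_sqrt_conj h0 hp]
  refine (τ.trace_conj_sqrt_le hp h0).trans ?_
  refine mul_le_of_le_one_left (zero_le) ?_
  rw [← ENNReal.ofReal_one]
  exact ENNReal.ofReal_le_ofReal (norm_approxSupport_le_one hz n)

theorem toReal_posPart_sub_negPart {p q : M} (hp : 0 ≤ p) (hq : 0 ≤ q)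
    (hp' : τ.toFun p < ⊤) (hq' : τ.toFun q < ⊤) :
    (τ.toFun ((p - q)⁺)).toReal - (τ.toFun ((p - q)⁻)).toReal
      = (τ.toFun p).toReal - (τ.toFun q).toReal := by
  have h1 := (τ.trace_posPart_le hp hq).trans_lt hp'
  have e : (p - q)⁻ = (q - p)⁺ := by rw [← CFC.posPart_neg, neg_sub]
  have h2 : τ.toFun ((p - q)⁻) < ⊤ := by
    rw [e]; exact (τ.trace_posPart_le hq hp).trans_lt hq'
  have h3 := CFC.posPart_sub_negPart (p - q) (hp.isSelfAdjoint.sub hq.isSelfAdjoint)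
  have h4 : (p - q)⁺ + q = p + (p - q)⁻ := by
    rw [sub_eq_sub_iff_add_eq_add] at h3
    exact h3
  have h5 := congrArg (fun x => (τ.toFun x).toReal) h4
  rw [τ.map_add _ _ (CFC.posPart_nonneg _) hq, τ.map_add _ _ hp (CFC.negPart_nonneg _),
    ENNReal.toReal_add h1.ne hq'.ne, ENNReal.toReal_add hp'.ne h2.ne] at h5
  linarith

/-- Although `ext` is defined through positive and negative parts, `toReal_posPart_sub_negPart`
shows that any decomposition with finite traces gives the same value. -/
theorem ext_of_decomposition {x p q p' q' : M} (hp : 0 ≤ p) (hq : 0 ≤ q) (hp' : 0 ≤ p')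
    (hq' : 0 ≤ q') (tp : τ.toFun p < ⊤) (tq : τ.toFun q < ⊤) (tp' : τ.toFun p' < ⊤)
    (tq' : τ.toFun q' < ⊤) (hx : x = (p - q) + Complex.I • (p' - q')) :
    τ.ext x = (((τ.toFun p).toReal - (τ.toFun q).toReal : ℝ) : ℂ)
      + (((τ.toFun p').toReal - (τ.toFun q').toReal : ℝ) : ℂ) * Complex.I := by
  have s1 : star (p - q) = p - q := (hp.isSelfAdjoint.sub hq.isSelfAdjoint).star_eq
  have s2 : star (p' - q') = p' - q' := (hp'.isSelfAdjoint.sub hq'.isSelfAdjoint).star_eq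
  have hsx : star x = (p - q) - Complex.I • (p' - q') := by
    rw [hx, star_add, star_smul, s1, s2]
    rw [Complex.star_def, Complex.conj_I, neg_smul, ← sub_eq_add_neg]
  have hre : (ℜ x : M) = p - q := by
    rw [realPart_apply_coe, hsx, hx]
    module
  have him : (ℑ x : M) = p' - q' := by
    rw [imaginaryPart_apply_coe, hsx, hx, add_sub_sub_cancel, ← two_smul ℝ, smul_smul,
      inv_mul_cancel₀ two_ne_zero, one_smul, smul_smul]
    simp
  rw [ext, hre, him, τ.toReal_posPart_sub_negPart hp hq tp tq,
    τ.toReal_posPart_sub_negPart hp' hq' tp' tq']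

namespace PreL2

variable {τ}

/-- Polarization writes $b^*c$ as a combination of four squares of finite trace. Thus the symmetry
of $S_t$, assumed for `ext`, becomes a statement on inner products. -/
theorem ext_star_mul (b c : τ.PreL2) : τ.ext (star (val b) * val c) = ⟪b, c⟫_ℂ := by
  have key : ∀ y : τ.PreL2, 0 ≤ (1 / 4 : ℝ) • (star (val y) * val y) := fun y =>
    smul_nonneg (by norm_num) (star_mul_self_nonneg _)
  have tr : ∀ y : τ.PreL2, τ.toFun ((1 / 4 : ℝ) • (star (val y) * val y)) < ⊤ := fun y => by
    rw [τ.map_real_smul (by norm_num) (star_mul_self_nonneg _)]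
    exact ENNReal.mul_lt_top ENNReal.ofReal_lt_top (lt_top y)
  have tv : ∀ y : τ.PreL2, (τ.toFun ((1 / 4 : ℝ) • (star (val y) * val y))).toReal
      = 1 / 4 * ‖y‖ ^ 2 := fun y => by
    rw [τ.map_real_smul (by norm_num) (star_mul_self_nonneg _), ENNReal.toReal_mul,
      ENNReal.toReal_ofReal (by norm_num), norm_sq]
  rw [τ.ext_of_decomposition (key (b + c)) (key (b - c)) (key (b - Complex.I • c))
    (key (b + Complex.I • c)) (tr _) (tr _) (tr _) (tr _), tv, tv, tv, tv,
    inner_eq_sum_norm_sq_div_four]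
  · simp only [RCLike.I_to_complex]
    push_cast
    simp only [Complex.coe_algebraMap]
    ring
  · have h : ∀ z : ℂ, star (val (b + z • c)) * val (b + z • c)
        = star (val b) * val b + z • (star (val b) * val c) + star z • (star (val c) * val b)
          + (star z * z) • (star (val c) * val c) := by
      intro z
      simp only [_root_.map_add, _root_.map_smul, star_add, star_smul, add_mul, mul_add,
        smul_mul_assoc, mul_smul_comm, smul_add, smul_smul]
      rw [mul_comm z]
      abel
    have e1 : b + c = b + (1 : ℂ) • c := by rw [one_smul]
    have e2 : b - c = b + (-1 : ℂ) • c := by rw [neg_one_smul, sub_eq_add_neg]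
    have e3 : b - Complex.I • c = b + (-Complex.I) • c := by rw [neg_smul, sub_eq_add_neg]
    rw [e1, e2, e3, h, h, h, h]
    simp only [← Complex.coe_smul]
    simp only [star_one, star_neg, Complex.star_def, Complex.conj_I, neg_neg, mul_neg, neg_mul,
      Complex.I_mul_I, mul_one]
    match_scalars <;> ring_nf <;> simp <;> ring_nf

/-- The adjoint on `M ∩ L_2(M)`. -/
def starMap (x : τ.PreL2) : τ.PreL2 :=
  mk (star (val x)) (by rw [τ.tracial, star_star]; exact lt_top x)

theorem val_starMap (x : τ.PreL2) : val (starMap x) = star (val x) := rfl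

theorem norm_starMap (x : τ.PreL2) : ‖starMap x‖ = ‖x‖ := by
  rw [norm_def, norm_def, val_starMap, star_star, ← τ.tracial]

/-- By traciality the adjoint is isometric; a conjugate-linear isometry reverses inner products, by
polarization. -/
theorem inner_starMap (x y : τ.PreL2) : ⟪starMap x, starMap y⟫_ℂ = ⟪y, x⟫_ℂ := by
  have e1 : starMap x + starMap y = starMap (y + x) :=
    val_injective (by simp [val_starMap, add_comm])
  have e2 : starMap x - starMap y = -starMap (y - x) :=
    val_injective (by simp [val_starMap])
  have e3 : starMap x + Complex.I • starMap y = Complex.I • starMap (y + Complex.I • x) :=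
    val_injective (by
      simp only [_root_.map_add, _root_.map_smul, val_starMap, star_add, star_smul, smul_add,
        smul_smul, Complex.star_def, Complex.conj_I, mul_neg, Complex.I_mul_I, neg_neg, one_smul]
      rw [add_comm])
  have e4 : starMap x - Complex.I • starMap y = (-Complex.I) • starMap (y - Complex.I • x) :=
    val_injective (by
      simp only [neg_smul, smul_neg, _root_.map_neg, _root_.map_sub, _root_.map_smul, val_starMap, star_sub, star_smul, smul_sub,
        smul_smul, Complex.star_def, Complex.conj_I, Complex.I_mul_I, neg_neg,
        one_smul]
      abel)
  rw [inner_eq_sum_norm_sq_div_four, inner_eq_sum_norm_sq_div_four]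
  simp only [RCLike.I_to_complex]
  rw [e1, e2, e3, e4]
  simp only [norm_neg, norm_smul, norm_starMap, neg_smul, Complex.norm_I, one_mul]

end PreL2

end SemifiniteTrace

/-! ### The Kadison-Schwarz inequality -/

section KadisonSchwarz

variable {M : Type*} [CStarAlgebra M] [PartialOrder M] [StarOrderedRing M]

theorem CStarMatrix.diag_nonneg {n : Type*} [Fintype n] {Q : CStarMatrix n n M}
    (hQ : 0 ≤ Q) (i : n) : 0 ≤ Q i i := by
  rw [StarOrderedRing.nonneg_iff] at hQ
  induction hQ using AddSubmonoid.closure_induction with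
  | mem Q h =>
    obtain ⟨B, rfl⟩ := h
    simp only [CStarMatrix.mul_apply, CStarMatrix.star_apply]
    exact Finset.sum_nonneg fun k _ => star_mul_self_nonneg (B k i)
  | zero => exact le_rfl
  | add Q R _ _ hQ hR => exact add_nonneg hQ hR

/-- The Kadison-Schwarz inequality for completely positive maps. -/
theorem CompletelyPositiveMap.star_mul_self_le (φ : M →CP M) {K : ℝ} (hK : 0 < K)
    (h1 : φ 1 ≤ K • 1) (x : M) : star (φ x) * φ x ≤ K • φ (star x * x) := by
  -- $A^*A$ has rows $(x^*x,\,x^*)$ and $(x,\,1)$, so its image has $\varphi(x)$ off the diagonal.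
  set A : CStarMatrix (Fin 2) (Fin 2) M := CStarMatrix.ofMatrix !![x, 1; 0, 0] with hA
  have hP := φ.map_cstarMatrix_nonneg (star A * A) (star_mul_self_nonneg A)
  set P := (star A * A).map φ with hPdef
  have e00 : P 0 0 = φ (star x * x) := by
    simp [hPdef, hA, CStarMatrix.mul_apply, CStarMatrix.star_apply, CStarMatrix.map_apply]
  have e10 : P 1 0 = φ x := by
    simp [hPdef, hA, CStarMatrix.mul_apply, CStarMatrix.star_apply, CStarMatrix.map_apply]
  have e11 : P 1 1 = φ 1 := by
    simp [hPdef, hA, CStarMatrix.mul_apply, CStarMatrix.star_apply, CStarMatrix.map_apply]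
  have e01 : P 0 1 = star (φ x) := by
    have h := congrFun (congrFun (hP.isSelfAdjoint.star_eq) 0) 1
    rw [CStarMatrix.star_apply, e10] at h
    exact h.symm
  set c : ℝ := K⁻¹ with hc
  -- Compression to the column $(1,-c\varphi(x))$; the value $c=1/K$ minimizes $-2c+Kc^2$.
  set V : CStarMatrix (Fin 2) (Fin 2) M := CStarMatrix.ofMatrix !![1, 0; -(c • φ x), 0] with hV
  have h2 := CStarMatrix.diag_nonneg (star_left_conjugate_nonneg hP V) 0
  have e : (star V * P * V) 0 0 = φ (star x * x) - (2 * c) • (star (φ x) * φ x)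
      + (c ^ 2) • (star (φ x) * φ 1 * φ x) := by
    simp only [CStarMatrix.mul_apply, Fin.sum_univ_two, e00, e01, e10, e11,
      CStarMatrix.star_apply]
    simp [hV, add_mul, mul_assoc]
    module
  rw [e] at h2
  have h3 : star (φ x) * φ 1 * φ x ≤ K • (star (φ x) * φ x) := by
    have := star_left_conjugate_le_conjugate h1 (φ x)
    simpa using this
  have h4 : (c ^ 2) • (star (φ x) * φ 1 * φ x) ≤ c • (star (φ x) * φ x) := by
    refine (smul_le_smul_of_nonneg_left h3 (by positivity)).trans_eq ?_
    rw [smul_smul, hc, sq, mul_assoc, inv_mul_cancel₀ hK.ne', mul_one]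
  have h5 : c • (star (φ x) * φ x) ≤ φ (star x * x) := by
    rw [← sub_nonneg]
    refine h2.trans ?_
    have : φ (star x * x) - (2 * c) • (star (φ x) * φ x) + c ^ 2 • (star (φ x) * φ 1 * φ x)
      ≤ φ (star x * x) - (2 * c) • (star (φ x) * φ x) + c • (star (φ x) * φ x) := by gcongr
    refine this.trans_eq ?_
    module
  have h6 := smul_le_smul_of_nonneg_left h5 hK.le
  rwa [smul_smul, hc, mul_inv_cancel₀ hK.ne', one_smul] at h6

end KadisonSchwarz

/-! ### Positive integrable elements and their density in $L_2$ -/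

namespace SemifiniteTrace

variable {M : Type*} [CStarAlgebra M] [PartialOrder M] [StarOrderedRing M]
  (τ : SemifiniteTrace M)

theorem powInt_one_of_nonneg {y : M} (hy : 0 ≤ y) : τ.powInt 1 y = τ.toFun y := by
  rw [powInt, CFC.abs_of_nonneg y hy, CFC.rpow_one y hy]

namespace PreL2

variable {τ}

/-- The square root of an integrable positive element, as an element of `L_2`. -/
def sqrt {x : M} (hx : 0 ≤ x) (h : τ.toFun x < ⊤) : τ.PreL2 :=
  mk (CFC.sqrt x) (by rwa [star_sqrt, CFC.sqrt_mul_sqrt_self x hx])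

theorem val_sqrt {x : M} (hx : 0 ≤ x) (h : τ.toFun x < ⊤) :
    val (sqrt hx h) = CFC.sqrt x := rfl

theorem starMap_sqrt {x : M} (hx : 0 ≤ x) (h : τ.toFun x < ⊤) :
    starMap (sqrt hx h) = sqrt hx h :=
  val_injective (by rw [val_starMap, val_sqrt, star_sqrt])

theorem vecDual_coe_eq_inner (x : τ.PreL2) (a : M) : τ.vecDual x a = ⟪x, lmul a x⟫_ℂ := by
  rw [vecDual_apply, lmul_coe, UniformSpace.Completion.inner_coe]

/-- Traciality gives $\tau(xa)=\tau(\sqrt x\,a\sqrt x)$, so pairing with a positive integrable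
element is a vector functional, hence normal. -/
theorem ext_mul_left {x : M} (hx : 0 ≤ x) (h : τ.toFun x < ⊤) (a : M) :
    τ.ext (x * a) = τ.vecDual (sqrt hx h : τ.PreL2) a := by
  have e : x * a = star (val (sqrt hx h)) * val (starMap (lmul (star a) (sqrt hx h))) := by
    rw [val_starMap, val_lmul, val_sqrt, star_mul, star_star, star_sqrt, ← mul_assoc,
      CFC.sqrt_mul_sqrt_self x hx]
  rw [e, ext_star_mul]
  nth_rewrite 1 [← starMap_sqrt hx h]
  rw [inner_starMap, inner_lmul, star_star, vecDual_coe_eq_inner]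

theorem ext_mul_right {x : M} (hx : 0 ≤ x) (h : τ.toFun x < ⊤) (a : M) :
    τ.ext (a * x) = τ.vecDual (sqrt hx h : τ.PreL2) a := by
  have e : a * x = star (val (starMap (lmul a (sqrt hx h)))) * val (sqrt hx h) := by
    rw [val_starMap, val_lmul, val_sqrt, star_star, mul_assoc, CFC.sqrt_mul_sqrt_self x hx]
  rw [e, ext_star_mul]
  nth_rewrite 2 [← starMap_sqrt hx h]
  rw [inner_starMap, vecDual_coe_eq_inner]

/-- The squared distance is $\tau(v_n)$ with $v_n=(z-zh_n)^2$ decreasing to $0$ in norm. Norm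
convergence alone says nothing about traces, but normality applies to $z^2-v_n\uparrow z^2$, and
$\tau(z^2)<\infty$. -/
theorem tendsto_mul_approxSupport {p : τ.PreL2} (hp : 0 ≤ val p) :
    Tendsto (fun n => (lmul (approxSupport n (val p)) p : τ.PreL2)) atTop (𝓝 p) := by
  set z := val p with hz
  set v : ℕ → M := fun n => (z - z * approxSupport n z) * (z - z * approxSupport n z) with hv
  have hsa : ∀ n, star (z - z * approxSupport n z) = z - z * approxSupport n z := fun n => by
    rw [star_sub, star_mul, star_approxSupport hp, hp.isSelfAdjoint.star_eq,
      ← (commute_approxSupport hp n).eq]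
  have hv0 : ∀ n, 0 ≤ v n := fun n => by
    have := star_mul_self_nonneg (z - z * approxSupport n z)
    rwa [hsa] at this
  have hanti : Antitone v := antitone_sq_sub_mul_approxSupport hp
  -- Thus $v_0=z^2$, and antitonicity bounds every $v_n$ by $z^2$.
  have hz0 : z * approxSupport 0 z = 0 := by
    rw [mul_approxSupport hp]
    simp
  have hvz : ∀ n, v n ≤ z * z := fun n => by
    have := hanti (Nat.zero_le n)
    simpa [hv, hz0] using this
  have hlim : Tendsto (fun n => z * z - v n) atTop (𝓝 (z * z)) := by
    have h1 : Tendsto (fun n => z - z * approxSupport n z) atTop (𝓝 (z - z)) :=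
      tendsto_const_nhds.sub (_root_.tendsto_mul_approxSupport hp)
    have h2 := (tendsto_const_nhds (x := z * z)).sub (h1.mul h1)
    simpa using h2
  have htr := τ.tendsto_trace_of_monotone (fun n => sub_nonneg.2 (hvz n))
    (fun k n h => sub_le_sub_left (hanti h) _) hlim
  have hzz : τ.toFun (z * z) < ⊤ := by
    have := lt_top p
    rwa [← hz, hp.isSelfAdjoint.star_eq] at this
  have hfin : ∀ n, τ.toFun (v n) < ⊤ := fun n => (τ.mono (hv0 n) (hvz n)).trans_lt hzz
  have hsub : ∀ n, τ.toFun (z * z - v n) ≠ ⊤ := fun n =>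
    ((τ.mono (sub_nonneg.2 (hvz n)) (sub_le_self _ (hv0 n))).trans_lt hzz).ne
  have hadd : ∀ n, (τ.toFun (v n)).toReal
      = (τ.toFun (z * z)).toReal - (τ.toFun (z * z - v n)).toReal := fun n => by
    have := τ.map_add _ _ (sub_nonneg.2 (hvz n)) (hv0 n)
    rw [sub_add_cancel] at this
    rw [this, ENNReal.toReal_add (hsub n) (hfin n).ne]
    ring
  have h0 : Tendsto (fun n => (τ.toFun (v n)).toReal) atTop (𝓝 0) := by
    have h1 := (ENNReal.tendsto_toReal hzz.ne).comp htr
    have h2 := (tendsto_const_nhds (x := (τ.toFun (z * z)).toReal)).sub h1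
    rw [sub_self] at h2
    exact h2.congr fun n => (hadd n).symm
  rw [tendsto_iff_norm_sub_tendsto_zero]
  have h3 := (Real.continuous_sqrt.tendsto 0).comp h0
  rw [Real.sqrt_zero] at h3
  refine h3.congr fun n => ?_
  rw [← norm_neg, neg_sub, norm_def, _root_.map_sub, val_lmul, ← hz,
    ← (commute_approxSupport hp n).eq, hsa]
  rfl

/-- $a^2=(a^+)^2+(a^-)^2$, so both parts are square integrable when $a$ is. -/
theorem exists_posPart {x : τ.PreL2} (hx : IsSelfAdjoint (val x)) :
    ∃ p q : τ.PreL2, 0 ≤ val p ∧ 0 ≤ val q ∧ x = p - q := by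
  set a := val x with ha
  have h0 : (0 : M) ≤ a⁺ := CFC.posPart_nonneg a
  have h1 : (0 : M) ≤ a⁻ := CFC.negPart_nonneg a
  have e := CFC.posPart_sub_negPart a hx
  have hsq : star a * a = star (a⁺) * a⁺ + star (a⁻) * a⁻ := by
    rw [hx.star_eq, h0.isSelfAdjoint.star_eq, h1.isSelfAdjoint.star_eq]
    nth_rewrite 1 2 [← e]
    rw [sub_mul, mul_sub, mul_sub, CFC.posPart_mul_negPart, CFC.negPart_mul_posPart]
    abel
  have hlt := lt_top x
  rw [← ha, hsq] at hlt
  refine ⟨mk (a⁺) ((τ.mono (star_mul_self_nonneg _)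
      (le_add_of_nonneg_right (star_mul_self_nonneg _))).trans_lt hlt),
    mk (a⁻) ((τ.mono (star_mul_self_nonneg _)
      (le_add_of_nonneg_left (star_mul_self_nonneg _))).trans_lt hlt), h0, h1, ?_⟩
  exact val_injective (by rw [_root_.map_sub, val_mk, val_mk, e])

theorem induction_nonneg {p : τ.PreL2 → Prop}
    (hadd : ∀ x y, p x → p y → p (x + y)) (hsmul : ∀ (c : ℂ) x, p x → p (c • x))
    (h : ∀ x : τ.PreL2, 0 ≤ val x → p x) (x : τ.PreL2) : p x := by
  have hsa : ∀ x : τ.PreL2, IsSelfAdjoint (val x) → p x := by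
    intro x hx
    obtain ⟨y, z, hy, hz, rfl⟩ := exists_posPart hx
    rw [sub_eq_add_neg, ← neg_one_smul ℂ]
    exact hadd _ _ (h y hy) (hsmul _ _ (h z hz))
  have e : x = (2⁻¹ : ℂ) • (x + starMap x)
      + (2⁻¹ * -Complex.I) • (Complex.I • (x + (-1 : ℂ) • starMap x)) := by
    rw [smul_smul, mul_assoc, neg_mul, Complex.I_mul_I]
    module
  rw [e]
  refine hadd _ _ (hsmul _ _ (hsa _ ?_)) (hsmul _ _ (hsa _ ?_))
  · rw [_root_.map_add, val_starMap]
    exact IsSelfAdjoint.add_star_self _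
  · rw [isSelfAdjoint_iff, _root_.map_smul, _root_.map_add, _root_.map_smul, val_starMap,
      star_smul, star_add, star_smul, star_star]
    simp only [Complex.star_def, Complex.conj_I, star_neg, star_one]
    module

end PreL2

variable {τ}

/-- A closed property of vectors of `L_2`, stable under linear combinations, holds if it holds for
positive integrable elements. -/
theorem L2_induction {p : τ.L2 → Prop} (hclosed : IsClosed {x | p x})
    (hadd : ∀ x y, p x → p y → p (x + y)) (hsmul : ∀ (c : ℂ) x, p x → p (c • x))
    (h : ∀ x : τ.PreL2, 0 ≤ PreL2.val x → τ.toFun (PreL2.val x) < ⊤ → p x) (x : τ.L2) : p x := by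
  induction x using UniformSpace.Completion.induction_on with
  | hp => exact hclosed
  | ih x =>
    refine PreL2.induction_nonneg (p := fun x : τ.PreL2 => p x) (fun x y hx hy => ?_)
      (fun c x hx => ?_) (fun x hx => ?_) x
    · rw [UniformSpace.Completion.coe_add]; exact hadd _ _ hx hy
    · rw [UniformSpace.Completion.coe_smul]; exact hsmul _ _ hx
    -- A positive square integrable $p$ need not be integrable, but $ph_n$ is:
    -- $\tau(ph_n)=\tau(\sqrt p\,h_n\sqrt p)\le n\,\tau(p^2)$.
    · refine hclosed.mem_of_tendsto (((UniformSpace.Completion.continuous_coe _).tendsto _).comp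
        (PreL2.tendsto_mul_approxSupport hx)) (Eventually.of_forall fun n => ?_)
      have e := (commute_approxSupport hx n).eq
      refine h _ ?_ ?_
      · rw [PreL2.val_lmul, ← e]
        exact mul_approxSupport_nonneg hx n
      · rw [PreL2.val_lmul, ← e, ← sqrt_conj_approxSupport hx n]
        have h0 := approxSupport_nonneg hx n
        rw [τ.trace_sqrt_conj h0 hx]
        have h1 : star (CFC.sqrt (PreL2.val x)) * approxSupport n (PreL2.val x)
            * CFC.sqrt (PreL2.val x) ≤ (n : ℝ) • (star (PreL2.val x) * PreL2.val x) := by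
          have h2 := star_left_conjugate_le_conjugate (approxSupport_le_smul hx n)
            (CFC.sqrt (PreL2.val x))
          refine h2.trans_eq ?_
          have e1 := CFC.sqrt_mul_sqrt_self (PreL2.val x) hx
          rw [mul_smul_comm, smul_mul_assoc, star_sqrt, hx.isSelfAdjoint.star_eq]
          congr 1
          calc _ = CFC.sqrt (PreL2.val x) * (CFC.sqrt (PreL2.val x) * CFC.sqrt (PreL2.val x))
                * CFC.sqrt (PreL2.val x) := by rw [e1]
            _ = (CFC.sqrt (PreL2.val x) * CFC.sqrt (PreL2.val x))
                * (CFC.sqrt (PreL2.val x) * CFC.sqrt (PreL2.val x)) := by simp only [mul_assoc]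
            _ = _ := by rw [e1]
        refine (τ.mono (star_left_conjugate_nonneg h0 _) h1).trans_lt ?_
        rw [τ.map_real_smul (by positivity) (star_mul_self_nonneg _)]
        exact ENNReal.mul_lt_top ENNReal.ofReal_lt_top (PreL2.lt_top x)

end SemifiniteTrace

/-! ### The semigroup on $L_2$ and its multipliers -/

namespace BoundedSemigroup

open SemifiniteTrace SemifiniteTrace.PreL2

variable {M : Type*} [CStarAlgebra M] [PartialOrder M] [StarOrderedRing M]
  {τ : SemifiniteTrace M} (𝒮 : BoundedSemigroup τ)

theorem exists_bound : ∃ K : ℝ, 1 ≤ K ∧ ∀ t, 0 ≤ t → ∀ f, ‖𝒮.S t f‖ ≤ K * ‖f‖ := by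
  obtain ⟨K, hK⟩ := 𝒮.bounded
  exact ⟨max K 1, le_max_right _ _, fun t ht f => (hK t ht f).trans (by gcongr; exact le_max_left _ _)⟩

theorem map_nonneg' (t : ℝ) {f : M} (hf : 0 ≤ f) : 0 ≤ 𝒮.S t f := map_nonneg (𝒮.S t) hf

/-- Duality with the bound on $\mathcal M$. Semifiniteness reduces to $z\le S_ty$ of finite trace;
for an approximate support $g$ of $z$, symmetry gives $\tau(S_t(y)g)=\tau(yS_t(g))\le K\tau(y)$, as
$\|g\|\le1$. -/
theorem trace_le {K : ℝ} (hK : 1 ≤ K) (hb : ∀ t, 0 ≤ t → ∀ f, ‖𝒮.S t f‖ ≤ K * ‖f‖)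
    {t : ℝ} (ht : 0 ≤ t) {y : M} (hy : 0 ≤ y) (h : τ.toFun y < ⊤) :
    τ.toFun (𝒮.S t y) ≤ ENNReal.ofReal K * τ.toFun y := by
  have hSy := 𝒮.map_nonneg' t hy
  refine (τ.semifinite _ hSy).2 ?_
  rintro _ ⟨z, hz, hzy, hzt, rfl⟩
  refine τ.trace_le_of_approxSupport hz fun n => ?_
  set g := approxSupport n z with hg
  have hg0 : 0 ≤ g := approxSupport_nonneg hz n
  have hgt : τ.toFun g < ⊤ := τ.trace_approxSupport_lt_top hz hzt n
  have hSg := 𝒮.map_nonneg' t hg0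
  have h1 : τ.toFun (z * g) ≤ τ.toFun (star (CFC.sqrt g) * 𝒮.S t y * CFC.sqrt g) := by
    rw [hg, ← sqrt_conj_approxSupport hz n]
    exact τ.mono (star_left_conjugate_nonneg hz _) (star_left_conjugate_le_conjugate hzy _)
  have h2 : τ.toFun (star (CFC.sqrt g) * 𝒮.S t y * CFC.sqrt g)
      = τ.toFun (star (CFC.sqrt y) * 𝒮.S t g * CFC.sqrt y) := by
    have e := 𝒮.symmetric t ht y g (by rwa [τ.powInt_one_of_nonneg hy])
      (by rwa [τ.powInt_one_of_nonneg hg0])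
    rw [ext_mul_right hg0 hgt, ext_mul_left hy h, τ.vecDual_coe _ hSy, τ.vecDual_coe _ hSg] at e
    have f1 := τ.trace_conj_lt_top (sqrt hg0 hgt) hSy
    have f2 := τ.trace_conj_lt_top (sqrt hy h) hSg
    exact (ENNReal.toReal_eq_toReal_iff' f1.ne f2.ne).1 (by exact_mod_cast e)
  rw [h2] at h1
  refine h1.trans ((τ.trace_conj_sqrt_le hy hSg).trans ?_)
  gcongr
  refine (hb t ht g).trans ?_
  exact mul_le_of_le_one_right (by linarith) (norm_approxSupport_le_one hz n)

/-- Kadison-Schwarz gives $|S_tx|^2\le K\,S_t(|x|^2)$, and the trace bound contributes the second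
factor $K$. -/
theorem trace_star_mul_self_le {K : ℝ} (hK : 1 ≤ K)
    (hb : ∀ t, 0 ≤ t → ∀ f, ‖𝒮.S t f‖ ≤ K * ‖f‖) {t : ℝ} (ht : 0 ≤ t) (x : τ.PreL2) :
    τ.toFun (star (𝒮.S t (val x)) * 𝒮.S t (val x))
      ≤ ENNReal.ofReal (K ^ 2) * τ.toFun (star (val x) * val x) := by
  have hK0 : 0 < K := by linarith
  have h1 : 𝒮.S t 1 ≤ K • 1 := by
    have h2 := (𝒮.map_nonneg' t (zero_le_one (α := M))).isSelfAdjoint.le_algebraMap_norm_self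
    rw [Algebra.algebraMap_eq_smul_one] at h2
    refine h2.trans (smul_le_smul_of_nonneg_right ?_ zero_le_one)
    refine (hb t ht 1).trans (mul_le_of_le_one_right hK0.le ?_)
    rcases subsingleton_or_nontrivial M with h | h
    · rw [Subsingleton.elim (1 : M) 0, norm_zero]; exact zero_le_one
    · exact CStarRing.norm_one.le
  have h2 := (𝒮.S t).star_mul_self_le hK0 h1 (val x)
  have h3 := star_mul_self_nonneg (val x)
  refine (τ.mono (star_mul_self_nonneg _) h2).trans ?_
  rw [τ.map_real_smul hK0.le (𝒮.map_nonneg' t h3), sq, ENNReal.ofReal_mul hK0.le, mul_assoc]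
  gcongr
  exact 𝒮.trace_le hK hb ht h3 (lt_top x)

theorem exists_l2Extension {K : ℝ} (hK : 1 ≤ K)
    (hb : ∀ t, 0 ≤ t → ∀ f, ‖𝒮.S t f‖ ≤ K * ‖f‖) {t : ℝ} (ht : 0 ≤ t) :
    ∃ T, 𝒮.IsL2Extension t T := by
  have hlt : ∀ x : τ.PreL2, τ.toFun (star (𝒮.S t (val x)) * 𝒮.S t (val x)) < ⊤ := fun x =>
    (𝒮.trace_star_mul_self_le hK hb ht x).trans_lt
      (ENNReal.mul_lt_top ENNReal.ofReal_lt_top (lt_top x))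
  let T₀ : τ.PreL2 →L[ℂ] τ.PreL2 := LinearMap.mkContinuous
    { toFun := fun x => PreL2.mk (𝒮.S t (val x)) (hlt x)
      map_add' := fun x y => val_injective (by simp [val_mk])
      map_smul' := fun c x => val_injective (by simp [val_mk]) } K fun x => by
    refine le_of_sq_le_sq ?_ (by positivity)
    rw [mul_pow, norm_sq, norm_sq]
    have h := ENNReal.toReal_mono
      (ENNReal.mul_lt_top ENNReal.ofReal_lt_top (lt_top x)).ne
      (𝒮.trace_star_mul_self_le hK hb ht x)
    rw [ENNReal.toReal_mul, ENNReal.toReal_ofReal (by positivity)] at h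
    exact h
  refine ⟨T₀.completion, ?_⟩
  rintro f _ ⟨h, rfl⟩
  refine ⟨hlt (PreL2.mk f h), ?_⟩
  rw [ContinuousLinearMap.completion_apply_coe]
  rfl

theorem isL2Extension_l2 {t : ℝ} (ht : 0 ≤ t) : 𝒮.IsL2Extension t (𝒮.l2 t) := by
  obtain ⟨K, hK, hb⟩ := 𝒮.exists_bound
  have h := 𝒮.exists_l2Extension hK hb ht
  rw [l2, dif_pos h]
  exact h.choose_spec

theorem sq_lt_top {t : ℝ} (ht : 0 ≤ t) (x : τ.PreL2) :
    τ.toFun (star (𝒮.S t (val x)) * 𝒮.S t (val x)) < ⊤ :=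
  (𝒮.isL2Extension_l2 ht (val x) x ⟨lt_top x, rfl⟩).1

theorem l2_coe {t : ℝ} (ht : 0 ≤ t) (x : τ.PreL2) :
    𝒮.l2 t x = (PreL2.mk (𝒮.S t (val x)) (𝒮.sq_lt_top ht x) : τ.PreL2) :=
  (𝒮.isL2Extension_l2 ht (val x) x ⟨lt_top x, rfl⟩).2

theorem norm_l2_le {K : ℝ} (hK : 1 ≤ K) (hb : ∀ t, 0 ≤ t → ∀ f, ‖𝒮.S t f‖ ≤ K * ‖f‖)
    {t : ℝ} (ht : 0 ≤ t) : ‖𝒮.l2 t‖ ≤ K := by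
  refine ContinuousLinearMap.opNorm_le_bound _ (by linarith) fun v => ?_
  induction v using UniformSpace.Completion.induction_on with
  | hp => exact isClosed_le (by fun_prop) (by fun_prop)
  | ih x =>
    rw [l2_coe _ ht, UniformSpace.Completion.norm_coe, UniformSpace.Completion.norm_coe]
    refine le_of_sq_le_sq ?_ (mul_nonneg (by linarith) (norm_nonneg _))
    rw [mul_pow, norm_sq, norm_sq]
    have h := ENNReal.toReal_mono
      (ENNReal.mul_lt_top ENNReal.ofReal_lt_top (lt_top x)).ne
      (𝒮.trace_star_mul_self_le hK hb ht x)
    rw [ENNReal.toReal_mul, ENNReal.toReal_ofReal (by positivity)] at h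
    exact h

theorem l2_zero : 𝒮.l2 0 = 1 := by
  ext v
  induction v using UniformSpace.Completion.induction_on with
  | hp => exact isClosed_eq (by fun_prop) (by fun_prop)
  | ih x =>
    rw [l2_coe _ le_rfl]
    change _ = (x : τ.L2)
    congr 1
    exact val_injective (by rw [val_mk, 𝒮.zero])

theorem l2_add (s t : ℝ) (hs : 0 ≤ s) (ht : 0 ≤ t) : 𝒮.l2 (s + t) = 𝒮.l2 s * 𝒮.l2 t := by
  ext v
  induction v using UniformSpace.Completion.induction_on with
  | hp => exact isClosed_eq (by fun_prop) (by fun_prop)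
  | ih x =>
    rw [mul_apply_eq_comp, l2_coe _ ht, l2_coe _ hs, l2_coe _ (add_nonneg hs ht)]
    congr 1
    exact val_injective (by rw [val_mk, val_mk, val_mk, 𝒮.add s t hs ht])

/-- Symmetry is assumed only on $\mathcal M\cap L_1$; `L2_induction` in each variable reduces to
positive integrable elements, which lie there. -/
theorem inner_l2_left {t : ℝ} (ht : 0 ≤ t) (x y : τ.L2) : ⟪𝒮.l2 t x, y⟫_ℂ = ⟪x, 𝒮.l2 t y⟫_ℂ := by
  induction x using L2_induction with
  | hclosed => exact isClosed_eq (by fun_prop) (by fun_prop)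
  | hadd x x' hx hx' => rw [_root_.map_add, inner_add_left, inner_add_left, hx, hx']
  | hsmul c x hx => rw [_root_.map_smul, inner_smul_left, inner_smul_left, hx]
  | h x hx tx =>
    induction y using L2_induction with
    | hclosed => exact isClosed_eq (by fun_prop) (by fun_prop)
    | hadd y y' hy hy' => rw [_root_.map_add, inner_add_right, inner_add_right, hy, hy']
    | hsmul c y hy => rw [_root_.map_smul, inner_smul_right, inner_smul_right, hy]
    | h y hy ty =>
      rw [l2_coe _ ht, l2_coe _ ht, UniformSpace.Completion.inner_coe,
        UniformSpace.Completion.inner_coe, ← ext_star_mul, ← ext_star_mul, val_mk, val_mk,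
        (𝒮.map_nonneg' t hx).isSelfAdjoint.star_eq, hx.isSelfAdjoint.star_eq]
      exact 𝒮.symmetric t ht _ _ (by rwa [τ.powInt_one_of_nonneg hx])
        (by rwa [τ.powInt_one_of_nonneg hy])

theorem isSelfAdjoint_l2 {t : ℝ} (ht : 0 ≤ t) : IsSelfAdjoint (𝒮.l2 t) := by
  rw [ContinuousLinearMap.isSelfAdjoint_iff_isSymmetric]
  exact fun x y => 𝒮.inner_l2_left ht x y

theorem _root_.isClosed_setOf_tendsto_inner {ι H : Type*} [NormedAddCommGroup H]
    [InnerProductSpace ℂ H] {l : Filter ι} {u : ι → H} {C : ℝ} (hu : ∀ᶠ i in l, ‖u i‖ ≤ C) :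
    IsClosed {x : H | Tendsto (fun i => ⟪x, u i⟫_ℂ) l (𝓝 0)} := by
  refine isClosed_of_closure_subset fun x hx => ?_
  rw [Set.mem_ofPred_eq, Metric.tendsto_nhds]
  intro ε hε
  have hC : 0 < 2 * (|C| + 1) := by positivity
  obtain ⟨y, hy, hxy⟩ := Metric.mem_closure_iff.1 hx (ε / (2 * (|C| + 1))) (by positivity)
  have h1 := (Metric.tendsto_nhds.1 hy) (ε / 2) (by positivity)
  filter_upwards [hu, h1] with i hi h2
  rw [dist_zero_right] at h2 ⊢
  have h3 : ⟪x, u i⟫_ℂ = ⟪x - y, u i⟫_ℂ + ⟪y, u i⟫_ℂ := by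
    rw [← inner_add_left, sub_add_cancel]
  have h4 : ‖⟪x - y, u i⟫_ℂ‖ ≤ ε / 2 := by
    refine (norm_inner_le_norm _ _).trans ?_
    rw [dist_eq_norm] at hxy
    calc ‖x - y‖ * ‖u i‖ ≤ (ε / (2 * (|C| + 1))) * (|C| + 1) := by
          gcongr
          exact hi.trans ((le_abs_self C).trans (by linarith))
      _ = ε / 2 := by field_simp
  rw [h3]
  refine (norm_add_le _ _).trans_lt ?_
  linarith

/-- Orbits are only weak-$*$ continuous in $\mathcal M$, which settles $x$ positive integrable and
$y\in\mathcal M\cap L_2$. The uniform bound on $e^{-tL}$ extends this to all $x$, then to all $y$.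
-/
theorem tendsto_inner_l2 (x y : τ.L2) :
    Tendsto (fun t => ⟪x, 𝒮.l2 t y⟫_ℂ) (𝓝[>] 0) (𝓝 ⟪x, y⟫_ℂ) := by
  obtain ⟨K, hK, hb⟩ := 𝒮.exists_bound
  have bound : ∀ y : τ.L2, ∀ᶠ t in 𝓝[>] (0 : ℝ), ‖𝒮.l2 t y - y‖ ≤ K * ‖y‖ + ‖y‖ := by
    intro y
    filter_upwards [self_mem_nhdsWithin] with t ht
    refine (norm_sub_le _ _).trans ?_
    gcongr
    exact ContinuousLinearMap.le_of_opNorm_le _ (𝒮.norm_l2_le hK hb (le_of_lt ht)) y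
  have iff : ∀ x y : τ.L2, Tendsto (fun t => ⟪x, 𝒮.l2 t y⟫_ℂ) (𝓝[>] 0) (𝓝 ⟪x, y⟫_ℂ)
      ↔ Tendsto (fun t => ⟪x, 𝒮.l2 t y - y⟫_ℂ) (𝓝[>] 0) (𝓝 0) := by
    intro x y
    simp only [inner_sub_right]
    exact tendsto_sub_nhds_zero_iff.symm
  have key : ∀ (x : τ.L2) (y : τ.PreL2),
      Tendsto (fun t => ⟪x, 𝒮.l2 t y - y⟫_ℂ) (𝓝[>] 0) (𝓝 0) := by
    intro x y
    induction x using L2_induction with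
    | hclosed => exact isClosed_setOf_tendsto_inner (bound y)
    | hadd x x' hx hx' =>
      simp only [inner_add_left]
      simpa using hx.add hx'
    | hsmul c x hx =>
      simp only [inner_smul_left]
      simpa using hx.const_mul ((starRingEnd ℂ) c)
    -- Here $\langle x,\cdot\rangle$ is the normal functional $\tau(\sqrt x\,\cdot\sqrt x)$.
    | h x hx tx =>
      rw [← iff]
      have e : ∀ a (ha : τ.toFun (star a * a) < ⊤),
          ⟪(x : τ.L2), ((PreL2.mk a ha : τ.PreL2) : τ.L2)⟫_ℂ
            = (τ.vec (sqrt hx tx : τ.PreL2)).toDual a := by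
        intro a ha
        rw [UniformSpace.Completion.inner_coe, ← ext_star_mul, val_mk,
          hx.isSelfAdjoint.star_eq, ext_mul_left hx tx]
        rfl
      have hw := 𝒮.continuous (val y)
      have hφ : Continuous[weakStar M, _] fun a =>
          (τ.vec (sqrt hx tx : τ.PreL2)).toDual a :=
        continuous_iInf_dom (i := τ.vec (sqrt hx tx : τ.PreL2)) continuous_induced_dom
      have hc : ContinuousOn (fun t => (τ.vec (sqrt hx tx : τ.PreL2)).toDual (𝒮.S t (val y)))
          (Set.Ici 0) := by
        let _ := weakStar M
        exact Continuous.comp_continuousOn hφ hw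
      have h1 := (hc 0 Set.self_mem_Ici).mono_left
        (nhdsWithin_mono (0 : ℝ) Set.Ioi_subset_Ici_self)
      simp only at h1
      rw [𝒮.zero, ← e _ (lt_top y)] at h1
      refine h1.congr' ?_
      filter_upwards [self_mem_nhdsWithin] with t ht
      rw [l2_coe _ (le_of_lt ht), e]
  rw [iff]
  -- Self-adjointness exchanges the two vectors, so closedness in the first variable gives it in the
  -- second.
  have flip : ∀ x y : τ.L2, Tendsto (fun t => ⟪x, 𝒮.l2 t y - y⟫_ℂ) (𝓝[>] 0) (𝓝 0) →
      Tendsto (fun t => ⟪y, 𝒮.l2 t x - x⟫_ℂ) (𝓝[>] 0) (𝓝 0) := by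
    intro x y h
    have h1 := (Complex.continuous_conj.tendsto 0).comp h
    rw [map_zero] at h1
    refine h1.congr' ?_
    filter_upwards [self_mem_nhdsWithin] with t ht
    rw [Function.comp_apply, inner_conj_symm, inner_sub_left, inner_sub_right,
      𝒮.inner_l2_left (le_of_lt ht)]
  have hclosed : IsClosed {y : τ.L2 | Tendsto (fun t => ⟪x, 𝒮.l2 t y - y⟫_ℂ) (𝓝[>] 0) (𝓝 0)} := by
    have := isClosed_setOf_tendsto_inner (bound x)
    convert this using 3 with y
    exact ⟨flip x y, flip y x⟩
  induction y using UniformSpace.Completion.induction_on with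
  | hp => exact hclosed
  | ih y => exact key x y

theorem exists_isSpectralMeasureAt (x : τ.L2) : ∃ μ, 𝒮.IsSpectralMeasureAt x μ := by
  obtain ⟨K, hK, hb⟩ := 𝒮.exists_bound
  exact exists_laplace_measure 𝒮.l2_zero 𝒮.l2_add (fun t ht => 𝒮.isSelfAdjoint_l2 ht)
    (fun t ht => 𝒮.norm_l2_le hK hb ht) x (𝒮.tendsto_inner_l2 x x)

/-- The multiplier of `e^{-t λ}` is `e^{-t L}`. -/
theorem mult_exp {t : ℝ} (ht : 0 ≤ t) :
    𝒮.mult (fun l => Complex.exp (-(t * l : ℂ))) = 𝒮.l2 t := by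
  have h : 𝒮.IsMultiplier (fun l => Complex.exp (-(t * l : ℂ))) (𝒮.l2 t) := by
    intro x
    obtain ⟨μ, hμ⟩ := 𝒮.exists_isSpectralMeasureAt x
    exact ⟨μ, hμ, hμ.2.2 t ht⟩
  have hex : ∃ B, 𝒮.IsMultiplier (fun l => Complex.exp (-(t * l : ℂ))) B := ⟨_, h⟩
  rw [mult, dif_pos hex]
  have hB := hex.choose_spec
  -- Uniqueness of spectral measures is not needed: every admissible $\mu$ gives $\int
  -- e^{-t\lambda}d\mu=\langle x,e^{-tL}x\rangle$, and the quadratic form determines the operator.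
  refine (ContinuousLinearMap.coe_inj.1 ((ext_inner_map _ _).1 fun x => ?_))
  obtain ⟨μ, hμ, h1⟩ := hB x
  rw [← hμ.2.2 t ht] at h1
  have h2 := congrArg (starRingEnd ℂ) h1
  rwa [inner_conj_symm, inner_conj_symm] at h2

/-- Multipliers only depend on the values on `[0, ∞)`. -/
theorem mult_congr {F G : ℝ → ℂ} (h : ∀ l, 0 ≤ l → F l = G l) : 𝒮.mult F = 𝒮.mult G := by
  have e : 𝒮.IsMultiplier F = 𝒮.IsMultiplier G := by
    ext B
    refine forall_congr' fun x => exists_congr fun μ => and_congr_right fun hμ => ?_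
    have : ∫ l, F l ∂μ = ∫ l, G l ∂μ := by
      refine MeasureTheory.integral_congr_ae ?_
      have : ∀ᵐ l ∂μ, 0 ≤ l := by
        rw [MeasureTheory.ae_iff]
        simpa [Set.Iio_def] using hμ.2.1
      filter_upwards [this] with l hl using h l hl
    rw [this]
  unfold mult
  rw [e]

end BoundedSemigroup

/-! ### The exponential as a multiplier and as a Schwartz function -/

section ExpMultiplier

theorem contDiff_cexp_neg_mul (t : ℝ) {n : WithTop ℕ∞} :
    ContDiff ℝ n (fun l : ℝ => Complex.exp (-(t * l : ℂ))) :=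
  ((contDiff_const.mul Complex.ofRealCLM.contDiff).neg).cexp

theorem iteratedDeriv_cexp_neg_mul (t : ℝ) (k : ℕ) :
    iteratedDeriv k (fun l : ℝ => Complex.exp (-(t * l : ℂ)))
      = fun l : ℝ => (-(t : ℂ)) ^ k * Complex.exp (-(t * l : ℂ)) := by
  induction k with
  | zero => simp
  | succ k ih =>
    rw [iteratedDeriv_succ, ih]
    ext l
    have h1 : HasDerivAt (fun l : ℝ => -(t * l : ℂ)) (-(t * 1 : ℂ)) l :=
      (Complex.ofRealCLM.hasDerivAt.const_mul (t : ℂ)).neg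
    have h2 := (h1.cexp.const_mul ((-(t : ℂ)) ^ k)).deriv
    rw [h2]
    ring

theorem norm_iteratedDeriv_cexp_neg_mul {t : ℝ} (ht : 0 ≤ t) (k : ℕ) (l : ℝ) :
    ‖iteratedDeriv k (fun l : ℝ => Complex.exp (-(t * l : ℂ))) l‖ = t ^ k * Real.exp (-(t * l)) := by
  rw [iteratedDeriv_cexp_neg_mul]
  simp only [norm_mul, norm_pow, norm_neg, Complex.norm_real, Real.norm_of_nonneg ht]
  rw [← Complex.ofReal_mul, ← Complex.ofReal_neg, Complex.norm_exp_ofReal]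

theorem isCbInfty_cexp_neg_mul {t : ℝ} (ht : 0 ≤ t) :
    IsCbInfty (fun l => Complex.exp (-(t * l : ℂ))) := by
  refine ⟨(contDiff_cexp_neg_mul t).contDiffOn, fun k => ⟨t ^ k, fun x hx => ?_⟩⟩
  rw [iteratedDerivWithin_eq_iteratedDeriv (uniqueDiffOn_Ici 0)
    (contDiff_cexp_neg_mul t).contDiffAt hx, norm_iteratedDeriv_cexp_neg_mul ht]
  refine mul_le_of_le_one_right (by positivity) ?_
  rw [Real.exp_le_one_iff]
  have := mul_nonneg ht hx
  linarith

/-- There is a Schwartz function that equals `e^{-tl}` for `l ≥ 0`. -/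
theorem exists_schwartz_eq_exp {t : ℝ} (ht : 0 < t) :
    ∃ F : 𝓢(ℝ, ℂ), ∀ l : ℝ, 0 ≤ l → F l = Complex.exp (-(t * l : ℂ)) := by
  -- A smooth cutoff, $0$ for $x\le-1$ and $1$ for $x\ge0$; it removes the growth of $e^{-tx}$ at
  -- $-\infty$.
  set χ : ℝ → ℝ := fun x => Real.smoothTransition (x + 1) with hχ
  set e : ℝ → ℂ := fun l => Complex.exp (-(t * l : ℂ)) with he
  set G : ℝ → ℂ := fun x => (χ x : ℂ) * e x with hG
  have hχc : ContDiff ℝ ∞ χ := Real.smoothTransition.contDiff.comp (contDiff_id.add contDiff_const)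
  have hGc : ContDiff ℝ ∞ G :=
    (Complex.ofRealCLM.contDiff.comp hχc).mul (contDiff_cexp_neg_mul t)
  have hone : ∀ x : ℝ, 0 ≤ x → G x = e x := fun x hx => by
    simp only [hG, hχ]
    rw [Real.smoothTransition.one_of_one_le (by linarith)]
    simp
  have hsupp : tsupport G ⊆ Set.Ici (-1) := by
    refine closure_minimal ?_ isClosed_Ici
    intro x hx
    by_contra h
    rw [Set.mem_Ici, not_le] at h
    refine hx ?_
    simp only [hG, hχ]
    rw [Real.smoothTransition.zero_of_nonpos (by linarith)]
    simp
  refine ⟨⟨G, hGc, fun k n => ?_⟩, hone⟩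
  obtain ⟨C, hC⟩ := (isCompact_Icc (a := (-1 : ℝ)) (b := 1)).exists_bound_of_continuousOn
    (f := fun x => ‖x‖ ^ k * ‖iteratedFDeriv ℝ n G x‖)
    (by
      have := hGc.continuous_iteratedFDeriv (m := n) (by exact_mod_cast le_top)
      fun_prop)
  -- $C$ covers $[-1,1]$ by compactness; the other constant covers $x>1$, through $(tx)^k/k!\le
  -- e^{tx}$.
  refine ⟨max C (k.factorial / t ^ k * t ^ n), fun x => ?_⟩
  rcases lt_or_ge x (-1) with h1 | h1
  · have h2 : iteratedFDeriv ℝ n G x = 0 := by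
      by_contra h
      have := hsupp (support_iteratedFDeriv_subset (𝕜 := ℝ) n h)
      exact absurd h1 (not_lt.2 this)
    rw [h2, norm_zero, mul_zero]
    exact le_max_of_le_right (by positivity)
  rcases le_or_gt x 1 with h2 | h2
  · exact le_max_of_le_left ((le_abs_self _).trans (hC x ⟨h1, h2⟩))
  · refine le_max_of_le_right ?_
    have h3 : G =ᶠ[𝓝 x] e := by
      filter_upwards [Ioi_mem_nhds (show (0 : ℝ) < x by linarith)] with y hy
      exact hone y (le_of_lt hy)
    rw [(h3.iteratedFDeriv ℝ n).eq_of_nhds, norm_iteratedFDeriv_eq_norm_iteratedDeriv, he,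
      norm_iteratedDeriv_cexp_neg_mul ht.le, Real.norm_of_nonneg (by linarith)]
    have hx : 0 < t * x := by positivity
    have h4 := Real.pow_div_factorial_le_exp (t * x) hx.le k
    have h5 : x ^ k ≤ k.factorial / t ^ k * Real.exp (t * x) := by
      rw [div_le_iff₀ (by positivity), mul_pow] at h4
      rw [div_mul_eq_mul_div, le_div_iff₀ (by positivity)]
      linarith
    calc x ^ k * (t ^ n * Real.exp (-(t * x)))
        ≤ k.factorial / t ^ k * Real.exp (t * x) * (t ^ n * Real.exp (-(t * x))) := by gcongr
      _ = k.factorial / t ^ k * t ^ n * (Real.exp (t * x) * Real.exp (-(t * x))) := by ring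
      _ = _ := by rw [← Real.exp_add]; simp

end ExpMultiplier

/-! ### The semigroup on the test algebra and its amplification -/

namespace BoundedSemigroup

open SemifiniteTrace

variable {M : Type*} [CStarAlgebra M] [PartialOrder M] [StarOrderedRing M]
  {τ : SemifiniteTrace M} {𝒮 : BoundedSemigroup τ} {A : NonUnitalSubalgebra ℂ M}

theorem IsTestAlgebra.sq_lt_top (hA : 𝒮.IsTestAlgebra A) {f : M} (hf : f ∈ A) :
    τ.toFun (star f * f) < ⊤ := by
  have h := (hA.lp_dense 2 one_lt_two).1 f hf
  rw [powInt] at h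
  have e : CFC.abs f ^ (2 : ℝ) = star f * f := by
    rw [← CFC.abs_sq f, ← CFC.rpow_natCast _ 2 (CFC.abs_nonneg f)]
    norm_num
  rwa [e] at h

/-- The element of $A$ representing $e^{-tL}f$ and $S_tf$ represent the same vector, and $\mathcal
M\cap L_2\to L_2$ is injective. -/
theorem IsTestAlgebra.semigroup_mem (hA : 𝒮.IsTestAlgebra A) {t : ℝ} (ht : 0 ≤ t) {f : M}
    (hf : f ∈ A) : 𝒮.S t f ∈ A := by
  have hr : τ.Represents f (PreL2.mk f (hA.sq_lt_top hf) : τ.PreL2) := ⟨hA.sq_lt_top hf, rfl⟩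
  obtain ⟨g, hg, hg2, hgr⟩ := hA.mult_mem _ (isCbInfty_cexp_neg_mul ht) f hf _ hr
  rw [𝒮.mult_exp ht] at hgr
  obtain ⟨h1, h2⟩ := 𝒮.isL2Extension_l2 ht f _ hr
  rw [h2] at hgr
  have h3 := congrArg PreL2.val (UniformSpace.Completion.coe_injective _ hgr)
  rw [PreL2.val_mk, PreL2.val_mk] at h3
  rwa [h3]

variable {N : Type*} [CStarAlgebra N] [PartialOrder N] [StarOrderedRing N] {P : MetricModel M N}
  {π : (τ.L2 →L[ℂ] τ.L2) → Module.End ℂ (P.V τ A)}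

theorem _root_.MetricModel.IsAmplification.semigroup (hπ : P.IsAmplification 𝒮 A π)
    (hA : 𝒮.IsTestAlgebra A) {t : ℝ} (ht : 0 ≤ t) {f : M} (hf : f ∈ A) (v : P.V τ A)
    (hv : (v : N) = P.ρ₂ f) :
    (π (𝒮.mult fun l => Complex.exp (-(t * l : ℂ))) v : N) = P.ρ₂ (𝒮.S t f) := by
  have hr : τ.Represents f (PreL2.mk f (hA.sq_lt_top hf) : τ.PreL2) := ⟨hA.sq_lt_top hf, rfl⟩
  refine hπ.intertwine _ (isCbInfty_cexp_neg_mul ht) f hf _ (hA.semigroup_mem ht hf)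
    ⟨_, hr, ?_⟩ v hv
  rw [𝒮.mult_exp ht]
  exact 𝒮.isL2Extension_l2 ht f _ hr

end BoundedSemigroup

/-! ### The representation of $\mathcal M$ on $L_2$ and the norm of the extended positive part -/

namespace SemifiniteTrace

variable {M : Type*} [CStarAlgebra M] [PartialOrder M] [StarOrderedRing M]
  (τ : SemifiniteTrace M)

theorem inner_lmul_left (a : M) (x y : τ.L2) : ⟪τ.lmul a x, y⟫_ℂ = ⟪x, τ.lmul (star a) y⟫_ℂ := by
  induction x, y using UniformSpace.Completion.induction_on₂ with
  | hp => exact isClosed_eq (by fun_prop) (by fun_prop)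
  | ih x y =>
    rw [lmul_coe, lmul_coe, UniformSpace.Completion.inner_coe, UniformSpace.Completion.inner_coe,
      PreL2.inner_lmul]

/-- The representation of `M` on `L_2(M)` by left multiplication. -/
def lmulHom : M →⋆ₙₐ[ℂ] (τ.L2 →L[ℂ] τ.L2) where
  toFun := τ.lmul
  map_smul' c a := _root_.map_smul _ c a
  map_zero' := _root_.map_zero _
  map_add' a b := _root_.map_add _ a b
  map_mul' a b := by
    ext v
    induction v using UniformSpace.Completion.induction_on with
    | hp => exact isClosed_eq (by fun_prop) (by fun_prop)
    | ih x =>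
      rw [mul_apply_eq_comp, lmul_coe, lmul_coe, lmul_coe]
      congr 1
      exact PreL2.val_injective (by simp only [PreL2.val_lmul, mul_assoc])
  map_star' a := by
    rw [ContinuousLinearMap.star_eq_adjoint, ContinuousLinearMap.eq_adjoint_iff]
    intro x y
    rw [inner_lmul_left, star_star]

/-- If $a$ annihilates $\mathcal M\cap L_2$ and $0\le y\le a^*a$ has finite trace, then $y^2=\sqrt
y\,y\sqrt y\le\sqrt y\,a^*a\sqrt y=0$. So $\tau(a^*a)=0$ by semifiniteness, and $a=0$ by
faithfulness. -/
theorem lmulHom_injective : Function.Injective τ.lmulHom := by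
  rw [injective_iff_map_eq_zero]
  intro a ha
  have h0 : ∀ x : τ.PreL2, a * PreL2.val x = 0 := by
    intro x
    have h1 : τ.lmul a x = 0 := by
      change τ.lmulHom a x = 0
      rw [ha]
      rfl
    rw [lmul_coe, ← UniformSpace.Completion.coe_zero] at h1
    have h2 := congrArg PreL2.val (UniformSpace.Completion.coe_injective _ h1)
    rwa [PreL2.val_lmul, _root_.map_zero] at h2
  have hz : 0 ≤ star a * a := star_mul_self_nonneg a
  have h1 : τ.toFun (star a * a) = 0 := by
    rw [← nonpos_iff_eq_zero]
    refine (τ.semifinite _ hz).2 ?_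
    rintro _ ⟨y, hy, hya, hyt, rfl⟩
    have h2 := h0 (PreL2.sqrt hy hyt)
    rw [PreL2.val_sqrt] at h2
    have h3 : star (CFC.sqrt y) * y * CFC.sqrt y ≤ 0 := by
      refine (star_left_conjugate_le_conjugate hya _).trans_eq ?_
      rw [mul_assoc, mul_assoc, h2, mul_zero, mul_zero]
    have h4 : star y * y = 0 := by
      refine le_antisymm (le_trans (le_of_eq ?_) h3) (star_mul_self_nonneg y)
      have e1 := CFC.sqrt_mul_sqrt_self y hy
      rw [star_sqrt, hy.isSelfAdjoint.star_eq]
      calc y * y = (CFC.sqrt y * CFC.sqrt y) * (CFC.sqrt y * CFC.sqrt y) := by rw [e1]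
        _ = CFC.sqrt y * (CFC.sqrt y * CFC.sqrt y) * CFC.sqrt y := by simp only [mul_assoc]
        _ = _ := by rw [e1]
    rw [CStarRing.star_mul_self_eq_zero_iff] at h4
    rw [h4, trace_zero]
  exact CStarRing.star_mul_self_eq_zero_iff a |>.1 (τ.faithful _ hz h1)

theorem norm_lmul (a : M) : ‖τ.lmul a‖ = ‖a‖ :=
  NonUnitalStarAlgHom.norm_map τ.lmulHom τ.lmulHom_injective a

theorem vecDual_star_mul_self (c : M) (b : τ.L2) :
    (τ.vecDual b (star c * c)).re = ‖τ.lmul c b‖ ^ 2 := by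
  have h : τ.lmul (star c * c) = τ.lmul (star c) * τ.lmul c := map_mul τ.lmulHom (star c) c
  rw [vecDual_apply, h, mul_apply_eq_comp, ← inner_lmul_left, inner_self_eq_norm_sq_to_K]
  norm_cast

/-- The norm of the extended positive part restricts to the norm of `M`. -/
theorem nrm_ofPos {a : M} (ha : 0 ≤ a) : (ExtPos.ofPos a ha).nrm τ = ‖a‖ₑ := by
  obtain ⟨c, rfl⟩ := CStarAlgebra.nonneg_iff_eq_star_mul_self.1 ha
  have key : ∀ b : τ.L2, (ExtPos.ofPos _ ha).toFun (τ.vec b) = ‖τ.lmul c b‖ₑ ^ 2 := by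
    intro b
    change ENNReal.ofReal (τ.vecDual b (star c * c)).re = _
    rw [vecDual_star_mul_self, ENNReal.ofReal_pow (norm_nonneg _), ofReal_norm]
  have e : ‖star c * c‖ₑ = ‖c‖ₑ ^ 2 := by
    rw [← ofReal_norm, CStarRing.norm_star_mul_self, ← sq, ENNReal.ofReal_pow (norm_nonneg _),
      ofReal_norm]
  rw [e]
  apply le_antisymm
  · refine iSup₂_le fun b hb => ?_
    rw [key]
    gcongr
    rw [← ofReal_norm, ← ofReal_norm]
    refine ENNReal.ofReal_le_ofReal (((τ.lmul c).le_opNorm b).trans ?_)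
    rw [norm_lmul]
    exact mul_le_of_le_one_right (norm_nonneg _) hb
  · by_cases htop : (ExtPos.ofPos _ ha).nrm τ = ⊤
    · rw [htop]; exact le_top
    set s := ((ExtPos.ofPos _ ha).nrm τ).toReal with hs
    have h1 : ∀ b : τ.L2, ‖b‖ ≤ 1 → ‖τ.lmul c b‖ ≤ √s := by
      intro b hb
      have h2 : ‖τ.lmul c b‖ₑ ^ 2 ≤ (ExtPos.ofPos _ ha).nrm τ := by
        rw [← key]
        exact le_iSup₂ (f := fun (b : τ.L2) (_ : ‖b‖ ≤ 1) =>
          (ExtPos.ofPos _ ha).toFun (τ.vec b)) b hb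
      have h3 := ENNReal.toReal_mono htop h2
      rw [ENNReal.toReal_pow, toReal_enorm] at h3
      exact Real.le_sqrt_of_sq_le h3
    have h2 : ‖c‖ ≤ √s := by
      rw [← τ.norm_lmul]
      refine ContinuousLinearMap.opNorm_le_of_unit_norm (𝕜 := ℂ) (Real.sqrt_nonneg _)
        fun b hb => h1 b hb.le
    rw [← ofReal_norm, ← ENNReal.ofReal_pow (norm_nonneg _), ← ENNReal.ofReal_toReal htop, ← hs]
    refine ENNReal.ofReal_le_ofReal ?_
    rw [← Real.sq_sqrt (show 0 ≤ s from ENNReal.toReal_nonneg)]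
    gcongr

end SemifiniteTrace

/-! ### The column norm of an operator-valued weight -/

namespace OperatorValuedWeight

variable {M N : Type*} [CStarAlgebra M] [PartialOrder M] [StarOrderedRing M]
  [CStarAlgebra N] [PartialOrder N] [StarOrderedRing N] {ρ : M →⋆ₐ[ℂ] N}
  (E : OperatorValuedWeight ρ) (τ : SemifiniteTrace M)

theorem mono {x y : N} (hx : 0 ≤ x) (h : x ≤ y) (φ : NormalPos M) :
    (E.w x).toFun φ ≤ (E.w y).toFun φ := by
  have := E.map_add x (y - x) hx (sub_nonneg.2 h) φ
  rw [add_sub_cancel] at this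
  rw [this]
  exact le_self_add

theorem map_real_smul {c : ℝ} (hc : 0 ≤ c) {x : N} (hx : 0 ≤ x) (φ : NormalPos M) :
    (E.w (c • x)).toFun φ = ENNReal.ofReal c * (E.w x).toFun φ := by
  have := E.map_smul c.toNNReal x hx φ
  rwa [NNReal.smul_def, Real.coe_toNNReal c hc] at this

/-- The seminorm `f ↦ φ(E(|f|^2))^{1/2}`. -/
def vnorm (φ : NormalPos M) (f : N) : ℝ≥0∞ := (E.w (absSq f)).toFun φ ^ (1 / 2 : ℝ)

theorem absSq_nonneg (f : N) : 0 ≤ absSq f := star_mul_self_nonneg f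

/-- The weighted parallelogram identity with $c^2=\beta/\alpha$ bounds the square by
$(1+\beta/\alpha)\alpha^2+(1+\alpha/\beta)\beta^2=(\alpha+\beta)^2$. No inner product is needed, and
infinite values are harmless. -/
theorem vnorm_add_le (φ : NormalPos M) (f g : N) :
    E.vnorm φ (f + g) ≤ E.vnorm φ f + E.vnorm φ g := by
  refine ENNReal.le_of_forall_pos_le_add fun ε hε hlt => ?_
  obtain ⟨hf, hg⟩ := ENNReal.add_lt_top.1 hlt
  -- The shift by $\varepsilon/2$ keeps the ratio $\beta/\alpha$ meaningful when a seminorm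
  -- vanishes.
  set α : ℝ := (E.vnorm φ f).toReal + ε / 2 with hα
  set β : ℝ := (E.vnorm φ g).toReal + ε / 2 with hβ
  have hε' : (0 : ℝ) < ε := hε
  have hα0 : 0 < α := by positivity
  have hβ0 : 0 < β := by positivity
  have hsq : ∀ x : N, E.vnorm φ x < ⊤ →
      (E.w (absSq x)).toFun φ ≤ ENNReal.ofReal (((E.vnorm φ x).toReal + ε / 2) ^ 2) := by
    intro x hx
    have h1 : (E.w (absSq x)).toFun φ = E.vnorm φ x ^ 2 := by
      rw [vnorm, ← ENNReal.rpow_natCast, ← ENNReal.rpow_mul]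
      norm_num
    rw [h1, ENNReal.ofReal_pow (by positivity)]
    gcongr
    refine (ENNReal.ofReal_toReal hx.ne).symm.trans_le (ENNReal.ofReal_le_ofReal ?_)
    linarith
  have hc : 0 < √(β / α) := by positivity
  have h := SemifiniteTrace.parallelogram f g hc
  have h2 := E.map_add (absSq (f + g)) _ (absSq_nonneg _)
    (absSq_nonneg ((√(β / α)) • f - (√(β / α))⁻¹ • g)) φ
  rw [absSq, absSq, h, E.map_add _ _ (smul_nonneg (by positivity) (star_mul_self_nonneg f))
      (smul_nonneg (by positivity) (star_mul_self_nonneg g)),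
    E.map_real_smul (by positivity) (star_mul_self_nonneg f),
    E.map_real_smul (by positivity) (star_mul_self_nonneg g), inv_pow,
    Real.sq_sqrt (by positivity)] at h2
  have h3 : (E.w (absSq (f + g))).toFun φ ≤ ENNReal.ofReal ((α + β) ^ 2) := by
    refine (le_self_add.trans h2.ge).trans ?_
    have e : (α + β) ^ 2 = (1 + β / α) * α ^ 2 + (1 + (β / α)⁻¹) * β ^ 2 := by
      field_simp
      ring
    rw [e, ENNReal.ofReal_add (p := (1 + β / α) * α ^ 2) (by positivity) (by positivity),
      ENNReal.ofReal_mul (by positivity), ENNReal.ofReal_mul (by positivity)]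
    gcongr
    · exact hsq f hf
    · exact hsq g hg
  calc E.vnorm φ (f + g) ≤ ENNReal.ofReal ((α + β) ^ 2) ^ (1 / 2 : ℝ) := by
        unfold vnorm; gcongr
    _ = ENNReal.ofReal (α + β) := by
        rw [ENNReal.ofReal_rpow_of_nonneg (by positivity) (by norm_num), ← Real.sqrt_eq_rpow,
          Real.sqrt_sq (by positivity)]
    _ = _ := by
        have e : α + β = (E.vnorm φ f).toReal + (E.vnorm φ g).toReal + ε := by rw [hα, hβ]; ring
        rw [e, ENNReal.ofReal_add (by positivity) (by positivity),
          ENNReal.ofReal_add (by positivity) (by positivity), ENNReal.ofReal_toReal hf.ne,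
          ENNReal.ofReal_toReal hg.ne, ENNReal.ofReal_coe_nnreal]

theorem vnorm_smul (φ : NormalPos M) (c : ℂ) (f : N) :
    E.vnorm φ (c • f) = ‖c‖ₑ * E.vnorm φ f := by
  rw [vnorm, absSq, SemifiniteTrace.sq_smul, E.map_real_smul (by positivity)
    (star_mul_self_nonneg f), ENNReal.mul_rpow_of_nonneg _ _ (by norm_num),
    ENNReal.ofReal_rpow_of_nonneg (by positivity) (by norm_num), ← Real.sqrt_eq_rpow,
    Real.sqrt_sq (norm_nonneg _), ofReal_norm]
  rfl

theorem vnorm_neg (φ : NormalPos M) (f : N) : E.vnorm φ (-f) = E.vnorm φ f := by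
  simp [vnorm, absSq]

/-- Exhibits the column norm as a supremum of the scalar seminorms `vnorm`, from which its
properties are inherited. -/
theorem cnorm_le_iff {f : N} {C : ℝ≥0∞} :
    E.cnorm τ f ≤ C ↔ ∀ b : τ.L2, ‖b‖ ≤ 1 → E.vnorm (τ.vec b) f ≤ C := by
  have e : ∀ x : ℝ≥0∞, x ^ (1 / 2 : ℝ) ≤ C ↔ x ≤ C ^ (2 : ℝ) := fun x => by
    rw [one_div]
    exact ENNReal.rpow_inv_le_iff two_pos
  unfold cnorm vnorm
  simp only [e, ExtPos.nrm, iSup_le_iff]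

theorem vnorm_le_cnorm {b : τ.L2} (hb : ‖b‖ ≤ 1) (f : N) :
    E.vnorm (τ.vec b) f ≤ E.cnorm τ f := (E.cnorm_le_iff τ).1 le_rfl b hb

theorem cnorm_add_le (f g : N) : E.cnorm τ (f + g) ≤ E.cnorm τ f + E.cnorm τ g := by
  rw [cnorm_le_iff]
  intro b hb
  refine (E.vnorm_add_le _ f g).trans ?_
  gcongr <;> exact E.vnorm_le_cnorm τ hb _

theorem cnorm_smul_le (c : ℂ) (f : N) : E.cnorm τ (c • f) ≤ ‖c‖ₑ * E.cnorm τ f := by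
  rw [cnorm_le_iff]
  intro b hb
  rw [vnorm_smul]
  gcongr
  exact E.vnorm_le_cnorm τ hb _

theorem cnorm_sub_le (f g : N) : E.cnorm τ (f - g) ≤ E.cnorm τ f + E.cnorm τ g := by
  rw [cnorm_le_iff]
  intro b hb
  rw [sub_eq_add_neg]
  refine (E.vnorm_add_le _ f _).trans ?_
  rw [vnorm_neg]
  gcongr <;> exact E.vnorm_le_cnorm τ hb _

theorem cnorm_zero : E.cnorm τ 0 = 0 := by
  have := E.cnorm_smul_le τ 0 0
  simpa using this

theorem cnorm_sum_le {ι : Type*} (s : Finset ι) (f : ι → N) :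
    E.cnorm τ (∑ i ∈ s, f i) ≤ ∑ i ∈ s, E.cnorm τ (f i) := by
  classical
  induction s using Finset.induction_on with
  | empty => simp [cnorm_zero]
  | insert i s hi ih =>
    rw [Finset.sum_insert hi, Finset.sum_insert hi]
    exact (E.cnorm_add_le τ _ _).trans (by gcongr)

theorem cnorm_mul_le (x y : N) : E.cnorm τ (x * y) ≤ ‖x‖ₑ * E.cnorm τ y := by
  rw [cnorm_le_iff]
  intro b hb
  have h1 : absSq (x * y) ≤ (‖x‖ ^ 2 : ℝ) • absSq y := by
    have h := CStarAlgebra.star_left_conjugate_le_norm_smul (a := y) (b := star x * x)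
      (IsSelfAdjoint.star_mul_self x)
    rw [CStarRing.norm_star_mul_self, ← sq] at h
    simpa only [absSq, star_mul, mul_assoc] using h
  have h2 := E.mono (absSq_nonneg _) h1 (τ.vec b)
  rw [E.map_real_smul (by positivity) (absSq_nonneg y)] at h2
  calc E.vnorm (τ.vec b) (x * y)
      ≤ (ENNReal.ofReal (‖x‖ ^ 2) * (E.w (absSq y)).toFun (τ.vec b)) ^ (1 / 2 : ℝ) := by
        unfold vnorm; gcongr
    _ = ‖x‖ₑ * E.vnorm (τ.vec b) y := by
        rw [ENNReal.mul_rpow_of_nonneg _ _ (by norm_num),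
          ENNReal.ofReal_rpow_of_nonneg (by positivity) (by norm_num), ← Real.sqrt_eq_rpow,
          Real.sqrt_sq (norm_nonneg _), ofReal_norm]
        rfl
    _ ≤ _ := by gcongr; exact E.vnorm_le_cnorm τ hb _

/-- The norm of `L_∞^c` is lower semicontinuous for the strong topology. -/
theorem cnorm_le_of_sotTendsto {ι : Type*} {l : Filter ι} [l.NeBot] {f : ι → N} {g : N} {C : ℝ≥0∞}
    (h : E.SOTTendsto τ l f g) (hf : ∀ᶠ i in l, E.cnorm τ (f i) ≤ C) : E.cnorm τ g ≤ C := by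
  rw [cnorm_le_iff]
  intro b hb
  have h1 := (h b)
  have h2 : Tendsto (fun i => E.vnorm (τ.vec b) (f i - g)) l (𝓝 0) := by
    have := (ENNReal.continuous_rpow_const (y := (1 / 2 : ℝ))).tendsto 0 |>.comp h1
    rw [ENNReal.zero_rpow_of_pos (by norm_num)] at this
    exact this
  have h3 : Tendsto (fun i => C + E.vnorm (τ.vec b) (f i - g)) l (𝓝 (C + 0)) :=
    tendsto_const_nhds.add h2
  rw [add_zero] at h3
  refine ge_of_tendsto h3 ?_
  filter_upwards [hf] with i hi
  calc E.vnorm (τ.vec b) g = E.vnorm (τ.vec b) (f i + -(f i - g)) := by congr 1; abel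
    _ ≤ _ := by
      refine (E.vnorm_add_le _ _ _).trans ?_
      rw [vnorm_neg]
      gcongr
      exact (E.vnorm_le_cnorm τ hb _).trans hi

end OperatorValuedWeight

/-! ### Averages over balls as column norms -/

namespace MetricModel

variable {M N : Type*} [CStarAlgebra M] [PartialOrder M] [StarOrderedRing M]
  [CStarAlgebra N] [PartialOrder N] [StarOrderedRing N] (τ : SemifiniteTrace M)
  (P : MetricModel M N)

/-- The seminorm `‖ρ₂(f) q_r E(q_r)^{-1/2}‖` of `f`, which is `‖R_r |f|^2‖^{1/2}`. -/
def ballNorm (r : ℝ) (f : M) : ℝ≥0∞ := P.E.cnorm τ (P.ρ₂ f * P.q r * P.dN r)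

/-- By the module property of $E$, $E(|\rho_2(f)q_rE(q_r)^{-1/2}|^2)$ is the compression that
defines $R_r|f|^2$. This is the passage from BMO seminorms to $\mathcal N$. -/
theorem ballNorm_eq {r : ℝ} (hr : 0 < r) {R : M →CP M} (hR : P.Produces r R) (f : M) :
    P.ballNorm τ r f = ‖R (absSq f)‖ₑ ^ (1 / 2 : ℝ) := by
  have h0 : 0 ≤ R (absSq f) := map_nonneg R (OperatorValuedWeight.absSq_nonneg f)
  have h1 := hR (absSq f) (OperatorValuedWeight.absSq_nonneg f) h0
  have hq : star (P.q r) = P.q r := (P.q_proj r hr).isSelfAdjoint.star_eq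
  have h2 : 0 ≤ P.q r * P.ρ₂ (absSq f) * P.q r := by
    have h3 : P.q r * P.ρ₂ (absSq f) * P.q r = star (P.ρ₂ f * P.q r) * (P.ρ₂ f * P.q r) := by
      rw [absSq, map_mul, map_star, star_mul, hq]
      simp only [mul_assoc]
    rw [h3]
    exact star_mul_self_nonneg _
  rw [ballNorm, OperatorValuedWeight.cnorm]
  have h4 : absSq (P.ρ₂ f * P.q r * P.dN r)
      = star (P.ρ₁ (P.d r)) * (P.q r * P.ρ₂ (absSq f) * P.q r) * P.ρ₁ (P.d r) := by
    rw [absSq, absSq, dN, map_mul, map_star, star_mul, star_mul, hq]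
    simp only [mul_assoc]
  rw [h4, P.E.conj _ _ h2, ← h1, τ.nrm_ofPos]

theorem ballNorm_add_le (r : ℝ) (f g : M) :
    P.ballNorm τ r (f + g) ≤ P.ballNorm τ r f + P.ballNorm τ r g := by
  simp only [ballNorm, map_add, add_mul]
  exact P.E.cnorm_add_le τ _ _

theorem ballNorm_sub_le (r : ℝ) (f g : M) :
    P.ballNorm τ r (f - g) ≤ P.ballNorm τ r f + P.ballNorm τ r g := by
  simp only [ballNorm, map_sub, sub_mul]
  exact P.E.cnorm_sub_le τ _ _

theorem ballNorm_smul_le (r : ℝ) (c : ℂ) (f : M) :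
    P.ballNorm τ r (c • f) ≤ ‖c‖ₑ * P.ballNorm τ r f := by
  simp only [ballNorm, map_smul, smul_mul_assoc]
  exact P.E.cnorm_smul_le τ _ _

theorem mul_q_mem_colSpace {s : ℝ} (hs : 0 < s) (f : N) : f * P.q s ∈ P.E.colSpace τ := by
  change P.E.cnorm τ _ < ⊤
  refine (P.E.cnorm_mul_le τ _ _).trans_lt (ENNReal.mul_lt_top (by simp) ?_)
  have hq : absSq (P.q s) = P.q s := by
    rw [absSq, (P.q_proj s hs).isSelfAdjoint.star_eq, (P.q_proj s hs).isIdempotentElem.eq]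
  rw [OperatorValuedWeight.cnorm, hq, P.E_q s hs, τ.nrm_ofPos]
  exact ENNReal.rpow_lt_top_of_nonneg (by norm_num) (by simp)

end MetricModel

/-! ### The ball estimate from Gaussian bounds and doubling -/

namespace MetricModel

variable {M N : Type*} [CStarAlgebra M] [PartialOrder M] [StarOrderedRing M]
  [CStarAlgebra N] [PartialOrder N] [StarOrderedRing N] {τ : SemifiniteTrace M}
  {P : MetricModel M N}

theorem expWeight_nonneg (m : ℝ) (k : ℕ) (x : ℝ) : 0 ≤ expWeight m k x := by
  unfold expWeight
  split_ifs
  · exact zero_le_one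
  · exact (Real.exp_pos _).le

/-- As $m/(m-1)\ge1$, the $k$-th weight is at most $\exp(-c2^k)$ for $k\ge2$, which beats every
power of $2^k$. -/
theorem summable_expWeight {m c : ℝ} (hm : 2 ≤ m) (hc : 0 < c) (s : ℝ) :
    Summable fun k : ℕ => expWeight m (k + 1) (-c) * ((2 : ℝ) ^ (k + 1)) ^ s := by
  have hg : Summable fun k : ℕ => (1 / 2 : ℝ) ^ k := summable_geometric_two
  refine Summable.of_norm_bounded_eventually_nat hg ?_
  -- One extra power of $x=2^{k+1}$ leaves a factor $x^{-1}$, hence a geometric majorant.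
  have h1 := tendsto_rpow_mul_exp_neg_mul_atTop_nhds_zero (s + 1) c hc
  have h2 : Tendsto (fun k : ℕ => (2 : ℝ) ^ (k + 1)) atTop atTop :=
    (tendsto_pow_atTop_atTop_of_one_lt one_lt_two).comp (tendsto_add_atTop_nat 1)
  have h3 := (h1.comp h2).eventually_le_const one_pos
  filter_upwards [h3, eventually_ge_atTop 1] with k hk hk1
  set x : ℝ := (2 : ℝ) ^ (k + 1) with hx
  have hx0 : 0 < x := by positivity
  rw [Real.norm_of_nonneg (mul_nonneg (expWeight_nonneg _ _ _) (by positivity))]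
  have h4 : expWeight m (k + 1) (-c) ≤ Real.exp (-c * x) := by
    rw [expWeight, if_neg (by omega)]
    rw [Real.exp_le_exp, mul_neg, neg_mul, neg_le_neg_iff, mul_comm]
    gcongr
    rw [hx, ← Real.rpow_natCast]
    refine Real.rpow_le_rpow_of_exponent_le one_le_two ?_
    rw [le_div_iff₀ (by linarith)]
    have : (0 : ℝ) ≤ ((k + 1 : ℕ) : ℝ) := by positivity
    nlinarith
  have h5 : Real.exp (-c * x) * x ^ s ≤ x⁻¹ := by
    rw [← one_div, le_div_iff₀ hx0]
    refine le_trans (le_of_eq ?_) hk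
    rw [Function.comp_apply, Real.rpow_add hx0, Real.rpow_one]
    ring
  calc _ ≤ Real.exp (-c * x) * x ^ s := by gcongr
    _ ≤ x⁻¹ := h5
    _ ≤ (1 / 2 : ℝ) ^ k := by
      rw [hx, one_div, inv_pow]
      gcongr
      · exact one_le_two
      · omega

theorem sum_b (r : ℝ) (J : ℕ) :
    ∑ k ∈ Finset.range (J + 1), P.b (k + 1) r = P.q (2 ^ (J + 1) * r) := by
  induction J with
  | zero => simp [b]
  | succ J ih =>
    rw [Finset.sum_range_succ, ih, b, if_neg (by omega)]
    simp

/-- Doubling for the annuli: the part of `ρ₂(f)` on the `k`-th annulus is controlled by the part of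
`ρ₂(f)` on the ball. -/
theorem StrongDoubling.exists_annulus_bound {A : NonUnitalSubalgebra ℂ M}
    (h : P.StrongDoubling τ A) :
    ∃ C s : ℝ, 0 ≤ C ∧ ∀ r : ℝ, 0 < r → ∀ k : ℕ, ∀ f ∈ A,
      P.E.cnorm τ (P.ρ₂ f * P.b (k + 1) r * P.dN r)
        ≤ ENNReal.ofReal (C * ((2 : ℝ) ^ (k + 1)) ^ s) * P.ballNorm τ r f := by
  obtain ⟨C, n, D, hC, hn, hD, h⟩ := h
  have key : ∀ r : ℝ, 0 < r → ∀ j : ℕ, ∀ f ∈ A,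
      P.E.cnorm τ (P.ρ₂ f * P.q (2 ^ j * r) * P.dN r)
        ≤ ENNReal.ofReal (√C * ((2 : ℝ) ^ j) ^ ((D + n) / 2)) * P.ballNorm τ r f := by
    intro r hr j f hf
    have h2 : (1 : ℝ) ≤ 2 ^ j := one_le_pow₀ one_le_two
    have h1 := h (2 ^ j * r) r r hr le_rfl (le_mul_of_one_le_left hr.le h2) f (Or.inl hf)
    rw [mul_div_cancel_right₀ _ hr.ne', mul_assoc C, ← Real.rpow_add (by positivity)] at h1
    have h3 := ENNReal.rpow_le_rpow h1 (show (0 : ℝ) ≤ 1 / 2 by norm_num)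
    rw [ENNReal.mul_rpow_of_nonneg _ _ (by norm_num),
      ENNReal.ofReal_rpow_of_nonneg (by positivity) (by norm_num), ← Real.sqrt_eq_rpow,
      Real.sqrt_mul hC.le, Real.sqrt_eq_rpow ((2 ^ j) ^ (D + n)), ← Real.rpow_mul (by positivity),
      mul_one_div] at h3
    exact h3
  -- Doubling is used with $r_2=r_3=r$; its square root gives the exponent $(D+n)/2$. The factor $2$
  -- pays for an annulus being a difference of two balls.
  refine ⟨2 * √C, (D + n) / 2, by positivity, fun r hr k f hf => ?_⟩
  rw [b]
  split_ifs with hk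
  · have hk0 : k = 0 := by omega
    subst hk0
    have := key r hr 1 f hf
    simp only [zero_add, pow_one] at this ⊢
    refine this.trans ?_
    gcongr
    linarith [Real.sqrt_nonneg C]
  · rw [mul_sub, sub_mul, Nat.add_sub_cancel]
    refine (P.E.cnorm_sub_le τ _ _).trans ?_
    rw [mul_assoc 2, two_mul, ENNReal.ofReal_add (by positivity) (by positivity), add_mul]
    refine add_le_add (key r hr (k + 1) f hf) ((key r hr k f hf).trans ?_)
    gcongr
    · exact one_le_two
    · omega

/-- The `L_2`-Gaussian estimate and doubling imply that `S_t` maps averages over balls of radius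
`t^{1/m}` to averages over any smaller ball. -/
theorem exists_ballNorm_semigroup_le {𝒮 : BoundedSemigroup τ} {A : NonUnitalSubalgebra ℂ M}
    (hA : 𝒮.IsTestAlgebra A) {π : (τ.L2 →L[ℂ] τ.L2) → Module.End ℂ (P.V τ A)}
    (hπ : P.IsAmplification 𝒮 A π) (hTi : P.ProjectionContinuity 𝒮 π) {m : ℝ} (hm : 2 ≤ m)
    (hOii : P.GaussianEstimate 𝒮 π m) (hANi : P.StrongDoubling τ A) :
    ∃ K : ℝ≥0, ∀ t r : ℝ, 0 < t → 0 < r → r ≤ t ^ (1 / m) → ∀ f ∈ A,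
      P.ballNorm τ r (𝒮.S t f) ≤ K * P.ballNorm τ (t ^ (1 / m)) f := by
  obtain ⟨C₁, c, hC₁, hc, hG⟩ := hOii
  obtain ⟨C₂, s, hC₂, hD⟩ := hANi.exists_annulus_bound
  set a : ℕ → ℝ := fun k => expWeight m (k + 1) (-c) * ((2 : ℝ) ^ (k + 1)) ^ s with ha
  have ha0 : ∀ k, 0 ≤ a k := fun k => mul_nonneg (expWeight_nonneg _ _ _) (by positivity)
  have hsum : Summable a := summable_expWeight hm hc s
  refine ⟨(C₁ * C₂ * ∑' k, a k).toNNReal, fun t r ht hr hrt f hf => ?_⟩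
  set ρ := t ^ (1 / m) with hρ
  have hρ0 : 0 < ρ := Real.rpow_pos_of_pos ht _
  have hcol : ∀ x : N, x ∈ P.E.colSpace τ → x ∈ P.V τ A := fun x hx =>
    Submodule.mem_sup_left hx
  have hbcol : ∀ k : ℕ, P.ρ₂ f * P.b (k + 1) ρ ∈ P.E.colSpace τ := by
    intro k
    rw [b]
    split_ifs
    · exact P.mul_q_mem_colSpace τ (by positivity) _
    · rw [mul_sub]
      exact Submodule.sub_mem _ (P.mul_q_mem_colSpace τ (by positivity) _)
        (P.mul_q_mem_colSpace τ (by positivity) _)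
  let v : P.V τ A := ⟨P.ρ₂ f, Submodule.mem_sup_right ⟨f, hf, rfl⟩⟩
  -- The value for $s\le0$ is arbitrary, since only $s\to\infty$ matters.
  let g : ℝ → P.V τ A := fun s =>
    if hs : 0 < s then ⟨P.ρ₂ f * P.q s, hcol _ (P.mul_q_mem_colSpace τ hs _)⟩ else 0
  have hg : ∀ s, 0 < s → (g s : N) = v * P.q s := fun s hs => by simp [g, hs, v]
  let w : ℕ → P.V τ A := fun k => ⟨P.ρ₂ f * P.b (k + 1) ρ, hcol _ (hbcol k)⟩
  -- Projection continuity concerns Schwartz functions; $F$ defines the same multiplier as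
  -- $e^{-t\lambda}$.
  obtain ⟨F, hF⟩ := exists_schwartz_eq_exp ht
  set T := π (𝒮.mult fun l => Complex.exp (-(t * l : ℂ))) with hT
  have hFT : π (𝒮.mult F) = T := by rw [hT, 𝒮.mult_congr hF]
  have hlim := hTi r hr F v g hg
  rw [hFT, hπ.semigroup hA ht.le hf v rfl] at hlim
  have hJ : Tendsto (fun J : ℕ => (2 : ℝ) ^ (J + 1) * ρ) atTop atTop :=
    ((tendsto_pow_atTop_atTop_of_one_lt one_lt_two).comp
      (tendsto_add_atTop_nat 1)).atTop_mul_const hρ0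
  have hlim2 : P.E.SOTTendsto τ atTop
      (fun J : ℕ => (T (g ((2 : ℝ) ^ (J + 1) * ρ)) : N) * P.q r * P.dN r)
      (P.ρ₂ (𝒮.S t f) * P.q r * P.dN r) := fun b => (hlim b).comp hJ
  refine P.E.cnorm_le_of_sotTendsto τ hlim2 (Eventually.of_forall fun J => ?_)
  have hgw : g ((2 : ℝ) ^ (J + 1) * ρ) = ∑ k ∈ Finset.range (J + 1), w k := by
    apply Subtype.ext
    rw [hg _ (by positivity), ← sum_b, Submodule.coe_sum, Finset.mul_sum]
  rw [hgw, map_sum, Submodule.coe_sum, Finset.sum_mul, Finset.sum_mul]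
  refine (P.E.cnorm_sum_le τ _ _).trans ?_
  have hterm : ∀ k : ℕ, P.E.cnorm τ ((T (w k) : N) * P.q r * P.dN r)
      ≤ ENNReal.ofReal (C₁ * C₂ * a k) * P.ballNorm τ ρ f := by
    intro k
    have h1 := hG t (k + 1) r ρ ht (by omega) hr hrt (P.ρ₂ f) (w k) rfl
    -- With $r_2=\rho=t^{1/m}$ the weight is $E_k(-c)$, free of $t$, and $\max\{r,\rho\}=\rho$
    -- normalizes the right side at $\rho$ however small $r$ is.
    rw [← hρ, max_eq_right hrt, div_self hρ0.ne', Real.one_rpow, mul_one] at h1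
    refine h1.trans ((mul_le_mul_right (hD ρ hρ0 k f hf) _).trans ?_)
    rw [← mul_assoc, ← ENNReal.ofReal_mul (mul_nonneg hC₁.le (expWeight_nonneg _ _ _))]
    refine mul_le_mul_left (ENNReal.ofReal_le_ofReal (le_of_eq ?_)) _
    simp only [ha]
    ring
  refine (Finset.sum_le_sum fun k _ => hterm k).trans ?_
  rw [← Finset.sum_mul]
  gcongr
  rw [← ENNReal.ofReal_sum_of_nonneg (fun k _ => by have := ha0 k; positivity), ← Finset.mul_sum]
  refine ENNReal.ofReal_le_ofReal ?_
  gcongr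
  exact hsum.sum_le_tsum _ (fun k _ => ha0 k)

end MetricModel

/-! ### Powers of $S_t$ and of $1-S_t$ -/

namespace BoundedSemigroup

variable {M : Type*} [CStarAlgebra M] [PartialOrder M] [StarOrderedRing M]
  {τ : SemifiniteTrace M} (𝒮 : BoundedSemigroup τ)

/-- The linear operator `S_t`. -/
def toEnd (t : ℝ) : Module.End ℂ M := (𝒮.S t).toLinearMap

theorem toEnd_apply (t : ℝ) (f : M) : 𝒮.toEnd t f = 𝒮.S t f := rfl

theorem toEnd_two_mul {t : ℝ} (ht : 0 ≤ t) : 𝒮.toEnd (2 * t) = 𝒮.toEnd t ^ 2 := by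
  ext f
  rw [two_mul, toEnd_apply, 𝒮.add t t ht ht, sq]
  rfl

/-- Uniform in $t$; needed for the a priori finiteness of the supremum absorbed in
`BallBound.exists_bmo_le_succ`. -/
theorem norm_one_sub_pow_le {K : ℝ} (hK : 1 ≤ K) (hb : ∀ t, 0 ≤ t → ∀ f, ‖𝒮.S t f‖ ≤ K * ‖f‖)
    {t : ℝ} (ht : 0 ≤ t) (n : ℕ) (f : M) :
    ‖((1 - 𝒮.toEnd t) ^ n) f‖ ≤ (1 + K) ^ n * ‖f‖ := by
  induction n with
  | zero => simp
  | succ n ih =>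
    have e : ((1 - 𝒮.toEnd t) ^ (n + 1)) f
        = ((1 - 𝒮.toEnd t) ^ n) f - 𝒮.S t (((1 - 𝒮.toEnd t) ^ n) f) := by
      rw [pow_succ']
      rfl
    rw [e]
    calc _ ≤ ‖((1 - 𝒮.toEnd t) ^ n) f‖ + K * ‖((1 - 𝒮.toEnd t) ^ n) f‖ :=
          (norm_sub_le _ _).trans (by gcongr; exact hb t ht _)
      _ = (1 + K) * ‖((1 - 𝒮.toEnd t) ^ n) f‖ := by ring
      _ ≤ (1 + K) * ((1 + K) ^ n * ‖f‖) := by gcongr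
      _ = _ := by ring

variable {𝒮} {A : NonUnitalSubalgebra ℂ M}

theorem IsTestAlgebra.toEnd_pow_mem (hA : 𝒮.IsTestAlgebra A) {t : ℝ} (ht : 0 ≤ t) (n : ℕ)
    {f : M} (hf : f ∈ A) : (𝒮.toEnd t ^ n) f ∈ A := by
  induction n with
  | zero => exact hf
  | succ n ih =>
    rw [pow_succ']
    exact hA.semigroup_mem ht ih

theorem IsTestAlgebra.one_sub_pow_mem (hA : 𝒮.IsTestAlgebra A) {t : ℝ} (ht : 0 ≤ t) (n : ℕ)
    {f : M} (hf : f ∈ A) : ((1 - 𝒮.toEnd t) ^ n) f ∈ A := by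
  induction n with
  | zero => exact hf
  | succ n ih =>
    rw [pow_succ']
    exact sub_mem ih (hA.semigroup_mem ht ih)

end BoundedSemigroup

theorem CompletelyPositiveMap.norm_absSq_le {M : Type*} [CStarAlgebra M] [PartialOrder M]
    [StarOrderedRing M] (R : M →CP M) (hR : R 1 = 1) (f : M) : ‖R (absSq f)‖ ≤ ‖f‖ ^ 2 := by
  have h0 : 0 ≤ absSq f := star_mul_self_nonneg f
  have h1 := OrderHomClass.mono R h0.isSelfAdjoint.le_algebraMap_norm_self
  rw [Algebra.algebraMap_eq_smul_one, ← Complex.coe_smul, map_smul, hR] at h1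
  have h2 := CStarAlgebra.norm_le_norm_of_nonneg_of_le (map_nonneg R h0) h1
  refine h2.trans ?_
  rw [norm_smul, absSq, CStarRing.norm_star_mul_self, Complex.norm_real, norm_mul, norm_norm, ← sq]
  refine mul_le_of_le_one_right (by positivity) ?_
  rcases subsingleton_or_nontrivial M with h | h
  · rw [Subsingleton.elim (1 : M) 0, norm_zero]; exact zero_le_one
  · exact CStarRing.norm_one.le

/-! ### Comparison of seminorms of consecutive orders -/

namespace MetricModel

open Polynomial

variable {M N : Type*} [CStarAlgebra M] [PartialOrder M] [StarOrderedRing M]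
  [CStarAlgebra N] [PartialOrder N] [StarOrderedRing N] {τ : SemifiniteTrace M}
  {P : MetricModel M N} {𝒮 : BoundedSemigroup τ} {A : NonUnitalSubalgebra ℂ M} {m : ℝ}

/-- `S_t` maps averages over balls of radius `t^{1/m}` to averages over smaller balls. -/
def BallBound (P : MetricModel M N) (𝒮 : BoundedSemigroup τ) (A : NonUnitalSubalgebra ℂ M)
    (m : ℝ) (K : ℝ≥0) : Prop :=
  ∀ t r : ℝ, 0 < t → 0 < r → r ≤ t ^ (1 / m) → ∀ f ∈ A,
    P.ballNorm τ r (𝒮.S t f) ≤ K * P.ballNorm τ (t ^ (1 / m)) f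

theorem BallBound.pow_le {K : ℝ≥0} (hB : P.BallBound 𝒮 A m K) (hA : 𝒮.IsTestAlgebra A) {t : ℝ}
    (ht : 0 < t) (n : ℕ) {f : M} (hf : f ∈ A) :
    P.ballNorm τ (t ^ (1 / m)) ((𝒮.toEnd t ^ n) f)
      ≤ (K ^ n : ℝ≥0) * P.ballNorm τ (t ^ (1 / m)) f := by
  induction n with
  | zero => simp
  | succ n ih =>
    rw [pow_succ']
    refine (hB t _ ht (Real.rpow_pos_of_pos ht _) le_rfl _ (hA.toEnd_pow_mem ht.le n hf)).trans ?_
    rw [pow_succ', ENNReal.coe_mul, mul_assoc]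
    gcongr

theorem BallBound.one_sub_pow_le {K : ℝ≥0} (hB : P.BallBound 𝒮 A m K) (hA : 𝒮.IsTestAlgebra A)
    {t : ℝ} (ht : 0 < t) (n : ℕ) {f : M} (hf : f ∈ A) :
    P.ballNorm τ (t ^ (1 / m)) (((1 - 𝒮.toEnd t) ^ n) f)
      ≤ ((1 + K) ^ n : ℝ≥0) * P.ballNorm τ (t ^ (1 / m)) f := by
  induction n with
  | zero => simp
  | succ n ih =>
    rw [pow_succ']
    change P.ballNorm τ _ (((1 - 𝒮.toEnd t) ^ n) f - 𝒮.S t (((1 - 𝒮.toEnd t) ^ n) f)) ≤ _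
    refine (P.ballNorm_sub_le τ _ _ _).trans ((add_le_add_right
      (hB t _ ht (Real.rpow_pos_of_pos ht _) le_rfl _ (hA.one_sub_pow_mem ht.le n hf)) _).trans ?_)
    rw [← one_add_mul, pow_succ', ENNReal.coe_mul, mul_assoc, ENNReal.coe_add, ENNReal.coe_one]
    gcongr

/-- One factor $S_t$ pays for the passage from radius $t^{1/m}$ to the smaller $r$; all other powers
act at radius $t^{1/m}$. Hence the extra $S_t$ in front of $f$. -/
theorem BallBound.exists_aeval_le {K : ℝ≥0} (hB : P.BallBound 𝒮 A m K) (hA : 𝒮.IsTestAlgebra A)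
    (p : ℂ[X]) : ∃ C : ℝ≥0, ∀ t r : ℝ, 0 < t → 0 < r → r ≤ t ^ (1 / m) → ∀ f ∈ A,
      P.ballNorm τ r (aeval (𝒮.toEnd t) p (𝒮.S t f)) ≤ C * P.ballNorm τ (t ^ (1 / m)) f := by
  induction p using Polynomial.induction_on' with
  | add p q hp hq =>
    obtain ⟨C₁, h₁⟩ := hp
    obtain ⟨C₂, h₂⟩ := hq
    refine ⟨C₁ + C₂, fun t r ht hr hrt f hf => ?_⟩
    rw [map_add, LinearMap.add_apply, ENNReal.coe_add, add_mul]
    exact (P.ballNorm_add_le τ _ _ _).trans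
      (add_le_add (h₁ t r ht hr hrt f hf) (h₂ t r ht hr hrt f hf))
  | monomial n a =>
    refine ⟨‖a‖₊ * (K * K ^ n), fun t r ht hr hrt f hf => ?_⟩
    have e : aeval (𝒮.toEnd t) (monomial n a) (𝒮.S t f) = a • 𝒮.S t ((𝒮.toEnd t ^ n) f) := by
      rw [aeval_monomial, ← Algebra.smul_def, LinearMap.smul_apply, ← 𝒮.toEnd_apply,
        ← 𝒮.toEnd_apply, ← Module.End.mul_apply, ← Module.End.mul_apply, ← pow_succ, ← pow_succ']
    rw [e]
    refine (P.ballNorm_smul_le τ _ _ _).trans ?_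
    rw [ENNReal.coe_mul, ENNReal.coe_mul, mul_assoc, mul_assoc]
    change (‖a‖₊ : ℝ≥0∞) * _ ≤ _
    gcongr
    refine (hB t r ht hr hrt _ (hA.toEnd_pow_mem ht.le n hf)).trans ?_
    gcongr
    exact hB.pow_le hA ht n hf

/-- After removing $(1-X)^nX$, the difference is $2^n-(1+X)^nX$, which vanishes at $X=1$ and so
supplies one more factor $1-X$. -/
theorem exists_polynomial_identity (n : ℕ) : ∃ q : ℂ[X],
    (2 : ℂ[X]) ^ n * ((1 - X) ^ n * X) = (1 - X ^ 2) ^ n * X ^ 2 + q * X * (1 - X) ^ (n + 1) := by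
  have h : (C 2 ^ n - (1 + X) ^ n * X : ℂ[X]).IsRoot 1 := by
    simp only [IsRoot.def, eval_sub, eval_pow, eval_C, eval_mul, eval_add, eval_one, eval_X, mul_one]
    norm_num
  obtain ⟨q, hq⟩ := dvd_iff_isRoot.2 h
  refine ⟨-q, ?_⟩
  have e1 : (1 - X ^ 2 : ℂ[X]) ^ n = (1 - X) ^ n * (1 + X) ^ n := by
    rw [← mul_pow]; ring
  rw [e1]
  rw [C_1] at hq
  have hq' : (2 : ℂ[X]) ^ n - (1 + X) ^ n * X = (X - 1) * q := by
    rw [← hq]; rfl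
  linear_combination (1 - X) ^ n * X * hq'

variable {𝒬 : PMetric 𝒮 m}

theorem bmo_eq (hP : ∀ r, 0 < r → P.Produces r (𝒬.R 0 r)) (k : ℕ) (f : M) :
    𝒬.bmo k f = ⨆ t : ℝ, ⨆ _ : 0 < t,
      P.ballNorm τ (t ^ (1 / m)) (((1 - 𝒮.toEnd t) ^ k) f) := by
  unfold PMetric.bmo
  refine iSup_congr fun t => iSup_congr fun ht => ?_
  have hr : 0 < t ^ (1 / m) := Real.rpow_pos_of_pos ht _
  rw [P.ballNorm_eq τ hr (hP _ hr)]
  rfl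

theorem ballNorm_le_bmo (hP : ∀ r, 0 < r → P.Produces r (𝒬.R 0 r)) (k : ℕ) (f : M) {t : ℝ}
    (ht : 0 < t) :
    P.ballNorm τ (t ^ (1 / m)) (((1 - 𝒮.toEnd t) ^ k) f) ≤ 𝒬.bmo k f := by
  rw [bmo_eq hP]
  exact le_iSup₂ (f := fun (t : ℝ) (_ : 0 < t) =>
    P.ballNorm τ (t ^ (1 / m)) (((1 - 𝒮.toEnd t) ^ k) f)) t ht

theorem ballNorm_le_enorm (hP : ∀ r, 0 < r → P.Produces r (𝒬.R 0 r)) {r : ℝ} (hr : 0 < r)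
    (f : M) : P.ballNorm τ r f ≤ ‖f‖ₑ := by
  rw [P.ballNorm_eq τ hr (hP _ hr), one_div, ENNReal.rpow_inv_le_iff two_pos, ← ofReal_norm,
    ← ofReal_norm, ENNReal.ofReal_rpow_of_nonneg (norm_nonneg _) two_pos.le, Real.rpow_two]
  exact ENNReal.ofReal_le_ofReal ((𝒬.R 0 r).norm_absSq_le (𝒬.R_one 0 r hr) f)

/-- Higher order seminorms are controlled by the seminorm of order one. -/
theorem BallBound.bmo_succ_le {K : ℝ≥0} (hB : P.BallBound 𝒮 A m K) (hA : 𝒮.IsTestAlgebra A)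
    (hP : ∀ r, 0 < r → P.Produces r (𝒬.R 0 r)) (n : ℕ) {f : M} (hf : f ∈ A) :
    𝒬.bmo (n + 1) f ≤ ((1 + K) ^ n : ℝ≥0) * 𝒬.bmo 1 f := by
  rw [bmo_eq hP]
  refine iSup₂_le fun t ht => ?_
  rw [pow_succ, Module.End.mul_apply]
  have hg := hA.one_sub_pow_mem ht.le 1 hf
  have h1 := ballNorm_le_bmo hP 1 f ht
  rw [pow_one] at hg h1
  refine (hB.one_sub_pow_le hA ht n hg).trans ?_
  gcongr

/-- The order of the seminorm can be lowered by one. -/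
theorem BallBound.exists_bmo_le_succ {K : ℝ≥0} (hB : P.BallBound 𝒮 A m K)
    (hA : 𝒮.IsTestAlgebra A) (hm : 0 < m) (hP : ∀ r, 0 < r → P.Produces r (𝒬.R 0 r)) {n : ℕ}
    (hn : 1 ≤ n) : ∃ C : ℝ≥0, ∀ f ∈ A, 𝒬.bmo n f ≤ C * 𝒬.bmo (n + 1) f := by
  obtain ⟨q, hq⟩ := exists_polynomial_identity n
  obtain ⟨C, hC⟩ := hB.exists_aeval_le hA q
  refine ⟨C + 1, fun f hf => ?_⟩
  set β := 𝒬.bmo (n + 1) f with hβ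
  -- Time doubles while the radius $r$ stays fixed; this is why the ball estimate is needed for all
  -- $r\le t^{1/m}$.
  have hrec : ∀ t r : ℝ, 0 < t → 0 < r → r ≤ t ^ (1 / m) →
      P.ballNorm τ r (((1 - 𝒮.toEnd t) ^ n) (𝒮.S t f))
        ≤ 2⁻¹ * (P.ballNorm τ r (((1 - 𝒮.toEnd (2 * t)) ^ n) (𝒮.S (2 * t) f)) + C * β) := by
    intro t r ht hr hrt
    have h1 := congrArg (fun p => aeval (𝒮.toEnd t) p f) hq
    simp only [map_add, map_sub, map_mul, map_pow, map_one, aeval_X, ← 𝒮.toEnd_two_mul ht.le,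
      LinearMap.add_apply] at h1
    have h2 : (aeval (𝒮.toEnd t) (2 : ℂ[X]) : Module.End ℂ M) = algebraMap ℂ _ 2 := by
      rw [← aeval_C]; rfl
    rw [h2, ← map_pow, ← Algebra.smul_def, LinearMap.smul_apply] at h1
    have h3 : ((1 - 𝒮.toEnd t) ^ n) (𝒮.S t f)
        = ((2 : ℂ) ^ n)⁻¹ • (((1 - 𝒮.toEnd (2 * t)) ^ n) (𝒮.S (2 * t) f)
          + aeval (𝒮.toEnd t) q (𝒮.S t (((1 - 𝒮.toEnd t) ^ (n + 1)) f))) := by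
      rw [eq_inv_smul_iff₀ (by positivity)]
      exact h1
    rw [h3]
    refine (P.ballNorm_smul_le τ _ _ _).trans ?_
    gcongr
    -- Since $n\ge1$, $2^{-n}\le\frac12$; a contraction factor below $1$ is what the absorption
    -- requires.
    · rw [enorm_inv (by positivity), ENNReal.inv_le_inv, enorm_pow]
      have : ‖(2 : ℂ)‖ₑ = 2 := by
        rw [← ofReal_norm]; simp
      rw [this]
      exact le_self_pow₀ one_le_two (by omega)
    · refine (P.ballNorm_add_le τ _ _ _).trans ?_
      gcongr
      refine (hC t r ht hr hrt _ (hA.one_sub_pow_mem ht.le (n + 1) hf)).trans ?_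
      gcongr
      exact ballNorm_le_bmo hP (n + 1) f ht
  have hmain : ∀ t : ℝ, 0 < t →
      P.ballNorm τ (t ^ (1 / m)) (((1 - 𝒮.toEnd t) ^ n) (𝒮.S t f)) ≤ C * β := by
    intro t ht
    set r := t ^ (1 / m) with hr
    have hr0 : 0 < r := Real.rpow_pos_of_pos ht _
    set u : ℝ≥0∞ := ⨆ s : ℝ, ⨆ _ : 0 < s ∧ r ≤ s ^ (1 / m),
      P.ballNorm τ r (((1 - 𝒮.toEnd s) ^ n) (𝒮.S s f)) with hu
    have hle : ∀ s : ℝ, 0 < s ∧ r ≤ s ^ (1 / m) →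
        P.ballNorm τ r (((1 - 𝒮.toEnd s) ^ n) (𝒮.S s f)) ≤ u := fun s hs =>
      le_iSup₂ (f := fun (s : ℝ) (_ : 0 < s ∧ r ≤ s ^ (1 / m)) =>
        P.ballNorm τ r (((1 - 𝒮.toEnd s) ^ n) (𝒮.S s f))) s hs
    have hut : u ≠ ⊤ := by
      obtain ⟨K', hK', hb⟩ := 𝒮.exists_bound
      refine ne_top_of_le_ne_top (b := ENNReal.ofReal ((1 + K') ^ n * (K' * ‖f‖)))
        ENNReal.ofReal_ne_top (iSup₂_le fun s hs => ?_)
      refine (ballNorm_le_enorm hP hr0 _).trans ?_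
      rw [← ofReal_norm]
      refine ENNReal.ofReal_le_ofReal ((𝒮.norm_one_sub_pow_le hK' hb hs.1.le n _).trans ?_)
      gcongr
      exact hb s hs.1.le f
    have hu1 : u ≤ 2⁻¹ * (u + C * β) := by
      refine iSup₂_le fun s hs => (hrec s r hs.1 hr0 hs.2).trans ?_
      gcongr
      refine hle (2 * s) ⟨by linarith [hs.1], hs.2.trans ?_⟩
      exact Real.rpow_le_rpow hs.1.le (by linarith [hs.1]) (by positivity)
    -- $2u\le u+C\beta$, and one $u$ cancels because $u$ is finite.
    have hu2 : u ≤ C * β := by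
      have h := mul_le_mul_right hu1 2
      rw [← mul_assoc, ENNReal.mul_inv_cancel two_ne_zero ENNReal.ofNat_ne_top, one_mul,
        two_mul] at h
      exact (ENNReal.add_le_add_iff_left hut).1 h
    exact (hle t ⟨ht, le_rfl⟩).trans hu2
  rw [bmo_eq hP]
  refine iSup₂_le fun t ht => ?_
  -- Splitting $f=S_tf+(1-S_t)f$ restores the part without the factor $S_t$, at the cost of one
  -- seminorm of order $n+1$.
  have e : ((1 - 𝒮.toEnd t) ^ n) f
      = ((1 - 𝒮.toEnd t) ^ n) (𝒮.S t f) + ((1 - 𝒮.toEnd t) ^ (n + 1)) f := by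
    have e1 : ((1 - 𝒮.toEnd t) ^ (n + 1)) f = ((1 - 𝒮.toEnd t) ^ n) (f - 𝒮.S t f) := by
      rw [pow_succ]; rfl
    rw [e1, ← map_add, add_sub_cancel]
  rw [e, ENNReal.coe_add, ENNReal.coe_one, add_mul, one_mul]
  exact (P.ballNorm_add_le τ _ _ _).trans
    (add_le_add (hmain t ht) (ballNorm_le_bmo hP (n + 1) f ht))

end MetricModel

end

/-! ### Equivalence of the seminorms of all orders -/

theorem proposition2p11 {M N : Type*}
    [CStarAlgebra M] [PartialOrder M] [StarOrderedRing M] [WStarAlgebra M]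
    [CStarAlgebra N] [PartialOrder N] [StarOrderedRing N] [WStarAlgebra N]
    (τ : SemifiniteTrace M) (𝒮 : BoundedSemigroup τ)
    (m : ℝ) (hm : 2 ≤ m) (𝒬 : PMetric 𝒮 m)
    (A : NonUnitalSubalgebra ℂ M) (hA : 𝒮.IsTestAlgebra A)
    (P : MetricModel M N) (hP : ∀ r, 0 < r → P.Produces r (𝒬.R 0 r))
    (π : (τ.L2 →L[ℂ] τ.L2) → Module.End ℂ (P.V τ A)) (hπ : P.IsAmplification 𝒮 A π)
    (hALi : P.Monotonicity) (hALii : P.RightModularity 𝒮 π)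
    (hTi : P.ProjectionContinuity 𝒮 π) (hTii : P.AmplificationContinuity 𝒮 π)
    (hOi : P.Boundedness 𝒮 π) (hOii : P.GaussianEstimate 𝒮 π m)
    (hANi : P.StrongDoubling τ A)
    (k : ℕ) (hk : 1 ≤ k) :
    ∃ C : ℝ≥0, 0 < C ∧ ∀ f ∈ A,
      𝒬.bmo 1 f ≤ C * 𝒬.bmo k f ∧ 𝒬.bmo k f ≤ C * 𝒬.bmo 1 f := by
  obtain ⟨K, hB⟩ := MetricModel.exists_ballNorm_semigroup_le hA hπ hTi hm hOii hANi
  have hB' : P.BallBound 𝒮 A m K := hB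
  have hlower : ∃ C : ℝ≥0, ∀ f ∈ A, 𝒬.bmo 1 f ≤ C * 𝒬.bmo k f := by
    induction k, hk using Nat.le_induction with
    | base => exact ⟨1, fun f _ => by simp⟩
    | succ n hn ih =>
      obtain ⟨C₁, h₁⟩ := ih
      obtain ⟨C₂, h₂⟩ := hB'.exists_bmo_le_succ hA (by linarith) hP hn
      refine ⟨C₁ * C₂, fun f hf => (h₁ f hf).trans ?_⟩
      rw [ENNReal.coe_mul, mul_assoc]
      gcongr
      exact h₂ f hf
  obtain ⟨C, hC⟩ := hlower
  obtain ⟨n, rfl⟩ : ∃ n, k = n + 1 := ⟨k - 1, by omega⟩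
  refine ⟨C + (1 + K) ^ n, by positivity, fun f hf => ⟨(hC f hf).trans ?_, ?_⟩⟩
  · gcongr
    exact le_self_add
  · refine (hB'.bmo_succ_le hA hP n hf).trans ?_
    gcongr
    exact le_add_self
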